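/- Let $G$ be a connected, simply connected, simple complex linear algebraic group, $T\subseteq B\subseteq P\subseteq G$ a maximal torus, a Borel subgroup and a parabolic subgroup, and $X=G/P$. Let $R$ be the root system of $(G,T)$ (reduced, irreducible, crystallographic), $W$ its Weyl group, $\Delta$ the base belonging to $B$, $\Delta_P\subseteq\Delta$ the subset belonging to $P$, $R_P=R\cap\mathbb Z\Delta_P$, and let $R^{\pm}$, $R_P^{\pm}=R_P\cap R^\pm$ be the sets of positive and negative roots. Let $(-,-)$ be a $W$-invariant scalar product on $\mathbb R\Delta$ and $\alpha^\vee=2\alpha/(\alpha,\alpha)$. Write $W_P$ for the subgroup of $W$ generated by the $s_\beta$, $\beta\in\Delta_P$, and $w_P$ for its longest element. Identify $H_2(X)=\mathbb Z\Delta^\vee/\mathbb Z\Delta_P^\vee$, and put $d\le d'$ if $(\omega_\beta,d'-d)\ge 0$ for all $\beta\in\Delta\setminus\Delta_P$, where $\omega_\beta$ is the fundamental weight; a degree is an element $d\ge 0$. A maximal root of $d$ is a maximal element (for the usual partial order on roots) of $\{\alpha\in R^+\setminus R_P^+\mid \alpha^\vee+\mathbb Z\Delta_P^\vee\le d\}$.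 A sequence $(\alpha_1,\dots,\alpha_r)$ is a greedy decomposition of $d$ if $\alpha_1$ is a maximal root of $d$ and $(\alpha_2,\dots,\alpha_r)$ is a greedy decomposition of $d-(\alpha_1^\vee+\mathbb Z\Delta_P^\vee)$, the empty sequence being the only greedy decomposition of $0$; every degree has a greedy decomposition, unique up to reordering. Define $z_d^P\in W$ by $z_d^Pw_P=s_{\alpha_1}\cdot\ldots\cdot s_{\alpha_r}\cdot w_P$, where $\cdot$ is the Hecke (Demazure) product on $W$. A degree $d$ is minimal if it is a minimal element of the set of degrees $d'$ with $z_d^P\le z_{d'}^P$ in the Bruhat order. The lifting of a minimal degree $d\in H_2(X)$ is the minimal degree $e\in H_2(G/B)$ with $z_d^Pw_P=z_e^B$. Let $\mathcal B_{R,e}$ be the set of positive roots that occur in a greedy decomposition of $e$. Let $d$ be a minimal degree in $H_2(X)$ and let $e$ be its lifting. For $\alpha\in\mathcal B_{R,e}\setminus R_P^+$ and $\gamma\in R_P^+$ with $(\alpha,\gamma)<0$, say that $(\alpha',\gamma')$ is associated to $(\alpha,\gamma)$ if $\alpha'\in\mathcal B_{R,e}\setminus R_P^+$, $(\alpha',\gamma)>0$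 and $\gamma'=-z_e^B(\gamma)$. Let $$\mathcal D=\{(\alpha,\gamma)\in(\mathcal B_{R,e}\setminus R_P^+)\times R_P^+\mid (\gamma,\alpha^\vee)<-1\}$$ and let $\widetilde{\mathrm{TD}}_{P,d}$, the set of additional tangent directions, be the set of all $-\alpha'+\gamma'\in R^-\setminus R_P^-$ such that $(\alpha',\gamma')$ is associated to some $(\alpha,\gamma)\in\mathcal D$. **Corollary.** For every $(\alpha,\gamma)\in\mathcal D$ there is exactly one associated pair $(\alpha',\gamma')$, and the assignment $(\alpha,\gamma)\mapsto-\alpha'+\gamma'$ is a bijection $\mathcal D\xrightarrow{\sim}\widetilde{\mathrm{TD}}_{P,d}$. -/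

import Mathlib

/-!
Throughout, `P` is a reduced irreducible crystallographic root system over `ℝ` (the root system `R`
of a simple group `G` relative to a maximal torus `T`), indexed by `ι`; a root is referred to by its
index. `b` is the base `Δ` belonging to a Borel subgroup, and `J ⊆ Δ` is the set `Δ_P` of simple
roots of a standard parabolic subgroup. The flag variety is `X = G/P`. The case `J = ∅` is `G/B`.
-/

noncomputable section

namespace MinimalDegrees

open Module

variable {ι M N : Type*} [AddCommGroup M] [Module ℝ M] [AddCommGroup N] [Module ℝ N]
  {P : RootPairing ι ℝ M N}

/-! ### Roots -/

section Roots

variable (b : P.Base)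

/-- The set `R_P` of roots lying in the span of `Δ_P`: the roots of the Levi factor. -/
def leviRoots (J : Set b.support) : Set ι :=
  {i | P.root i ∈ Submodule.span ℤ ((fun j : b.support ↦ P.root j) '' J)}

/-- The set `R_P⁺` of positive roots of the Levi factor. -/
def leviPosRoots (J : Set b.support) : Set ι :=
  {i | b.IsPos i ∧ i ∈ leviRoots b J}

/-- The set `R⁺ ∖ R_P⁺`. -/
def nonLeviPosRoots (J : Set b.support) : Set ι :=
  {i | b.IsPos i ∧ i ∉ leviPosRoots b J}

/-- The set `R⁻ ∖ R_P⁻ = -(R⁺ ∖ R_P⁺)`, as a set of vectors. -/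
def nonLeviNegRoots (J : Set b.support) : Set M :=
  {x | ∃ i ∈ nonLeviPosRoots b J, x = -P.root i}

/-- The usual partial order on roots: `α ≤ α'` if `α' - α` is a sum of simple roots. -/
def RootLE (i j : ι) : Prop :=
  P.root j - P.root i ∈ AddSubmonoid.closure (P.root '' b.support)

end Roots

/-! ### The Weyl group: length, Bruhat order, Hecke product -/

section Weyl

variable (b : P.Base)

/-- The product of the simple reflections in a word. -/
def wordProd (l : List b.support) : P.weylGroup :=
  (l.map fun i ↦ RootPairing.weylGroup.ofIdx P (i : ι)).prod

/-- The length `ℓ(w)`: the least length of a word in the simple reflections representing `w`. -/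
def length (w : P.weylGroup) : ℕ :=
  sInf {n | ∃ l : List b.support, l.length = n ∧ wordProd b l = w}

/-- `l` is a reduced word (reduced expression) of `w`. -/
def IsReducedWord (l : List b.support) (w : P.weylGroup) : Prop :=
  wordProd b l = w ∧ l.length = length b w

/-- The Bruhat order on `W`, generated by `u < u s_α` whenever `ℓ(u) < ℓ(u s_α)`, for `α` in `R`. -/
def BruhatLE : P.weylGroup → P.weylGroup → Prop :=
  Relation.ReflTransGen fun u v ↦
    ∃ i : ι, v = u * RootPairing.weylGroup.ofIdx P i ∧ length b u < length b v

/-- `u · s_β` for a simple reflection `s_β`: it is `u s_β` if this is longer than `u`,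
and `u` otherwise. -/
def heckeStep (u : P.weylGroup) (i : b.support) : P.weylGroup :=
  open scoped Classical in
  if length b u < length b (u * RootPairing.weylGroup.ofIdx P (i : ι)) then
    u * RootPairing.weylGroup.ofIdx P (i : ι) else u

section

variable [Finite ι] [P.IsCrystallographic] [P.IsReduced]

/-- The simple reflections generate the Weyl group. -/
theorem exists_wordProd_eq (w : P.weylGroup) : ∃ l : List b.support, wordProd b l = w := by
  have hmul (l₁ l₂ : List b.support) :
      wordProd b (l₁ ++ l₂) = wordProd b l₁ * wordProd b l₂ := by simp [wordProd]
  have hrefl (i j : ι) : RootPairing.weylGroup.ofIdx P (P.reflectionPerm j i) =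
      RootPairing.weylGroup.ofIdx P j * RootPairing.weylGroup.ofIdx P i *
        RootPairing.weylGroup.ofIdx P j := by
    apply Subtype.ext
    apply RootPairing.Equiv.weightHom_injective P
    ext x
    have := congrArg (fun f : M ≃ₗ[ℝ] M ↦ f x) (P.reflection_reflectionPerm (i := i) (j := j))
    simpa [RootPairing.weylGroup.ofIdx] using this
  have hidx (i : ι) : ∃ l : List b.support,
      wordProd b l = RootPairing.weylGroup.ofIdx P i := by
    refine b.induction_reflect i
      (p := fun i ↦ ∃ l : List b.support, wordProd b l = RootPairing.weylGroup.ofIdx P i) ?_ ?_ ?_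
    · rintro i ⟨l, hl⟩
      exact ⟨l ++ l ++ l, by rw [hmul, hmul, hl, hrefl]⟩
    · intro i hi
      exact ⟨[⟨i, hi⟩], by simp [wordProd]⟩
    · rintro i j ⟨l, hl⟩ hj
      refine ⟨[⟨j, hj⟩] ++ l ++ [⟨j, hj⟩], ?_⟩
      rw [hmul, hmul, hl, hrefl]
      simp [wordProd]
  obtain ⟨w, hw⟩ := w
  induction hw using RootPairing.weylGroup.induction with
  | mem i => exact hidx i
  | one => exact ⟨[], rfl⟩
  | mul x y hx hy h₁ h₂ =>
    obtain ⟨l₁, h₁⟩ := h₁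
    obtain ⟨l₂, h₂⟩ := h₂
    exact ⟨l₁ ++ l₂, by rw [hmul, h₁, h₂]; rfl⟩

theorem exists_isReducedWord (w : P.weylGroup) : ∃ l : List b.support, IsReducedWord b l w := by
  have hne : {n | ∃ l : List b.support, l.length = n ∧ wordProd b l = w}.Nonempty := by
    obtain ⟨l, hl⟩ := exists_wordProd_eq b w
    exact ⟨l.length, l, rfl, hl⟩
  obtain ⟨l, hl, hl'⟩ := Nat.sInf_mem hne
  exact ⟨l, hl', hl⟩

/-- The Hecke product `u · v = u · s_{β₁} · … · s_{βₖ}`, for a reduced word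
`s_{β₁} ⋯ s_{βₖ}` of `v` (the result does not depend on the chosen reduced word). -/
def hecke (u v : P.weylGroup) : P.weylGroup :=
  (exists_isReducedWord b v).choose.foldl (heckeStep b) u

end

/-- The Weyl group `W_P` generated by the reflections in the roots of `Δ_P`. -/
def leviWeylGroup (J : Set b.support) : Subgroup P.weylGroup :=
  Subgroup.closure ((fun j : b.support ↦ RootPairing.weylGroup.ofIdx P (j : ι)) '' J)

section

variable [Finite ι] [P.IsRootSystem]

theorem finite_weylGroup (P : RootPairing ι ℝ M N) [P.IsRootSystem] : Finite P.weylGroup := by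
  refine Finite.of_injective (fun w : P.weylGroup ↦ P.weylGroupToPerm w) fun u v h ↦ ?_
  apply Subtype.ext
  apply RootPairing.Equiv.weightHom_injective P
  apply LinearEquiv.toLinearMap_injective
  refine LinearMap.ext_on_range (v := P.root) RootPairing.IsRootSystem.span_root_eq_top fun i ↦ ?_
  have hu := P.weylGroup_apply_root u i
  have hv := P.weylGroup_apply_root v i
  have h' : P.weylGroupToPerm u = P.weylGroupToPerm v := h
  rw [h', ← hv] at hu
  exact hu

theorem exists_longest (J : Set b.support) :
    ∃ w ∈ leviWeylGroup b J, ∀ v ∈ leviWeylGroup b J, length b v ≤ length b w := by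
  have := finite_weylGroup P
  exact Set.exists_max_image (leviWeylGroup b J : Set P.weylGroup) (length b) (Set.toFinite _)
    ⟨1, one_mem _⟩

/-- The longest element `w_P` of `W_P`. -/
def longest (J : Set b.support) : P.weylGroup :=
  (exists_longest b J).choose

end

end Weyl

/-! ### Degrees -/

section Degrees

variable (b : P.Base)

/-- The coroot lattice `ℤΔ^∨`. -/
abbrev corootLattice : Submodule ℤ N :=
  Submodule.span ℤ (P.coroot '' b.support)

/-- The sublattice `ℤΔ_P^∨`, as a subset of `ℤΔ^∨`. -/
abbrev leviCorootLattice (J : Set b.support) : Submodule ℤ (corootLattice b) :=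
  (Submodule.span ℤ ((fun j : b.support ↦ P.coroot j) '' J)).submoduleOf (corootLattice b)

/-- `H₂(X) = ℤΔ^∨ / ℤΔ_P^∨`. -/
abbrev H2 (J : Set b.support) : Type _ :=
  corootLattice b ⧸ leviCorootLattice b J

/-- The class `α^∨ + ℤΔ_P^∨` in `H₂(X)`. -/
def corootClass (J : Set b.support) (i : ι) : H2 b J :=
  Submodule.Quotient.mk ⟨P.coroot i, b.coroot_mem_span_int i⟩

variable [P.IsRootSystem]

/-- The fundamental weight `ω_β`, as the functional on the coroot space with
`(ω_β, β'^∨) = δ_{β,β'}` for `β, β'` in `Δ`. -/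
def fundamentalWeight (β : b.support) : N →ₗ[ℝ] ℝ :=
  b.toCoweightBasis.coord β

/-- The Poincaré pairing `(ω_β, -)` on `H₂(X)`, for `β` in `Δ ∖ Δ_P`. -/
def poincare (J : Set b.support) (β : (Jᶜ : Set b.support)) : H2 b J →ₗ[ℤ] ℝ :=
  (leviCorootLattice b J).liftQ
    (((fundamentalWeight b (β : b.support)).restrictScalars ℤ) ∘ₗ (corootLattice b).subtype) <| by
    intro x hx
    have hx' : (x : N) ∈ Submodule.span ℤ ((fun j : b.support ↦ P.coroot j) '' J) := hx
    have hle : Submodule.span ℤ ((fun j : b.support ↦ P.coroot j) '' J) ≤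
        LinearMap.ker ((fundamentalWeight b (β : b.support)).restrictScalars ℤ) := by
      rw [Submodule.span_le]
      rintro - ⟨j, hj, rfl⟩
      have hne : j ≠ (β : b.support) := fun h ↦ β.2 (h ▸ hj)
      simp [fundamentalWeight, hne]
    exact hle hx'

/-- The partial order on `H₂(X)`: `d ≤ d'` if `(ω_β, d' - d) ≥ 0` for all `β` in `Δ ∖ Δ_P`. -/
def DegLE (J : Set b.support) (d d' : H2 b J) : Prop :=
  ∀ β : (Jᶜ : Set b.support), 0 ≤ poincare b J β (d' - d)

/-- `d` is a degree in `H₂(X)`, that is, an effective class. -/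
def IsDegree (J : Set b.support) (d : H2 b J) : Prop :=
  DegLE b J 0 d

/-- `α` is a maximal root of `d`: a maximal element, for the partial order on roots, of
`{α ∈ R⁺ ∖ R_P⁺ | α^∨ + ℤΔ_P^∨ ≤ d}`. -/
def IsMaximalRoot (J : Set b.support) (d : H2 b J) (i : ι) : Prop :=
  (i ∈ nonLeviPosRoots b J ∧ DegLE b J (corootClass b J i) d) ∧
    ∀ k, k ∈ nonLeviPosRoots b J → DegLE b J (corootClass b J k) d → RootLE b i k → k = i

/-- `(α₁, …, αᵣ)` is a greedy decomposition of `d`. -/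
def IsGreedy (J : Set b.support) : H2 b J → List ι → Prop
  | d, [] => d = 0
  | d, i :: l => IsMaximalRoot b J d i ∧ IsGreedy J (d - corootClass b J i) l

open scoped Classical in
/-- A greedy decomposition of a degree `d`. Every degree has one, unique up to reordering;
the default value is used only for classes that are not effective. -/
def greedy (J : Set b.support) (d : H2 b J) : List ι :=
  if h : ∃ l, IsGreedy b J d l then h.choose else []

variable [Finite ι] [P.IsCrystallographic] [P.IsReduced]

/-- The element `z_d^P`, defined by `z_d^P w_P = s_{α₁} · … · s_{αᵣ} · w_P` (Hecke product) for a
greedy decomposition `(α₁, …, αᵣ)` of `d`. -/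
def z (J : Set b.support) (d : H2 b J) : P.weylGroup :=
  hecke b (((greedy b J d).map (RootPairing.weylGroup.ofIdx P)).foldl (hecke b) 1) (longest b J) *
    (longest b J)⁻¹

/-- `d` belongs to the set `Π_P` of minimal degrees in `H₂(X)`: it is a minimal element of
the set of degrees `d'` with `z_d^P ≤ z_{d'}^P`. -/
def IsMinimalDegree (J : Set b.support) (d : H2 b J) : Prop :=
  IsDegree b J d ∧
    ∀ d', IsDegree b J d' → BruhatLE b (z b J d) (z b J d') → DegLE b J d' d → d' = d

/-- `e` is the lifting of `d`: the minimal degree in `H₂(G/B)` with `z_d^P w_P = z_e^B`. -/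
def IsLifting (J : Set b.support) (d : H2 b J) (e : H2 b ∅) : Prop :=
  IsMinimalDegree b ∅ e ∧ z b J d * longest b J = z b ∅ e

end Degrees

/-! ### Additional tangent directions -/

section Tangent

variable (b : P.Base) [P.IsRootSystem]

/-- The generalized cascade `𝓑_{R,e}`: the roots occurring in a greedy decomposition of `e`. -/
def cascade (e : H2 b ∅) : Set ι :=
  {i | b.IsPos i ∧ ∃ l, IsGreedy b ∅ e l ∧ i ∈ l}

variable [Fintype ι] [P.IsCrystallographic] [P.IsReduced]

/-- `(α', γ')` are associated to `(α, γ)`: here `α ∈ 𝓑_{R,e} ∖ R_P⁺` and `γ ∈ R_P⁺` with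
`(α, γ) < 0`; the root `α' ∈ 𝓑_{R,e} ∖ R_P⁺` has `(α', γ) > 0`, and `γ' = -z_e^B(γ)`.
The `W`-invariant scalar product is `P.RootForm`. -/
structure IsAssociated (J : Set b.support) (e : H2 b ∅) (p q : ι × ι) : Prop where
  fst_mem : p.1 ∈ cascade b e \ leviPosRoots b J
  snd_mem : p.2 ∈ leviPosRoots b J
  form_neg : P.RootForm (P.root p.1) (P.root p.2) < 0
  fst_mem' : q.1 ∈ cascade b e \ leviPosRoots b J
  form_pos' : 0 < P.RootForm (P.root q.1) (P.root p.2)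
  snd_eq' : P.root q.2 = -(z b ∅ e • P.root p.2)

/-- The set of pairs `(α, γ)` in `(𝓑_{R,e} ∖ R_P⁺) × R_P⁺` with `(γ, α^∨) < -1`. -/
def specialPairs (J : Set b.support) (e : H2 b ∅) : Set (ι × ι) :=
  {p | p.1 ∈ cascade b e \ leviPosRoots b J ∧ p.2 ∈ leviPosRoots b J ∧ P.pairing p.2 p.1 < -1}

/-- The set of additional tangent directions associated to the minimal degree `d` with
lifting `e`: the elements `-α' + γ'` of `R⁻ ∖ R_P⁻` where `(α', γ')` are associated to some
`(α, γ)` in `(𝓑_{R,e} ∖ R_P⁺) × R_P⁺` with `(γ, α^∨) < -1`. -/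
def additionalTangentDirections (J : Set b.support) (e : H2 b ∅) : Set M :=
  {x | x ∈ nonLeviNegRoots b J ∧ ∃ p ∈ specialPairs b J e, ∃ q, IsAssociated b J e p q ∧
    x = -P.root q.1 + P.root q.2}

end Tangent

end MinimalDegrees

end

/-!
The degrees of `G/B` are encoded by their coefficients on the simple coroots, and the proof falls
into two halves: a description of the minimal degrees of `G/B`, and an argument with at most three
orthogonal roots.

**Minimal degrees.** For a degree `d` let `A(d)` be the set of ordinary products of reflections
`s_{β₁} ⋯ s_{βₖ}` with `β₁^∨ + ⋯ + βₖ^∨ ≤ d`. If `σ` is simple and `⟨σ, d⟩ > 0`, conjugating chains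
by `s_σ` (`exists_conjugate_chains`) shows that `A(d)` is the union of `A'`, `s_σ A'`, `A' s_σ` and
`s_σ A' s_σ` for `A' = A(d - σ^∨)`. So `A(d)` has a Bruhat-greatest element `m(d)` (`maxElt`), which
satisfies `m(d) = s_σ · m(d - σ^∨) · s_σ` for the Hecke product. By induction with this recursion,
splitting off a maximal root `α` gives `m(d) = s_α · m(d - α^∨)` (`IsMaxRoot.maxElt_eq`), whence
`z_d^B = m(d)` (`z_ofDeg`); moreover the part of `d - α^∨` that is not orthogonal to `α` is absorbed
by `s_α` (`refl_hecke_maxElt_orthPart`). A minimal degree `e` cannot contain such a part, so its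
greedy decomposition consists of pairwise orthogonal roots (`IsMinDeg.pairwise`), and `z_e^B` is the
ordinary product of their reflections: `z_e^B(γ) = γ - ∑ ⟨γ, α^∨⟩ α`, the sum being over
`α ∈ 𝓑_{R,e}`. As `e` is a lifting, `z_e^B` makes the roots in `R_P⁺` negative
(`not_isPos_hecke_longest`).

**The assignment.** Let `(α₀, γ) ∈ 𝓓`. Bessel's inequality for `γ` and the orthogonal roots
`𝓑_{R,e}` (`sum_pairingIn_mul_lt_or`) and the greedy property
(`IsGreedyDeg.mem_of_corootCoeff_le_sum`) force `⟨γ, α^∨⟩ = ⟨α, γ^∨⟩ ∈ {0, ±1}` for the other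
`α ∈ 𝓑_{R,e}`, and equality holds in Bessel's inequality as soon as two of these numbers are
nonzero. The associated root exists because otherwise `z_e^B(γ)` would have a positive coefficient
on a simple root outside `Δ_P` that occurs in `α₀`; two associated roots `α₁ ≠ α₂` would give
`γ = -α₀ + (α₁ + α₂)/2`, and then either `α₁` or `α₂` lies in `R_P⁺` or the root
`α₀ + (α₁ + α₂)/2` contradicts the greedy property. Finally `α' - γ'` has a positive coefficient
outside `Δ_P`; and if two pairs with associated roots `β₁ ≠ β₂` had the same image, then applying
`z_e^B` gives `γ₁ - γ₂ = β₁ - β₂`, and the equality case of Bessel's inequality yields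
`γᵢ = -αᵢ ± (β₁ - β₂)/2`, so that `γ₁ + γ₂` is negative.
-/

noncomputable section

namespace MinimalDegrees

open Module

set_option linter.unusedSectionVars false

variable {ι M N : Type*} [AddCommGroup M] [Module ℝ M] [AddCommGroup N] [Module ℝ N]
  {P : RootPairing ι ℝ M N}

local notation "𝐬" => RootPairing.weylGroup.ofIdx P


/-! ### Coefficients of roots and coroots -/

section Coefficients

variable (b : P.Base)

/-- The integral coefficients of a root with respect to the simple roots. -/
def rootCoeff (i : ι) (σ : b.support) : ℤ :=
  (b.exists_root_eq_sum_int i).choose σ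

/-- The integral coefficients of a coroot with respect to the simple coroots. -/
def corootCoeff (i : ι) (σ : b.support) : ℤ :=
  rootCoeff b.flip i σ

theorem root_eq_sum (i : ι) : P.root i = ∑ σ : b.support, rootCoeff b i σ • P.root σ := by
  have h := (b.exists_root_eq_sum_int i).choose_spec.2.2
  rw [h, ← Finset.sum_coe_sort b.support]
  rfl

theorem coroot_eq_sum (i : ι) : P.coroot i = ∑ σ : b.support, corootCoeff b i σ • P.coroot σ :=
  root_eq_sum b.flip i

theorem height_eq_sum_rootCoeff (i : ι) : b.height i = ∑ σ : b.support, rootCoeff b i σ := by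
  rw [RootPairing.Base.height, ← Finset.sum_coe_sort b.support]
  rfl

theorem rootCoeff_nonneg_or_nonpos (i : ι) : 0 ≤ rootCoeff b i ∨ rootCoeff b i ≤ 0 := by
  rcases (b.exists_root_eq_sum_int i).choose_spec.2.1 with h | h
  · exact Or.inl fun σ ↦ h.le σ
  · exact Or.inr fun σ ↦ h.le σ

theorem isPos_iff_rootCoeff_nonneg {i : ι} : b.IsPos i ↔ 0 ≤ rootCoeff b i := by
  rw [RootPairing.Base.isPos_iff', height_eq_sum_rootCoeff]
  refine ⟨fun h ↦ ?_, fun h ↦ Finset.sum_nonneg fun σ _ ↦ h σ⟩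
  rcases rootCoeff_nonneg_or_nonpos b i with h' | h'
  · exact h'
  · have h0 := Finset.sum_nonpos fun σ (_ : σ ∈ Finset.univ) ↦ h' σ
    have h1 := (Finset.sum_eq_zero_iff_of_nonpos fun σ _ ↦ h' σ).1 (le_antisymm h0 h)
    exact fun σ ↦ (h1 σ (Finset.mem_univ σ)).ge

theorem not_isPos_iff_rootCoeff_nonpos {i : ι} : ¬ b.IsPos i ↔ rootCoeff b i ≤ 0 := by
  constructor
  · intro h
    rw [isPos_iff_rootCoeff_nonneg] at h
    exact (rootCoeff_nonneg_or_nonpos b i).resolve_left h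
  · intro h h'
    rw [RootPairing.Base.isPos_iff, height_eq_sum_rootCoeff] at h'
    exact absurd (Finset.sum_nonpos fun σ (_ : σ ∈ Finset.univ) ↦ h σ) (not_le.2 h')

theorem exists_rootCoeff_pos {i : ι} (hi : b.IsPos i) : ∃ σ, 0 < rootCoeff b i σ := by
  by_contra! h
  exact (not_isPos_iff_rootCoeff_nonpos b).2 (fun σ ↦ h σ) hi

variable [P.IsRootSystem]

theorem toWeightBasis_coord_root (i : ι) (σ : b.support) :
    b.toWeightBasis.coord σ (P.root i) = rootCoeff b i σ := by
  rw [root_eq_sum b i, map_sum, Finset.sum_eq_single σ]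
  · rw [map_zsmul, Basis.coord_apply]; simp
  · intro τ _ h
    rw [map_zsmul, Basis.coord_apply]; simp [h]
  · simp

theorem fundamentalWeight_coroot (i : ι) (σ : b.support) :
    fundamentalWeight b σ (P.coroot i) = corootCoeff b i σ :=
  toWeightBasis_coord_root (P := P.flip) b.flip i σ

theorem fundamentalWeight_coroot_simple [DecidableEq b.support] (τ σ : b.support) :
    fundamentalWeight b σ (P.coroot τ) = if τ = σ then 1 else 0 := by
  rw [fundamentalWeight, Basis.coord_apply, RootPairing.Base.toCoweightBasis_repr_coroot,
    Finsupp.single_apply]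

theorem ext_rootCoeff {i j : ι} (h : rootCoeff b i = rootCoeff b j) : i = j := by
  apply P.root.injective
  rw [root_eq_sum b i, root_eq_sum b j, h]

theorem rootCoeff_simple_self (τ : b.support) : rootCoeff b τ τ = 1 := by
  classical
  have h := toWeightBasis_coord_root b τ τ
  rw [Basis.coord_apply, RootPairing.Base.toWeightBasis_repr_root, Finsupp.single_apply,
    if_pos rfl] at h
  exact_mod_cast h.symm

theorem rootCoeff_simple_ne {τ σ : b.support} (hne : τ ≠ σ) : rootCoeff b τ σ = 0 := by
  classical
  have h := toWeightBasis_coord_root b τ σ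
  rw [Basis.coord_apply, RootPairing.Base.toWeightBasis_repr_root, Finsupp.single_apply,
    if_neg hne] at h
  exact_mod_cast h.symm

theorem corootCoeff_simple_self (τ : b.support) : corootCoeff b τ τ = 1 :=
  rootCoeff_simple_self (P := P.flip) b.flip τ

theorem corootCoeff_simple_ne {τ σ : b.support} (hne : τ ≠ σ) : corootCoeff b τ σ = 0 :=
  rootCoeff_simple_ne (P := P.flip) b.flip (τ := τ) (σ := σ) hne

end Coefficients

/-! ### Pairings -/

section Pairing

variable (b : P.Base) [Fintype ι] [P.IsRootSystem] [P.IsCrystallographic]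

/-- The square of the length of a root. -/
abbrev normSq (P : RootPairing ι ℝ M N) (i : ι) : ℝ := P.RootForm (P.root i) (P.root i)

theorem normSq_pos (i : ι) : 0 < normSq P i :=
  P.rootForm_pos_of_ne_zero (Submodule.subset_span ⟨i, rfl⟩) (P.ne_zero i)

theorem two_mul_rootForm (i j : ι) :
    2 * P.RootForm (P.root i) (P.root j) = P.pairing i j * normSq P j :=
  P.toInvariantForm.two_mul_apply_root_root i j

theorem rootForm_comm (x y : M) : P.RootForm x y = P.RootForm y x :=
  (P.rootForm_symmetric.eq x y).symm.symm

theorem cast_pairingIn (i j : ι) : ((P.pairingIn ℤ i j : ℤ) : ℝ) = P.pairing i j :=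
  P.algebraMap_pairingIn ℤ i j

/-- The coefficients of `α^∨` and of `α` differ by the ratio of squared lengths. -/
theorem normSq_mul_corootCoeff (i : ι) (σ : b.support) :
    normSq P i * corootCoeff b i σ = normSq P σ * rootCoeff b i σ := by
  have h := P.rootForm_self_smul_coroot i
  have h2 : (2 : ℕ) • P.Polarization (P.root i) =
      ∑ τ : b.support, (rootCoeff b i τ * normSq P τ) • P.coroot τ := by
    conv_lhs => rw [root_eq_sum b i]
    rw [map_sum, Finset.smul_sum]
    refine Finset.sum_congr rfl fun τ _ ↦ ?_
    rw [map_zsmul, smul_comm, ← P.rootForm_self_smul_coroot, mul_smul, Int.cast_smul_eq_zsmul]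
  rw [h2] at h
  have h3 := congrArg (fundamentalWeight b σ) h
  classical
  rw [map_smul, fundamentalWeight_coroot, map_sum, Finset.sum_eq_single σ] at h3
  · rw [map_smul, fundamentalWeight_coroot_simple] at h3
    simp only [smul_eq_mul, if_true, mul_one] at h3
    rw [h3, mul_comm]
  · intro τ _ hτ
    rw [map_smul, fundamentalWeight_coroot_simple, if_neg hτ, smul_zero]
  · simp

theorem corootCoeff_pos_iff {i : ι} {σ : b.support} :
    0 < corootCoeff b i σ ↔ 0 < rootCoeff b i σ := by
  have h := normSq_mul_corootCoeff b i σ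
  have h1 := normSq_pos (P := P) i
  have h2 := normSq_pos (P := P) σ
  constructor
  · intro hp
    have : (0 : ℝ) < normSq P σ * rootCoeff b i σ := by rw [← h]; positivity
    exact_mod_cast (pos_iff_pos_of_mul_pos this).1 h2
  · intro hp
    have : (0 : ℝ) < normSq P i * corootCoeff b i σ := by rw [h]; positivity
    exact_mod_cast (pos_iff_pos_of_mul_pos this).1 h1

theorem corootCoeff_nonneg {i : ι} (hi : b.IsPos i) : 0 ≤ corootCoeff b i := by
  intro σ
  have h := normSq_mul_corootCoeff b i σ
  have h1 := normSq_pos (P := P) i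
  have h2 := normSq_pos (P := P) σ
  have h3 : (0 : ℝ) ≤ rootCoeff b i σ := by
    exact_mod_cast (isPos_iff_rootCoeff_nonneg b).1 hi σ
  have h4 : (0 : ℝ) ≤ normSq P i * corootCoeff b i σ := by rw [h]; positivity
  exact_mod_cast nonneg_of_mul_nonneg_right h4 h1

theorem isPos_of_corootCoeff_nonneg {i : ι} (h : 0 ≤ corootCoeff b i) : b.IsPos i := by
  by_contra h'
  have h2 : rootCoeff b i = 0 := by
    refine le_antisymm ((not_isPos_iff_rootCoeff_nonpos b).1 h') fun σ ↦ ?_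
    have h3 := normSq_mul_corootCoeff b i σ
    have h4 : (0 : ℝ) ≤ normSq P σ * rootCoeff b i σ := by
      rw [← h3]
      have := h σ
      have h5 := (normSq_pos (P := P) i).le
      have : (0 : ℝ) ≤ corootCoeff b i σ := by exact_mod_cast this
      positivity
    exact_mod_cast nonneg_of_mul_nonneg_right h4 (normSq_pos (P := P) σ)
  exact h' ((isPos_iff_rootCoeff_nonneg b).2 h2.ge)

theorem exists_corootCoeff_pos {i : ι} (hi : b.IsPos i) : ∃ σ, 0 < corootCoeff b i σ := by
  obtain ⟨σ, h⟩ := exists_rootCoeff_pos b hi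
  exact ⟨σ, (corootCoeff_pos_iff b).2 h⟩

/-- The pairing `⟨αᵢ, d⟩` of a root with a vector `d = ∑ d_τ τ^∨` of the coroot lattice. -/
def degPair (i : ι) (d : b.support → ℤ) : ℤ :=
  ∑ τ : b.support, d τ * P.pairingIn ℤ i τ

theorem degPair_add (i : ι) (d d' : b.support → ℤ) :
    degPair b i (d + d') = degPair b i d + degPair b i d' := by
  simp [degPair, add_mul, Finset.sum_add_distrib]

theorem degPair_sub (i : ι) (d d' : b.support → ℤ) :
    degPair b i (d - d') = degPair b i d - degPair b i d' := by
  simp [degPair, sub_mul, Finset.sum_sub_distrib]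

theorem degPair_corootCoeff (i k : ι) : degPair b i (corootCoeff b k) = P.pairingIn ℤ i k := by
  have h : P.pairing i k = ∑ τ : b.support, (corootCoeff b k τ : ℝ) * P.pairing i τ := by
    conv_lhs => rw [← P.root'_coroot_eq_pairing, coroot_eq_sum b k]
    rw [map_sum]
    refine Finset.sum_congr rfl fun τ _ ↦ ?_
    rw [map_zsmul, zsmul_eq_mul, P.root'_coroot_eq_pairing]
  have h2 : ((degPair b i (corootCoeff b k) : ℤ) : ℝ) = (P.pairingIn ℤ i k : ℤ) := by
    rw [cast_pairingIn, h, degPair]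
    push_cast
    refine Finset.sum_congr rfl fun τ _ ↦ ?_
    rw [cast_pairingIn]
  exact_mod_cast h2

/-- Dually, `⟨αᵢ, α_k^∨⟩` in terms of the coefficients of `αᵢ`. -/
theorem pairingIn_eq_sum_rootCoeff (i k : ι) :
    P.pairingIn ℤ i k = ∑ τ : b.support, rootCoeff b i τ * P.pairingIn ℤ τ k := by
  have h : P.pairing i k = ∑ τ : b.support, (rootCoeff b i τ : ℝ) * P.pairing τ k := by
    conv_lhs => rw [← P.root_coroot'_eq_pairing, root_eq_sum b i]
    rw [map_sum]
    refine Finset.sum_congr rfl fun τ _ ↦ ?_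
    rw [map_zsmul, zsmul_eq_mul, P.root_coroot'_eq_pairing]
  have h2 : ((P.pairingIn ℤ i k : ℤ) : ℝ) =
      ((∑ τ : b.support, rootCoeff b i τ * P.pairingIn ℤ τ k : ℤ) : ℝ) := by
    rw [cast_pairingIn, h]
    push_cast
    refine Finset.sum_congr rfl fun τ _ ↦ ?_
    rw [cast_pairingIn]
  exact_mod_cast h2

theorem corootCoeff_congr {k : ι} {x : N} (h : P.coroot k = x) (σ : b.support) :
    (corootCoeff b k σ : ℝ) = fundamentalWeight b σ x := by
  rw [← h, fundamentalWeight_coroot]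

theorem rootCoeff_congr {k : ι} {x : M} (h : P.root k = x) (σ : b.support) :
    (rootCoeff b k σ : ℝ) = b.toWeightBasis.coord σ x := by
  rw [← h, toWeightBasis_coord_root]

theorem rootCoeff_reflectionPerm (i k : ι) :
    rootCoeff b (P.reflectionPerm k i) = rootCoeff b i - P.pairingIn ℤ i k • rootCoeff b k := by
  ext σ
  have h := rootCoeff_congr b (P.root_reflectionPerm k i) σ
  rw [P.reflection_apply_root, map_sub, map_smul, toWeightBasis_coord_root,
    toWeightBasis_coord_root, smul_eq_mul, ← cast_pairingIn] at h
  simp only [Pi.sub_apply, Pi.smul_apply, smul_eq_mul]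
  exact_mod_cast h

theorem corootCoeff_reflectionPerm (i k : ι) :
    corootCoeff b (P.reflectionPerm k i) =
      corootCoeff b i - P.pairingIn ℤ k i • corootCoeff b k := by
  ext σ
  have h := corootCoeff_congr b (P.coroot_reflectionPerm k i) σ
  rw [P.coreflection_apply_coroot, map_sub, map_smul, fundamentalWeight_coroot,
    fundamentalWeight_coroot, smul_eq_mul, ← cast_pairingIn] at h
  simp only [Pi.sub_apply, Pi.smul_apply, smul_eq_mul]
  exact_mod_cast h

theorem rootCoeff_reflectionPerm_self (i : ι) :
    rootCoeff b (P.reflectionPerm i i) = -rootCoeff b i := by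
  rw [rootCoeff_reflectionPerm, P.pairingIn_same, two_smul]; abel

theorem isPos_reflectionPerm_self {i : ι} : b.IsPos (P.reflectionPerm i i) ↔ ¬ b.IsPos i := by
  rw [isPos_iff_rootCoeff_nonneg, rootCoeff_reflectionPerm_self, not_isPos_iff_rootCoeff_nonpos]
  exact neg_nonneg

/-- The vector of the root space that the invariant form identifies with the coroot lattice vector
`∑ d_τ τ^∨`. -/
def degVec (d : b.support → ℤ) : M :=
  ∑ τ : b.support, ((d τ : ℝ) * (2 / normSq P τ)) • P.root τ

theorem rootForm_root_degVec (i : ι) (d : b.support → ℤ) :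
    P.RootForm (P.root i) (degVec b d) = degPair b i d := by
  rw [degVec, map_sum, degPair]
  push_cast
  refine Finset.sum_congr rfl fun τ _ ↦ ?_
  rw [map_smul, smul_eq_mul, cast_pairingIn]
  have h1 := two_mul_rootForm (P := P) i τ
  have h2 := (normSq_pos (P := P) τ).ne'
  field_simp
  linear_combination (d τ : ℝ) * h1

theorem rootForm_degVec (d : b.support → ℤ) (x : M) :
    P.RootForm x (degVec b d) =
      ∑ τ : b.support, (d τ : ℝ) * (2 / normSq P τ) * P.RootForm x (P.root τ) := by
  rw [degVec, map_sum]
  exact Finset.sum_congr rfl fun τ _ ↦ by rw [map_smul, smul_eq_mul]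

theorem degVec_add (d d' : b.support → ℤ) : degVec b (d + d') = degVec b d + degVec b d' := by
  simp [degVec, add_mul, add_smul, Finset.sum_add_distrib]

theorem degVec_corootCoeff (i : ι) : degVec b (corootCoeff b i) = (2 / normSq P i) • P.root i := by
  rw [degVec, root_eq_sum b i, Finset.smul_sum]
  refine Finset.sum_congr rfl fun τ _ ↦ ?_
  rw [← Int.cast_smul_eq_zsmul ℝ, smul_smul]
  congr 1
  have h1 := (normSq_pos (P := P) τ).ne'
  have h2 := (normSq_pos (P := P) i).ne'
  have h3 := normSq_mul_corootCoeff b i τ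
  field_simp
  linear_combination h3

theorem degVec_ne_zero {d : b.support → ℤ} (h0 : d ≠ 0) : degVec b d ≠ 0 := by
  intro h
  obtain ⟨τ, hτ⟩ := Function.ne_iff.1 h0
  have h3 := congrArg (b.toWeightBasis.coord τ) h
  rw [degVec, map_sum, map_zero, Finset.sum_eq_single τ] at h3
  · rw [map_smul, Basis.coord_apply, RootPairing.Base.toWeightBasis_repr_root] at h3
    have h2 := (normSq_pos (P := P) τ).ne'
    simp at h3
    rcases h3 with h3 | h3
    · exact hτ h3
    · exact h2 h3
  · intro ρ _ hρ
    rw [map_smul, Basis.coord_apply, RootPairing.Base.toWeightBasis_repr_root]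
    simp [hρ]
  · simp

/-- A nonzero effective class pairs positively with some simple root in its support. -/
theorem exists_degPair_pos {d : b.support → ℤ} (hd : 0 ≤ d) (h0 : d ≠ 0) :
    ∃ σ : b.support, 0 < d σ ∧ 0 < degPair b σ d := by
  have hpos : 0 < P.RootForm (degVec b d) (degVec b d) :=
    P.rootForm_pos_of_ne_zero (by simp) (degVec_ne_zero b h0)
  by_contra! hcon
  refine absurd hpos (not_lt.2 ?_)
  rw [rootForm_degVec]
  refine Finset.sum_nonpos fun τ _ ↦ ?_
  rw [rootForm_comm, rootForm_root_degVec]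
  have h2 := normSq_pos (P := P) τ
  rcases (hd τ).eq_or_lt with h | h
  · rw [← h]; simp
  · have h4 : (degPair b τ d : ℝ) ≤ 0 := by exact_mod_cast hcon τ h
    have h5 : (0 : ℝ) < d τ := by exact_mod_cast h
    exact mul_nonpos_of_nonneg_of_nonpos (by positivity) h4

end Pairing

/-! ### The action of the Weyl group on roots -/

section Action

theorem weylGroupToPerm_ofIdx (i k : ι) :
    P.weylGroupToPerm (𝐬 i) k = P.reflectionPerm i k := rfl

theorem weylGroupToPerm_mul (u v : P.weylGroup) (i : ι) :
    P.weylGroupToPerm (u * v) i = P.weylGroupToPerm u (P.weylGroupToPerm v i) := by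
  rw [map_mul]; rfl

theorem weylGroup_ext [P.IsRootSystem] {u v : P.weylGroup} (h : ∀ x : M, u • x = v • x) :
    u = v := by
  apply Subtype.ext
  apply RootPairing.Equiv.weightHom_injective P
  apply LinearEquiv.toLinearMap_injective
  exact LinearMap.ext h

theorem ofIdx_smul (i : ι) (x : M) : 𝐬 i • x = x - P.coroot' i x • P.root i :=
  P.reflection_apply i x

variable [P.IsRootSystem]

theorem ofIdx_mul_self (i : ι) : 𝐬 i * 𝐬 i = 1 := by
  refine weylGroup_ext fun x ↦ ?_
  rw [mul_smul, one_smul]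
  exact P.reflection_same i x

theorem ofIdx_inv (i : ι) : (𝐬 i)⁻¹ = 𝐬 i := inv_eq_of_mul_eq_one_left (ofIdx_mul_self i)

theorem mul_ofIdx_mul_ofIdx (w : P.weylGroup) (i : ι) : w * 𝐬 i * 𝐬 i = w := by
  rw [mul_assoc, ofIdx_mul_self, mul_one]

theorem ofIdx_mul_ofIdx_mul (w : P.weylGroup) (i : ι) : 𝐬 i * (𝐬 i * w) = w := by
  rw [← mul_assoc, ofIdx_mul_self, one_mul]

theorem ofIdx_reflectionPerm (i k : ι) : 𝐬 (P.reflectionPerm k i) = 𝐬 k * 𝐬 i * 𝐬 k := by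
  refine weylGroup_ext fun x ↦ ?_
  have := congrArg (fun f : M ≃ₗ[ℝ] M ↦ f x) (P.reflection_reflectionPerm (i := i) (j := k))
  rw [mul_smul, mul_smul]
  exact this

theorem ofIdx_reflectionPerm_self (i : ι) : 𝐬 (P.reflectionPerm i i) = 𝐬 i := by
  rw [ofIdx_reflectionPerm, ofIdx_mul_self, one_mul]

variable [Finite ι] [P.IsCrystallographic] [P.IsReduced]

theorem mul_ofIdx (b : P.Base) (w : P.weylGroup) (i : ι) :
    w * 𝐬 i = 𝐬 (P.weylGroupToPerm w i) * w := by
  obtain ⟨l, rfl⟩ := exists_wordProd_eq b w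
  induction l with
  | nil => simp [wordProd]
  | cons σ l ih =>
    have h : wordProd b (σ :: l) = 𝐬 σ * wordProd b l := by simp [wordProd]
    rw [h, mul_assoc, ih, weylGroupToPerm_mul, weylGroupToPerm_ofIdx, ofIdx_reflectionPerm]
    simp only [mul_assoc, ofIdx_mul_ofIdx_mul]

end Action

/-! ### Strong exchange and the Bruhat order -/

section Bruhat

variable (b : P.Base) [Fintype ι] [P.IsRootSystem] [P.IsCrystallographic] [P.IsReduced]

theorem wordProd_cons (σ : b.support) (l : List b.support) :
    wordProd b (σ :: l) = 𝐬 σ * wordProd b l := by simp [wordProd]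

theorem wordProd_append (l l' : List b.support) :
    wordProd b (l ++ l') = wordProd b l * wordProd b l' := by simp [wordProd]

theorem wordProd_nil : wordProd b [] = 1 := rfl

theorem wordProd_singleton (σ : b.support) : wordProd b [σ] = 𝐬 σ := by simp [wordProd]

theorem weylGroupToPerm_neg (w : P.weylGroup) (i : ι) :
    P.weylGroupToPerm w (P.reflectionPerm i i) =
      P.reflectionPerm (P.weylGroupToPerm w i) (P.weylGroupToPerm w i) := by
  apply P.root.injective
  rw [← P.weylGroup_apply_root, P.root_reflectionPerm, P.reflection_apply_self, smul_neg,
    P.weylGroup_apply_root, P.root_reflectionPerm, P.reflection_apply_self]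

theorem isPos_simple (σ : b.support) : b.IsPos σ := RootPairing.Base.isPos_of_mem_support σ.2

theorem isPos_reflectionPerm_simple {i : ι} (σ : b.support) (hi : b.IsPos i) (h : i ≠ σ) :
    b.IsPos (P.reflectionPerm σ i) := hi.reflectionPerm σ.2 h

/-- The strong exchange condition. -/
theorem exists_sublist_of_not_isPos (l : List b.support) {α : ι} (hα : b.IsPos α)
    (h : ¬ b.IsPos (P.weylGroupToPerm (wordProd b l) α)) :
    ∃ l', l'.Sublist l ∧ l'.length + 1 = l.length ∧ wordProd b l' = wordProd b l * 𝐬 α := by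
  induction l with
  | nil => exact absurd hα h
  | cons σ l ih =>
    by_cases h' : b.IsPos (P.weylGroupToPerm (wordProd b l) α)
    · refine ⟨l, List.sublist_cons_self σ l, rfl, ?_⟩
      have hσ : P.weylGroupToPerm (wordProd b l) α = σ := by
        by_contra hne
        apply h
        rw [wordProd_cons, weylGroupToPerm_mul]
        exact isPos_reflectionPerm_simple b σ h' hne
      rw [wordProd_cons, mul_assoc, mul_ofIdx b, hσ, ofIdx_mul_ofIdx_mul]
    · obtain ⟨l', h1, h2, h3⟩ := ih h'
      refine ⟨σ :: l', h1.cons_cons σ, by simp [h2], ?_⟩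
      rw [wordProd_cons, wordProd_cons, h3, mul_assoc]

theorem length_wordProd_le (l : List b.support) : length b (wordProd b l) ≤ l.length :=
  Nat.sInf_le ⟨l, rfl, rfl⟩

theorem length_mul_lt {w : P.weylGroup} {α : ι} (hα : b.IsPos α)
    (h : ¬ b.IsPos (P.weylGroupToPerm w α)) : length b (w * 𝐬 α) < length b w := by
  obtain ⟨l, hl, hl'⟩ := exists_isReducedWord b w
  subst hl
  obtain ⟨l', -, h2, h3⟩ := exists_sublist_of_not_isPos b l hα h
  rw [← h3, ← hl']
  have := length_wordProd_le b l'
  omega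

theorem length_lt_mul {w : P.weylGroup} {α : ι} (hα : b.IsPos α)
    (h : b.IsPos (P.weylGroupToPerm w α)) : length b w < length b (w * 𝐬 α) := by
  have := length_mul_lt b (w := w * 𝐬 α) hα (by
    rw [weylGroupToPerm_mul, weylGroupToPerm_ofIdx, weylGroupToPerm_neg,
      isPos_reflectionPerm_self, not_not]
    exact h)
  rwa [mul_ofIdx_mul_ofIdx] at this

theorem length_lt_mul_iff {w : P.weylGroup} {α : ι} (hα : b.IsPos α) :
    length b w < length b (w * 𝐬 α) ↔ b.IsPos (P.weylGroupToPerm w α) := by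
  refine ⟨fun h ↦ ?_, length_lt_mul b hα⟩
  by_contra h'
  exact absurd (length_mul_lt b hα h') (not_lt.2 h.le)

theorem bruhatLE_refl (u : P.weylGroup) : BruhatLE b u u := Relation.ReflTransGen.refl

theorem BruhatLE.trans {b : P.Base} {u v w : P.weylGroup} (h : BruhatLE b u v)
    (h' : BruhatLE b v w) : BruhatLE b u w := Relation.ReflTransGen.trans h h'

theorem bruhatLE_mul {u : P.weylGroup} {α : ι} (hα : b.IsPos α)
    (h : b.IsPos (P.weylGroupToPerm u α)) : BruhatLE b u (u * 𝐬 α) :=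
  Relation.ReflTransGen.single ⟨α, rfl, length_lt_mul b hα h⟩

theorem mul_bruhatLE {u : P.weylGroup} {α : ι} (hα : b.IsPos α)
    (h : ¬ b.IsPos (P.weylGroupToPerm u α)) : BruhatLE b (u * 𝐬 α) u :=
  Relation.ReflTransGen.single
    ⟨α, (mul_ofIdx_mul_ofIdx u α).symm, length_mul_lt b hα h⟩

/-- Induction over a Bruhat chain whose steps are given by positive roots. -/
theorem BruhatLE.induction {u v : P.weylGroup} (h : BruhatLE b u v)
    {p : P.weylGroup → Prop} (h0 : p u)
    (step : ∀ (w : P.weylGroup) (α : ι), b.IsPos α → b.IsPos (P.weylGroupToPerm w α) →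
      p w → p (w * 𝐬 α)) : p v := by
  induction h with
  | refl => exact h0
  | tail _ hs ih =>
    obtain ⟨i, rfl, hlt⟩ := hs
    by_cases hi : b.IsPos i
    · exact step _ i hi ((length_lt_mul_iff b hi).1 hlt) ih
    · have hi' := (isPos_reflectionPerm_self b).2 hi
      rw [← ofIdx_reflectionPerm_self i] at hlt ⊢
      exact step _ _ hi' ((length_lt_mul_iff b hi').1 hlt) ih

theorem BruhatLE.eq_or_length_lt {u v : P.weylGroup} (h : BruhatLE b u v) :
    u = v ∨ length b u < length b v := by
  refine BruhatLE.induction b h (p := fun v ↦ u = v ∨ length b u < length b v) (Or.inl rfl) ?_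
  rintro w α hα hw (rfl | hlt)
  · exact Or.inr (length_lt_mul b hα hw)
  · exact Or.inr (hlt.trans (length_lt_mul b hα hw))

theorem BruhatLE.antisymm {u v : P.weylGroup} (h : BruhatLE b u v) (h' : BruhatLE b v u) :
    u = v := by
  rcases BruhatLE.eq_or_length_lt b h with h1 | h1
  · exact h1
  · rcases BruhatLE.eq_or_length_lt b h' with h2 | h2
    · exact h2.symm
    · omega

/-- The subword property: anything below the value of a word is the value of a subword. -/
theorem exists_sublist_of_bruhatLE {u v : P.weylGroup} (h : BruhatLE b u v) :
    ∀ l : List b.support, wordProd b l = v → ∃ l', l'.Sublist l ∧ wordProd b l' = u := by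
  refine BruhatLE.induction b h
    (p := fun v ↦ ∀ l : List b.support, wordProd b l = v →
      ∃ l', l'.Sublist l ∧ wordProd b l' = u) (fun l hl ↦ ⟨l, List.Sublist.refl l, hl⟩) ?_
  intro w α hα hw ih l hl
  obtain ⟨l', h1, -, h3⟩ := exists_sublist_of_not_isPos b l hα (by
    rw [hl, weylGroupToPerm_mul, weylGroupToPerm_ofIdx, weylGroupToPerm_neg,
      isPos_reflectionPerm_self, not_not]
    exact hw)
  rw [hl, mul_ofIdx_mul_ofIdx] at h3
  obtain ⟨l'', h4, h5⟩ := ih l' h3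
  exact ⟨l'', h4.trans h1, h5⟩

theorem length_inv_le (w : P.weylGroup) : length b w⁻¹ ≤ length b w := by
  obtain ⟨l, rfl, hl⟩ := exists_isReducedWord b w
  have : (wordProd b l)⁻¹ = wordProd b l.reverse := by
    clear hl
    induction l with
    | nil => simp [wordProd]
    | cons σ l ih =>
      rw [wordProd_cons, mul_inv_rev, ih, List.reverse_cons, wordProd_append, wordProd_singleton,
        ofIdx_inv]
  rw [this, ← hl]
  simpa using length_wordProd_le b l.reverse

theorem length_inv (w : P.weylGroup) : length b w⁻¹ = length b w :=
  le_antisymm (length_inv_le b w) (by simpa using length_inv_le b w⁻¹)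

theorem BruhatLE.inv {u v : P.weylGroup} (h : BruhatLE b u v) : BruhatLE b u⁻¹ v⁻¹ := by
  refine BruhatLE.induction b h (p := fun v ↦ BruhatLE b u⁻¹ v⁻¹) (bruhatLE_refl b _) ?_
  intro w α hα hw ih
  refine ih.trans (Relation.ReflTransGen.single ⟨P.weylGroupToPerm w α, ?_, ?_⟩)
  · rw [mul_ofIdx b w α, mul_inv_rev, ofIdx_inv]
  · rw [length_inv, length_inv]
    exact length_lt_mul b hα hw

end Bruhat

/-! ### The Hecke product -/

section Hecke

variable (b : P.Base) [Fintype ι] [P.IsRootSystem] [P.IsCrystallographic] [P.IsReduced]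

theorem heckeStep_of_isPos {u : P.weylGroup} {σ : b.support}
    (h : b.IsPos (P.weylGroupToPerm u σ)) : heckeStep b u σ = u * 𝐬 σ :=
  if_pos (length_lt_mul b (isPos_simple b σ) h)

theorem heckeStep_of_not_isPos {u : P.weylGroup} {σ : b.support}
    (h : ¬ b.IsPos (P.weylGroupToPerm u σ)) : heckeStep b u σ = u :=
  if_neg fun h' ↦ h ((length_lt_mul_iff b (isPos_simple b σ)).1 h')

theorem heckeStep_eq_or (u : P.weylGroup) (σ : b.support) :
    heckeStep b u σ = u ∨ heckeStep b u σ = u * 𝐬 σ := by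
  by_cases h : b.IsPos (P.weylGroupToPerm u σ)
  · exact Or.inr (heckeStep_of_isPos b h)
  · exact Or.inl (heckeStep_of_not_isPos b h)

theorem le_heckeStep (u : P.weylGroup) (σ : b.support) : BruhatLE b u (heckeStep b u σ) := by
  by_cases h : b.IsPos (P.weylGroupToPerm u σ)
  · rw [heckeStep_of_isPos b h]; exact bruhatLE_mul b (isPos_simple b σ) h
  · rw [heckeStep_of_not_isPos b h]; exact bruhatLE_refl b u

theorem mul_le_heckeStep (u : P.weylGroup) (σ : b.support) :
    BruhatLE b (u * 𝐬 σ) (heckeStep b u σ) := by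
  by_cases h : b.IsPos (P.weylGroupToPerm u σ)
  · rw [heckeStep_of_isPos b h]; exact bruhatLE_refl b _
  · rw [heckeStep_of_not_isPos b h]; exact mul_bruhatLE b (isPos_simple b σ) h

/-- The lifting property of the Bruhat order. -/
theorem BruhatLE.heckeStep {u v : P.weylGroup} (h : BruhatLE b u v) (σ : b.support) :
    BruhatLE b (heckeStep b u σ) (heckeStep b v σ) := by
  refine BruhatLE.induction b h
    (p := fun v ↦ BruhatLE b (MinimalDegrees.heckeStep b u σ) (MinimalDegrees.heckeStep b v σ))
    (bruhatLE_refl b _) ?_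
  intro w α hα hw ih
  refine ih.trans ?_
  rcases heckeStep_eq_or b w σ with h1 | h1
  · rw [h1]
    exact (bruhatLE_mul b hα hw).trans (le_heckeStep b _ σ)
  · rw [h1]
    by_cases hασ : α = σ
    · rw [hασ]
      exact le_heckeStep b _ σ
    · refine BruhatLE.trans ?_ (mul_le_heckeStep b _ σ)
      have h2 : w * 𝐬 α * 𝐬 σ = w * 𝐬 σ * 𝐬 (P.reflectionPerm σ α) := by
        rw [ofIdx_reflectionPerm]
        simp only [mul_assoc, ofIdx_mul_ofIdx_mul]
      rw [h2]
      refine bruhatLE_mul b (isPos_reflectionPerm_simple b σ hα hασ) ?_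
      rw [weylGroupToPerm_mul, weylGroupToPerm_ofIdx, P.reflectionPerm_self]
      exact hw

theorem BruhatLE.foldl_heckeStep (l : List b.support) :
    ∀ {u v : P.weylGroup}, BruhatLE b u v →
      BruhatLE b (l.foldl (MinimalDegrees.heckeStep b) u)
        (l.foldl (MinimalDegrees.heckeStep b) v) := by
  induction l with
  | nil => exact fun h ↦ h
  | cons σ l ih => exact fun h ↦ ih (BruhatLE.heckeStep b h σ)

theorem mul_wordProd_le_foldl {l l' : List b.support} (h : l'.Sublist l) :
    ∀ u : P.weylGroup, BruhatLE b (u * wordProd b l') (l.foldl (heckeStep b) u) := by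
  induction h with
  | slnil => intro u; rw [wordProd_nil, mul_one]; exact bruhatLE_refl b u
  | cons σ _ ih =>
    exact fun u ↦ (ih u).trans (BruhatLE.foldl_heckeStep b _ (le_heckeStep b u σ))
  | cons_cons σ _ ih =>
    intro u
    rw [wordProd_cons, ← mul_assoc]
    exact (ih _).trans (BruhatLE.foldl_heckeStep b _ (mul_le_heckeStep b u σ))

theorem exists_foldl_eq (l : List b.support) :
    ∀ u : P.weylGroup, ∃ l', l'.Sublist l ∧ l.foldl (heckeStep b) u = u * wordProd b l' := by
  induction l with
  | nil => exact fun u ↦ ⟨[], List.Sublist.refl _, (mul_one u).symm⟩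
  | cons σ l ih =>
    intro u
    obtain ⟨l', h1, h2⟩ := ih (heckeStep b u σ)
    rcases heckeStep_eq_or b u σ with h | h
    · exact ⟨l', h1.cons σ, by rw [List.foldl_cons, h2, h]⟩
    · exact ⟨σ :: l', h1.cons_cons σ, by
        rw [List.foldl_cons, h2, h, wordProd_cons, mul_assoc]⟩

theorem foldl_heckeStep_one_of_isReducedWord {l : List b.support} {w : P.weylGroup}
    (hl : IsReducedWord b l w) : l.foldl (heckeStep b) 1 = w := by
  obtain ⟨l', h1, h2⟩ := exists_foldl_eq b l 1
  have h3 := mul_wordProd_le_foldl b (List.Sublist.refl l) 1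
  rw [one_mul, hl.1] at h3
  rcases BruhatLE.eq_or_length_lt b h3 with h | h
  · exact h.symm
  · rw [h2, one_mul, ← hl.2] at h
    have := length_wordProd_le b l'
    have := h1.length_le
    omega

theorem wordProd_le_of_sublist {l l' : List b.support} {w : P.weylGroup}
    (hl : IsReducedWord b l w) (h : l'.Sublist l) : BruhatLE b (wordProd b l') w := by
  have := mul_wordProd_le_foldl b h 1
  rwa [one_mul, foldl_heckeStep_one_of_isReducedWord b hl] at this

theorem exists_hecke_eq (u v : P.weylGroup) : ∃ v', BruhatLE b v' v ∧ hecke b u v = u * v' := by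
  obtain ⟨l', h1, h2⟩ := exists_foldl_eq b (exists_isReducedWord b v).choose u
  exact ⟨wordProd b l', wordProd_le_of_sublist b (exists_isReducedWord b v).choose_spec h1, h2⟩

/-- `u · v` is the greatest of the products `u' v'` with `u' ≤ u` and `v' ≤ v`. -/
theorem mul_le_hecke {u u' v v' : P.weylGroup} (hu : BruhatLE b u' u) (hv : BruhatLE b v' v) :
    BruhatLE b (u' * v') (hecke b u v) := by
  have hl := (exists_isReducedWord b v).choose_spec
  obtain ⟨l', h1, rfl⟩ := exists_sublist_of_bruhatLE b hv _ hl.1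
  exact (mul_wordProd_le_foldl b h1 u').trans (BruhatLE.foldl_heckeStep b _ hu)

theorem hecke_mono {u u' v v' : P.weylGroup} (hu : BruhatLE b u' u) (hv : BruhatLE b v' v) :
    BruhatLE b (hecke b u' v') (hecke b u v) := by
  obtain ⟨x, hx, h⟩ := exists_hecke_eq b u' v'
  rw [h]
  exact mul_le_hecke b hu (hx.trans hv)

theorem exists_of_le_hecke {u v y : P.weylGroup} (h : BruhatLE b y (hecke b u v)) :
    ∃ u' v', BruhatLE b u' u ∧ BruhatLE b v' v ∧ y = u' * v' := by
  obtain ⟨l, hl⟩ := exists_isReducedWord b u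
  have hr := (exists_isReducedWord b v).choose_spec
  obtain ⟨l', h1, h2⟩ := exists_foldl_eq b (exists_isReducedWord b v).choose u
  obtain ⟨m, hm, rfl⟩ := exists_sublist_of_bruhatLE b h (l ++ l')
    (by rw [wordProd_append, hl.1]; exact h2.symm)
  obtain ⟨m₁, m₂, rfl, h3, h4⟩ := List.sublist_append_iff.1 hm
  exact ⟨_, _, wordProd_le_of_sublist b hl h3, wordProd_le_of_sublist b hr (h4.trans h1),
    wordProd_append b _ _⟩

theorem hecke_assoc (u v w : P.weylGroup) :
    hecke b (hecke b u v) w = hecke b u (hecke b v w) := by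
  refine BruhatLE.antisymm b ?_ ?_
  · obtain ⟨w', hw, h⟩ := exists_hecke_eq b (hecke b u v) w
    obtain ⟨v', hv, h'⟩ := exists_hecke_eq b u v
    rw [h, h', mul_assoc]
    exact mul_le_hecke b (bruhatLE_refl b u) (mul_le_hecke b hv hw)
  · obtain ⟨y, hy, h⟩ := exists_hecke_eq b u (hecke b v w)
    obtain ⟨v', w', hv, hw, rfl⟩ := exists_of_le_hecke b hy
    rw [h, ← mul_assoc]
    exact mul_le_hecke b (mul_le_hecke b (bruhatLE_refl b u) hv) hw

theorem eq_one_of_bruhatLE_one {u : P.weylGroup} (h : BruhatLE b u 1) : u = 1 := by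
  obtain ⟨l', h1, h2⟩ := exists_sublist_of_bruhatLE b h [] rfl
  rw [List.sublist_nil.1 h1] at h2
  exact h2.symm

theorem hecke_one (u : P.weylGroup) : hecke b u 1 = u := by
  obtain ⟨v', hv, h⟩ := exists_hecke_eq b u 1
  rw [h, eq_one_of_bruhatLE_one b hv, mul_one]

theorem one_hecke (v : P.weylGroup) : hecke b 1 v = v := by
  obtain ⟨v', hv, h⟩ := exists_hecke_eq b 1 v
  have h2 := mul_le_hecke b (bruhatLE_refl b 1) (bruhatLE_refl b v)
  rw [h, one_mul, one_mul] at h2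
  rw [h, one_mul]
  exact BruhatLE.antisymm b hv h2

theorem one_bruhatLE (u : P.weylGroup) : BruhatLE b 1 u := by
  obtain ⟨l, hl⟩ := exists_isReducedWord b u
  exact wordProd_le_of_sublist b hl (List.nil_sublist l)

theorem le_hecke_left (u v : P.weylGroup) : BruhatLE b u (hecke b u v) := by
  simpa using mul_le_hecke b (bruhatLE_refl b u) (one_bruhatLE b v)

theorem le_hecke_right (u v : P.weylGroup) : BruhatLE b v (hecke b u v) := by
  simpa using mul_le_hecke b (one_bruhatLE b u) (bruhatLE_refl b v)

theorem hecke_simple (u : P.weylGroup) (σ : b.support) : hecke b u (𝐬 σ) = heckeStep b u σ := by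
  refine BruhatLE.antisymm b ?_ ?_
  · obtain ⟨v', hv, h⟩ := exists_hecke_eq b u (𝐬 σ)
    obtain ⟨l', h1, h2⟩ := exists_sublist_of_bruhatLE b hv [σ] (wordProd_singleton b σ)
    rw [h, ← h2]
    simpa using mul_wordProd_le_foldl b h1 u
  · rcases heckeStep_eq_or b u σ with h | h
    · rw [h]; exact le_hecke_left b _ _
    · rw [h]; exact mul_le_hecke b (bruhatLE_refl b u) (bruhatLE_refl b _)

theorem hecke_inv (u v : P.weylGroup) : (hecke b u v)⁻¹ = hecke b v⁻¹ u⁻¹ := by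
  have key (u v : P.weylGroup) : BruhatLE b (hecke b u v)⁻¹ (hecke b v⁻¹ u⁻¹) := by
    obtain ⟨v', hv, h⟩ := exists_hecke_eq b u v
    rw [h, mul_inv_rev]
    exact mul_le_hecke b (BruhatLE.inv b hv) (bruhatLE_refl b _)
  refine BruhatLE.antisymm b (key u v) ?_
  have := BruhatLE.inv b (key v⁻¹ u⁻¹)
  simpa using this

theorem simple_hecke_eq_or (σ : b.support) (u : P.weylGroup) :
    hecke b (𝐬 σ) u = u ∨ hecke b (𝐬 σ) u = 𝐬 σ * u := by
  have h : hecke b (𝐬 σ) u = (heckeStep b u⁻¹ σ)⁻¹ := by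
    rw [← hecke_simple, hecke_inv, inv_inv, ofIdx_inv]
  rw [h]
  rcases heckeStep_eq_or b u⁻¹ σ with h | h
  · left; rw [h, inv_inv]
  · right; rw [h, mul_inv_rev, inv_inv, ofIdx_inv]

/-- A simple root with `⟨σ, α^∨⟩ > 0` is an inversion of `s_α`. -/
theorem not_isPos_reflectionPerm_of_pairingIn_pos {α : ι} (hα : b.IsPos α) {σ : b.support}
    (h : 0 < P.pairingIn ℤ σ α) : ¬ b.IsPos (P.reflectionPerm α σ) := by
  intro hp
  have h1 := (isPos_iff_rootCoeff_nonneg b).1 hp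
  rw [rootCoeff_reflectionPerm] at h1
  have h0 := (isPos_iff_rootCoeff_nonneg b).1 hα
  have h2 : ∀ τ, rootCoeff b α τ ≤ rootCoeff b σ τ := by
    intro τ
    have := h1 τ
    have := h0 τ
    simp only [Pi.zero_apply, Pi.sub_apply, Pi.smul_apply, smul_eq_mul] at *
    nlinarith
  have h3 : ∀ τ, τ ≠ σ → rootCoeff b α τ = 0 := by
    intro τ hτ
    have := h2 τ
    rw [rootCoeff_simple_ne b hτ.symm] at this
    exact le_antisymm this (h0 τ)
  obtain ⟨τ, hτ⟩ := exists_rootCoeff_pos b hα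
  have hτσ : τ = σ := by
    by_contra hne
    exact hτ.ne' (h3 τ hne)
  subst hτσ
  have h4 : α = τ := by
    refine ext_rootCoeff b (funext fun ρ ↦ ?_)
    by_cases hρ : ρ = τ
    · subst hρ
      have := h2 ρ
      rw [rootCoeff_simple_self] at this ⊢
      omega
    · rw [h3 ρ hρ, rootCoeff_simple_ne b (Ne.symm hρ)]
  rw [h4] at hp
  exact (isPos_reflectionPerm_self b).1 hp (isPos_simple b τ)

theorem refl_hecke_simple_of_pos {α : ι} (hα : b.IsPos α) {σ : b.support}
    (h : 0 < P.pairingIn ℤ σ α) : hecke b (𝐬 α) (𝐬 σ) = 𝐬 α := by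
  rw [hecke_simple]
  exact heckeStep_of_not_isPos b (not_isPos_reflectionPerm_of_pairingIn_pos b hα h)

theorem simple_hecke_refl_of_pos {α : ι} (hα : b.IsPos α) {σ : b.support}
    (h : 0 < P.pairingIn ℤ σ α) : hecke b (𝐬 σ) (𝐬 α) = 𝐬 α := by
  have := congrArg (·⁻¹) (refl_hecke_simple_of_pos b hα h)
  simpa only [hecke_inv, ofIdx_inv] using this

theorem reflectionPerm_eq_self_of_pairingIn {i k : ι} (h : P.pairingIn ℤ i k = 0) :
    P.reflectionPerm k i = i := by
  apply P.root.injective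
  rw [P.root_reflectionPerm, P.reflection_apply_root, ← cast_pairingIn, h]
  simp

/-- For the Hecke product, `s_α` commutes with `s_σ` when `⟨σ, α^∨⟩ ≥ 0`: if the pairing is
positive, then `s_α` absorbs `s_σ` on both sides. -/
theorem refl_hecke_comm_simple {α : ι} (hα : b.IsPos α) {σ : b.support}
    (h : 0 ≤ P.pairingIn ℤ σ α) : hecke b (𝐬 α) (𝐬 σ) = hecke b (𝐬 σ) (𝐬 α) := by
  rcases h.eq_or_lt with h | h
  · have h1 : hecke b (𝐬 α) (𝐬 σ) = 𝐬 α * 𝐬 σ := by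
      rw [hecke_simple]
      refine heckeStep_of_isPos b ?_
      rw [weylGroupToPerm_ofIdx, reflectionPerm_eq_self_of_pairingIn h.symm]
      exact isPos_simple b σ
    have h2 : hecke b (𝐬 σ) (𝐬 α) = 𝐬 σ * 𝐬 α := by
      have := congrArg (·⁻¹) h1
      simpa only [hecke_inv, mul_inv_rev, ofIdx_inv] using this
    rw [h1, h2, mul_ofIdx b, weylGroupToPerm_ofIdx, reflectionPerm_eq_self_of_pairingIn h.symm]
  · rw [refl_hecke_simple_of_pos b hα h, simple_hecke_refl_of_pos b hα h]

end Hecke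

/-! ### Products of reflections of bounded degree -/

section ReflProducts

variable (b : P.Base) [Fintype ι] [P.IsRootSystem] [P.IsCrystallographic] [P.IsReduced]

/-- The Weyl group elements reached by chains of degree at most `d`: the ordinary products
`s_{β₁} ⋯ s_{βₖ}` of reflections in positive roots with `β₁^∨ + ⋯ + βₖ^∨ ≤ d`. Degrees in
`ℤΔ^∨` are encoded by their coefficients on the simple coroots, with the pointwise order. -/
def reflProducts (d : b.support → ℤ) : Set P.weylGroup :=
  {w | ∃ C : List ι, (∀ β ∈ C, b.IsPos β) ∧ (C.map 𝐬).prod = w ∧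
    (C.map (corootCoeff b)).sum ≤ d}

theorem sum_corootCoeff_nonneg {C : List ι} (hC : ∀ β ∈ C, b.IsPos β) :
    0 ≤ (C.map (corootCoeff b)).sum := by
  refine List.sum_nonneg fun x hx ↦ ?_
  obtain ⟨β, hβ, rfl⟩ := List.mem_map.1 hx
  exact corootCoeff_nonneg b (hC β hβ)

theorem degPair_simple_nonpos {σ : b.support} {s : b.support → ℤ} (hs : 0 ≤ s) (h : s σ = 0) :
    degPair b σ s ≤ 0 := by
  refine Finset.sum_nonpos fun τ _ ↦ ?_
  by_cases hne : σ = τ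
  · rw [← hne, h, zero_mul]
  · exact mul_nonpos_of_nonneg_of_nonpos (hs τ)
      (b.pairingIn_le_zero_of_ne (fun h ↦ hne (Subtype.ext h)) σ.2 τ.2)

theorem le_of_apply_le {σ : b.support} {x d : b.support → ℤ} {n : ℤ} (hx : x ≤ d)
    (h : x σ + n ≤ d σ) : x + n • corootCoeff b σ ≤ d := by
  intro τ
  by_cases hne : σ = τ
  · subst hne
    simpa [corootCoeff_simple_self] using h
  · simpa [corootCoeff_simple_ne b hne] using hx τ

/-- Conjugating a chain by a simple reflection `s_σ`: scanning the chain, the roots different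
from `σ` are alternately kept and reflected, the switch taking place at each occurrence of `σ`,
which is dropped. Depending on the initial state one gets two chains, whose total gain is the
pairing of `σ` with the degree of the original chain. -/
theorem exists_conjugate_chains (σ : b.support) (C : List ι) (hC : ∀ β ∈ C, b.IsPos β) :
    ∃ (n₀ n₁ : ℤ) (C₀ C₁ : List ι), (∀ β ∈ C₀, b.IsPos β) ∧ (∀ β ∈ C₁, b.IsPos β) ∧
      (C₀.map (corootCoeff b)).sum = (C.map (corootCoeff b)).sum - n₀ • corootCoeff b σ ∧
      (C₁.map (corootCoeff b)).sum = (C.map (corootCoeff b)).sum - n₁ • corootCoeff b σ ∧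
      n₀ + n₁ = degPair b σ (C.map (corootCoeff b)).sum ∧
      ((C₀.map 𝐬).prod = (C.map 𝐬).prod ∧
          (C₁.map 𝐬).prod = 𝐬 σ * (C.map 𝐬).prod * 𝐬 σ ∨
        (C₀.map 𝐬).prod = (C.map 𝐬).prod * 𝐬 σ ∧
          (C₁.map 𝐬).prod = 𝐬 σ * (C.map 𝐬).prod) := by
  induction C with
  | nil =>
    exact ⟨0, 0, [], [], by simp, by simp, by simp, by simp, by simp [degPair],
      Or.inl ⟨rfl, by simp [ofIdx_mul_self]⟩⟩
  | cons β C ih =>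
    obtain ⟨n₀, n₁, C₀, C₁, h0, h1, e0, e1, hn, hp⟩ :=
      ih fun γ hγ ↦ hC γ (List.mem_cons_of_mem _ hγ)
    have hβ : b.IsPos β := hC β List.mem_cons_self
    by_cases hne : β = σ
    · subst hne
      refine ⟨n₁ + 1, n₀ + 1, C₁, C₀, h1, h0, ?_, ?_, ?_, ?_⟩
      · rw [e1, List.map_cons, List.sum_cons, add_smul, one_smul]; abel
      · rw [e0, List.map_cons, List.sum_cons, add_smul, one_smul]; abel
      · rw [List.map_cons, List.sum_cons, degPair_add, degPair_corootCoeff, P.pairingIn_same,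
          ← hn]; ring
      · simp only [List.map_cons, List.prod_cons, ofIdx_mul_ofIdx_mul]
        rcases hp with ⟨p0, p1⟩ | ⟨p0, p1⟩
        · exact Or.inr ⟨p1, p0⟩
        · exact Or.inl ⟨p1, p0⟩
    · refine ⟨n₀, n₁ + P.pairingIn ℤ σ β, β :: C₀, P.reflectionPerm σ β :: C₁, ?_, ?_, ?_, ?_,
        ?_, ?_⟩
      · simpa [hβ] using h0
      · simpa [isPos_reflectionPerm_simple b σ hβ hne] using h1
      · simp only [List.map_cons, List.sum_cons, e0]; abel
      · simp only [List.map_cons, List.sum_cons, e1, corootCoeff_reflectionPerm, add_smul]; abel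
      · rw [List.map_cons, List.sum_cons, degPair_add, degPair_corootCoeff, ← hn]; ring
      · simp only [List.map_cons, List.prod_cons, ofIdx_reflectionPerm]
        rcases hp with ⟨p0, p1⟩ | ⟨p0, p1⟩
        · refine Or.inl ⟨by rw [p0], ?_⟩
          rw [p1]; simp only [mul_assoc, ofIdx_mul_ofIdx_mul]
        · refine Or.inr ⟨by rw [p0, mul_assoc], ?_⟩
          rw [p1]; simp only [mul_assoc, ofIdx_mul_ofIdx_mul]

theorem exists_of_mem_reflProducts {σ : b.support} {d : b.support → ℤ}
    (hσ : 0 < degPair b σ d) {w : P.weylGroup} (hw : w ∈ reflProducts b d) :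
    ∃ y ∈ reflProducts b (d - corootCoeff b σ),
      w = y ∨ w = 𝐬 σ * y ∨ w = y * 𝐬 σ ∨ w = 𝐬 σ * y * 𝐬 σ := by
  obtain ⟨C, hC, rfl, hd⟩ := hw
  obtain ⟨n₀, n₁, C₀, C₁, h0, h1, e0, e1, hn, hp⟩ := exists_conjugate_chains b σ C hC
  set c := (C.map (corootCoeff b)).sum
  rcases (hd σ).lt_or_eq with hlt | heq
  · refine ⟨_, ⟨C, hC, rfl, ?_⟩, Or.inl rfl⟩
    have := le_of_apply_le b (σ := σ) (n := 1) hd (by lia)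
    rwa [one_smul, ← le_sub_iff_add_le] at this
  · have hs := degPair_simple_nonpos b (σ := σ) (sub_nonneg.2 hd) (by simp [heq])
    rw [degPair_sub, ← hn] at hs
    have key {n : ℤ} (h : 0 < n) : c - n • corootCoeff b σ ≤ d - corootCoeff b σ := by
      have := le_of_apply_le b (σ := σ) (n := 1 - n) hd (by lia)
      rw [sub_smul, one_smul] at this
      rw [le_sub_iff_add_le]
      convert this using 1
      abel
    by_cases hn0 : 0 < n₀
    · refine ⟨_, ⟨C₀, h0, rfl, e0.trans_le (key hn0)⟩, ?_⟩
      rcases hp with ⟨p0, p1⟩ | ⟨p0, p1⟩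
      · exact Or.inl p0.symm
      · rw [p0, mul_ofIdx_mul_ofIdx]; exact Or.inr (Or.inr (Or.inl rfl))
    · refine ⟨_, ⟨C₁, h1, rfl, e1.trans_le (key (by lia))⟩, ?_⟩
      rcases hp with ⟨p0, p1⟩ | ⟨p0, p1⟩
      · refine Or.inr (Or.inr (Or.inr ?_))
        rw [p1]; simp only [mul_assoc, ofIdx_mul_ofIdx_mul, ofIdx_mul_self, mul_one]
      · refine Or.inr (Or.inl ?_)
        rw [p1, ofIdx_mul_ofIdx_mul]

theorem reflProducts_mono {d d' : b.support → ℤ} (h : d ≤ d') :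
    reflProducts b d ⊆ reflProducts b d' :=
  fun _ ⟨C, hC, hw, hd⟩ ↦ ⟨C, hC, hw, hd.trans h⟩

theorem simple_mul_mem_reflProducts (σ : b.support) {d : b.support → ℤ} {y : P.weylGroup}
    (hy : y ∈ reflProducts b d) : 𝐬 σ * y ∈ reflProducts b (d + corootCoeff b σ) := by
  obtain ⟨C, hC, rfl, hd⟩ := hy
  refine ⟨(σ : ι) :: C, by simpa [isPos_simple b σ] using hC, by simp, ?_⟩
  rw [List.map_cons, List.sum_cons, add_comm]
  exact add_le_add_left hd _

theorem mul_simple_mem_reflProducts (σ : b.support) {d : b.support → ℤ} {y : P.weylGroup}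
    (hy : y ∈ reflProducts b d) : y * 𝐬 σ ∈ reflProducts b (d + corootCoeff b σ) := by
  obtain ⟨C, hC, rfl, hd⟩ := hy
  refine ⟨C ++ [(σ : ι)], ?_, by simp, ?_⟩
  · intro β hβ
    rcases List.mem_append.1 hβ with h | h
    · exact hC β h
    · rw [List.mem_singleton.1 h]; exact isPos_simple b σ
  · rw [List.map_append, List.sum_append, List.map_singleton, List.sum_singleton]
    exact add_le_add_left hd _

theorem simple_mul_mul_simple_mem_reflProducts {σ : b.support} {d : b.support → ℤ}
    (hσ : 0 < degPair b σ d) {y : P.weylGroup}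
    (hy : y ∈ reflProducts b (d - corootCoeff b σ)) : 𝐬 σ * y * 𝐬 σ ∈ reflProducts b d := by
  have hy' := hy
  obtain ⟨C, hC, rfl, hd⟩ := hy'
  obtain ⟨n₀, n₁, C₀, C₁, h0, h1, e0, e1, hn, hp⟩ := exists_conjugate_chains b σ C hC
  set c := (C.map (corootCoeff b)).sum with hc
  set y := (C.map 𝐬).prod with hyy
  have hdσ : c σ ≤ d σ - 1 := by simpa [corootCoeff_simple_self] using hd σ
  have hd' : c ≤ d := hd.trans (sub_le_self _ (corootCoeff_nonneg b (isPos_simple b σ)))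
  have key {n : ℤ} (h : c σ + n ≤ d σ) {C' : List ι} {m : ℤ} (hC' : ∀ β ∈ C', b.IsPos β)
      (h' : (C'.map (corootCoeff b)).sum = c - m • corootCoeff b σ) :
      (C'.map 𝐬).prod ∈ reflProducts b (d - (m + n) • corootCoeff b σ) := by
    refine ⟨C', hC', rfl, ?_⟩
    have := le_of_apply_le b hd' h
    rw [h', le_sub_iff_add_le]
    convert this using 1
    rw [add_smul]; abel
  -- room for `2 σ^∨` allows a factor `s_σ` on either side
  have two {n : ℤ} {x : P.weylGroup} (h : 2 ≤ n)
      (hx : x ∈ reflProducts b (d - n • corootCoeff b σ)) : 𝐬 σ * x * 𝐬 σ ∈ reflProducts b d := by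
    refine reflProducts_mono b ?_
      (mul_simple_mem_reflProducts b σ (simple_mul_mem_reflProducts b σ hx))
    intro τ
    have := corootCoeff_nonneg b (isPos_simple b σ) τ
    simp only [Pi.add_apply, Pi.sub_apply, Pi.smul_apply, smul_eq_mul, Pi.zero_apply] at this ⊢
    nlinarith
  have shrink {n m : ℤ} {x : P.weylGroup} (h : m ≤ n)
      (hx : x ∈ reflProducts b (d - n • corootCoeff b σ)) :
      x ∈ reflProducts b (d - m • corootCoeff b σ) := by
    refine reflProducts_mono b (sub_le_sub_left ?_ _) hx
    intro τ
    exact mul_le_mul_of_nonneg_right h (corootCoeff_nonneg b (isPos_simple b σ) τ)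
  rcases hdσ.lt_or_eq with hlt | heq
  · have := key (n := 2) (by lia) (m := 0) hC (by simp [hc])
    exact two (by lia) this
  · have hs : degPair b σ (d - corootCoeff b σ - c) ≤ 0 :=
      degPair_simple_nonpos b (sub_nonneg.2 hd) (by simp [corootCoeff_simple_self, heq])
    rw [degPair_sub, degPair_sub, ← hn, degPair_corootCoeff, P.pairingIn_same] at hs
    rcases hp with ⟨p0, p1⟩ | ⟨p0, p1⟩
    · by_cases hn1 : -1 ≤ n₁
      · have := shrink (m := 0) (by lia) (key (n := 1) (by lia) h1 e1)
        rwa [p1, zero_smul, sub_zero] at this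
      · have := two (by lia) (key (n := 1) (by lia) h0 e0)
        rwa [p0] at this
    · by_cases hn1 : 0 ≤ n₁
      · have := mul_simple_mem_reflProducts b σ
          (shrink (m := 1) (by lia) (key (n := 1) (by lia) h1 e1))
        rwa [p1, one_smul, sub_add_cancel] at this
      · have := simple_mul_mem_reflProducts b σ
          (shrink (m := 1) (by lia) (key (n := 1) (by lia) h0 e0))
        rwa [p0, one_smul, sub_add_cancel, ← mul_assoc] at this

theorem mem_reflProducts_zero {w : P.weylGroup} : w ∈ reflProducts b 0 ↔ w = 1 := by
  constructor
  · rintro ⟨C, hC, rfl, hd⟩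
    cases C with
    | nil => rfl
    | cons β C =>
      obtain ⟨σ, hσ⟩ := exists_corootCoeff_pos b (hC β List.mem_cons_self)
      have h1 := sum_corootCoeff_nonneg b
        (C := C) (fun γ hγ ↦ hC γ (List.mem_cons_of_mem _ hγ)) σ
      have h2 := hd σ
      simp only [List.map_cons, List.sum_cons, Pi.add_apply, Pi.zero_apply] at h1 h2
      lia
  · rintro rfl
    exact ⟨[], by simp, rfl, by simp⟩

/-- If `m` is the greatest element for the degree `d - σ^∨` and `⟨σ, d⟩ > 0`, then the Hecke
product `s_σ · m · s_σ` is the greatest element for `d`. -/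
theorem isGreatest_reflProducts_step {σ : b.support} {d : b.support → ℤ}
    (hσ : 0 < degPair b σ d) {m : P.weylGroup}
    (hm : m ∈ reflProducts b (d - corootCoeff b σ))
    (hmax : ∀ y ∈ reflProducts b (d - corootCoeff b σ), BruhatLE b y m) :
    hecke b (𝐬 σ) (hecke b m (𝐬 σ)) ∈ reflProducts b d ∧
      ∀ w ∈ reflProducts b d, BruhatLE b w (hecke b (𝐬 σ) (hecke b m (𝐬 σ))) := by
  constructor
  · have h0 : m ∈ reflProducts b d := reflProducts_mono b
      (sub_le_self _ (corootCoeff_nonneg b (isPos_simple b σ))) hm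
    have h1 : 𝐬 σ * m ∈ reflProducts b d := by
      simpa using simple_mul_mem_reflProducts b σ hm
    have h2 : m * 𝐬 σ ∈ reflProducts b d := by
      simpa using mul_simple_mem_reflProducts b σ hm
    have h3 := simple_mul_mul_simple_mem_reflProducts b hσ hm
    rw [mul_assoc] at h3
    rw [hecke_simple]
    rcases heckeStep_eq_or b m σ with h | h <;> rw [h] <;>
      rcases simple_hecke_eq_or b σ _ with h' | h' <;> rw [h'] <;> assumption
  · intro w hw
    obtain ⟨y, hy, h⟩ := exists_of_mem_reflProducts b hσ hw
    have hle := hmax y hy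
    have hσ := bruhatLE_refl b (𝐬 σ)
    rcases h with rfl | rfl | rfl | rfl
    · exact (hle.trans (le_hecke_left b _ _)).trans (le_hecke_right b _ _)
    · exact mul_le_hecke b hσ (hle.trans (le_hecke_left b _ _))
    · exact (mul_le_hecke b hle hσ).trans (le_hecke_right b _ _)
    · rw [mul_assoc]
      exact mul_le_hecke b hσ (mul_le_hecke b hle hσ)

theorem exists_pred {d : b.support → ℤ} (hd : 0 ≤ d) (h0 : d ≠ 0) :
    ∃ σ : b.support, 0 < degPair b σ d ∧ 0 ≤ d - corootCoeff b σ := by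
  obtain ⟨σ, h1, h2⟩ := exists_degPair_pos b hd h0
  refine ⟨σ, h2, sub_nonneg.2 ?_⟩
  have := le_of_apply_le b (σ := σ) (n := 1) hd (by simpa using Int.add_one_le_iff.2 h1)
  simpa using this

/-- Induction on degrees, lowering `d` by simple coroots `σ^∨` with `⟨σ, d⟩ > 0`. -/
theorem degree_induction {p : (b.support → ℤ) → Prop} (h0 : p 0)
    (step : ∀ (d : b.support → ℤ) (σ : b.support), 0 ≤ d → 0 ≤ d - corootCoeff b σ →
      0 < degPair b σ d → p (d - corootCoeff b σ) → p d) {d : b.support → ℤ} (hd : 0 ≤ d) :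
    p d := by
  obtain ⟨n, hn⟩ : ∃ n : ℕ, (∑ τ, d τ) = n := Int.eq_ofNat_of_zero_le
    (Finset.sum_nonneg fun τ _ ↦ hd τ)
  induction n using Nat.strong_induction_on generalizing d with
  | _ n ih =>
    by_cases hd0 : d = 0
    · rw [hd0]; exact h0
    · obtain ⟨σ, h1, h2⟩ := exists_pred b hd hd0
      have hsum : ∑ τ, (d - corootCoeff b σ) τ = ∑ τ, d τ - 1 := by
        simp only [Pi.sub_apply, Finset.sum_sub_distrib]
        rw [Finset.sum_eq_single (a := σ) (f := corootCoeff b σ), corootCoeff_simple_self]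
        · intro τ _ hne; exact corootCoeff_simple_ne b hne.symm
        · simp
      have hpos : 0 ≤ ∑ τ, (d - corootCoeff b σ) τ := Finset.sum_nonneg fun τ _ ↦ h2 τ
      exact step d σ hd h2 h1 (ih (n - 1) (by lia) h2 (by rw [hsum, hn]; lia))

theorem exists_isGreatest_reflProducts {d : b.support → ℤ} (hd : 0 ≤ d) :
    ∃ m ∈ reflProducts b d, ∀ w ∈ reflProducts b d, BruhatLE b w m := by
  refine degree_induction b
    (p := fun d ↦ ∃ m ∈ reflProducts b d, ∀ w ∈ reflProducts b d, BruhatLE b w m) ?_ ?_ hd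
  · refine ⟨1, (mem_reflProducts_zero b).2 rfl, fun w hw ↦ ?_⟩
    rw [(mem_reflProducts_zero b).1 hw]; exact bruhatLE_refl b 1
  · rintro d σ - - hσ ⟨m, hm, hmax⟩
    exact ⟨_, isGreatest_reflProducts_step b hσ hm hmax⟩

open scoped Classical in
/-- The Bruhat-greatest element among the products of reflections of degree at most `d`
(the default value is used only when `d` is not effective). It is the element `z_d` of `G/B`. -/
def maxElt (d : b.support → ℤ) : P.weylGroup :=
  if h : 0 ≤ d then (exists_isGreatest_reflProducts b h).choose else 1

theorem maxElt_mem {d : b.support → ℤ} (hd : 0 ≤ d) : maxElt b d ∈ reflProducts b d := by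
  rw [maxElt, dif_pos hd]
  exact (exists_isGreatest_reflProducts b hd).choose_spec.1

theorem le_maxElt {d : b.support → ℤ} (hd : 0 ≤ d) {w : P.weylGroup}
    (hw : w ∈ reflProducts b d) : BruhatLE b w (maxElt b d) := by
  rw [maxElt, dif_pos hd]
  exact (exists_isGreatest_reflProducts b hd).choose_spec.2 w hw

theorem maxElt_zero : maxElt b 0 = 1 :=
  (mem_reflProducts_zero b).1 (maxElt_mem b le_rfl)

theorem maxElt_step {σ : b.support} {d : b.support → ℤ} (hd : 0 ≤ d - corootCoeff b σ)
    (hσ : 0 < degPair b σ d) :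
    maxElt b d = hecke b (𝐬 σ) (hecke b (maxElt b (d - corootCoeff b σ)) (𝐬 σ)) := by
  have h := isGreatest_reflProducts_step b hσ (maxElt_mem b hd) fun y hy ↦ le_maxElt b hd hy
  have hd' : 0 ≤ d :=
    hd.trans (sub_le_self _ (corootCoeff_nonneg b (isPos_simple b σ)))
  exact BruhatLE.antisymm b (h.2 _ (maxElt_mem b hd')) (le_maxElt b hd' h.1)

end ReflProducts

/-! ### Pairs of roots -/

section Pairs

variable (b : P.Base) [Fintype ι] [P.IsRootSystem] [P.IsCrystallographic] [P.IsReduced]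

theorem pairingIn_pos_comm {i j : ι} : 0 < P.pairingIn ℤ i j ↔ 0 < P.pairingIn ℤ j i :=
  P.zero_lt_pairingIn_iff' ℤ

theorem pairingIn_neg_comm {i j : ι} : P.pairingIn ℤ i j < 0 ↔ P.pairingIn ℤ j i < 0 :=
  P.pairingIn_lt_zero_iff ℤ

theorem pairingIn_zero_comm {i j : ι} : P.pairingIn ℤ i j = 0 ↔ P.pairingIn ℤ j i = 0 :=
  P.pairingIn_eq_zero_iff

theorem eq_reflectionPerm_self_iff {i j : ι} :
    i = P.reflectionPerm j j ↔ P.root i = -P.root j := by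
  rw [← P.root.injective.eq_iff, P.root_reflectionPerm, P.reflection_apply_self]

theorem pairingIn_mem {i j : ι} (h : i ≠ j) (h' : P.root i ≠ -P.root j) :
    (P.pairingIn ℤ i j, P.pairingIn ℤ j i) ∈
      ({(0, 0), (1, 1), (-1, -1), (1, 2), (2, 1), (-1, -2), (-2, -1), (1, 3), (3, 1), (-1, -3),
        (-3, -1)} : Set (ℤ × ℤ)) :=
  P.pairingIn_pairingIn_mem_set_of_isCrystal_of_isRed' i j
    (fun h1 ↦ h (P.root.injective h1)) h'

theorem pairingIn_eq_one_or {i j : ι} (h : i ≠ j) (hpos : 0 < P.pairingIn ℤ i j) :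
    P.pairingIn ℤ i j = 1 ∨ P.pairingIn ℤ j i = 1 := by
  have h' : P.root i ≠ -P.root j := by
    intro h'
    rw [eq_reflectionPerm_self_iff.2 h', P.pairingIn_reflectionPerm_self_left,
      P.pairingIn_same] at hpos
    lia
  have := pairingIn_mem h h'
  simp only [Set.mem_insert_iff, Set.mem_singleton_iff, Prod.mk.injEq] at this
  lia

theorem pairingIn_eq_neg_one_or {i j : ι} (h' : P.root i ≠ -P.root j)
    (hneg : P.pairingIn ℤ i j < 0) : P.pairingIn ℤ i j = -1 ∨ P.pairingIn ℤ j i = -1 := by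
  have h : i ≠ j := by
    rintro rfl
    rw [P.pairingIn_same] at hneg
    lia
  have := pairingIn_mem h h'
  simp only [Set.mem_insert_iff, Set.mem_singleton_iff, Prod.mk.injEq] at this
  lia

theorem root_ne_neg_of_isPos {i j : ι} (hi : b.IsPos i) (hj : b.IsPos j) :
    P.root i ≠ -P.root j := by
  intro h
  rw [eq_reflectionPerm_self_iff.2 h, isPos_reflectionPerm_self] at hi
  exact hi hj

theorem isPos_of_rootCoeff_le {i j : ι} (hi : b.IsPos i) (h : rootCoeff b i ≤ rootCoeff b j) :
    b.IsPos j :=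
  (isPos_iff_rootCoeff_nonneg b).2 (((isPos_iff_rootCoeff_nonneg b).1 hi).trans h)

/-- Two positive roots `α`, `β` with `(α, β) < 0` admit a root above both of them, of coroot
`α^∨ + β^∨`. -/
theorem exists_corootCoeff_eq_add {α β : ι} (hα : b.IsPos α) (hβ : b.IsPos β)
    (h : P.pairingIn ℤ α β < 0) :
    ∃ μ, corootCoeff b μ = corootCoeff b α + corootCoeff b β ∧
      rootCoeff b α + rootCoeff b β ≤ rootCoeff b μ := by
  have key {α β : ι} (hβ : b.IsPos β) (h : P.pairingIn ℤ α β < 0)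
      (h1 : P.pairingIn ℤ β α = -1) :
      ∃ μ, corootCoeff b μ = corootCoeff b α + corootCoeff b β ∧
        rootCoeff b α + rootCoeff b β ≤ rootCoeff b μ := by
    refine ⟨P.reflectionPerm β α, ?_, ?_⟩
    · rw [corootCoeff_reflectionPerm, h1, neg_one_smul, sub_neg_eq_add]
    · rw [rootCoeff_reflectionPerm]
      intro τ
      have := (isPos_iff_rootCoeff_nonneg b).1 hβ τ
      simp only [Pi.add_apply, Pi.sub_apply, Pi.smul_apply, smul_eq_mul, Pi.zero_apply] at this ⊢
      nlinarith
  rcases pairingIn_eq_neg_one_or (root_ne_neg_of_isPos b hα hβ) h with h1 | h1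
  · obtain ⟨μ, hμ, hμ'⟩ := key hα (pairingIn_neg_comm.1 h) h1
    exact ⟨μ, by rw [hμ, add_comm], by rwa [add_comm]⟩
  · exact key hβ h h1

theorem corootCoeff_ne_zero (i : ι) : corootCoeff b i ≠ 0 := by
  intro h
  have hi := isPos_of_corootCoeff_nonneg b h.ge
  obtain ⟨σ, hσ⟩ := exists_corootCoeff_pos b hi
  rw [h] at hσ
  exact lt_irrefl _ hσ

end Pairs

/-! ### The greatest element of a coroot -/

section Good

variable (b : P.Base) [Fintype ι] [P.IsRootSystem] [P.IsCrystallographic] [P.IsReduced]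

/-- A root `α` such that every inversion `γ ≠ α` of `s_α` satisfies `⟨γ, α^∨⟩ = 1`; these are the
roots whose reflection `s_α` has length `⟨2ρ, α^∨⟩ - 1`. -/
def IsCosmall (α : ι) : Prop :=
  ∀ γ, b.IsPos γ → γ ≠ α → ¬ b.IsPos (P.reflectionPerm α γ) → P.pairingIn ℤ γ α = 1

variable {b} in
theorem IsCosmall.pairingIn_simple {α : ι} (h : IsCosmall b α) (hα : b.IsPos α) {σ : b.support}
    (hσ : 0 < P.pairingIn ℤ σ α) (hne : (σ : ι) ≠ α) : P.pairingIn ℤ σ α = 1 :=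
  h σ (isPos_simple b σ) hne (not_isPos_reflectionPerm_of_pairingIn_pos b hα hσ)

theorem pairingIn_simple_reflectionPerm (i k : ι) :
    P.pairingIn ℤ k (P.reflectionPerm k i) = -P.pairingIn ℤ k i := by
  rw [P.pairingIn_reflectionPerm, P.pairingIn_reflectionPerm_self_left]

/-- A reflected root `s_k i` is positive when `i`, `k` are positive and `⟨i, k^∨⟩ ≤ 0`. -/
theorem isPos_reflectionPerm_of_nonpos {i k : ι} (hi : b.IsPos i) (hk : b.IsPos k)
    (h : P.pairingIn ℤ i k ≤ 0) : b.IsPos (P.reflectionPerm k i) := by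
  refine isPos_of_rootCoeff_le b hi ?_
  rw [rootCoeff_reflectionPerm]
  intro τ
  have := (isPos_iff_rootCoeff_nonneg b).1 hk τ
  simp only [Pi.sub_apply, Pi.smul_apply, smul_eq_mul, Pi.zero_apply] at this ⊢
  nlinarith

theorem reflectionPerm_reflectionPerm (i j k : ι) :
    P.reflectionPerm (P.reflectionPerm k i) j =
      P.reflectionPerm k (P.reflectionPerm i (P.reflectionPerm k j)) := by
  have h := congrArg (fun w ↦ P.weylGroupToPerm w j) (ofIdx_reflectionPerm (P := P) i k)
  simpa only [weylGroupToPerm_mul, weylGroupToPerm_ofIdx] using h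

variable {b} in
theorem IsCosmall.reflectionPerm {α : ι} (h : IsCosmall b α) (hα : b.IsPos α) {σ : b.support}
    (hσ : 0 < P.pairingIn ℤ σ α) (hne : (σ : ι) ≠ α) :
    IsCosmall b (P.reflectionPerm σ α) := by
  intro γ hγ hγα hinv
  have hα' : b.IsPos (P.reflectionPerm σ α) := isPos_reflectionPerm_simple b σ hα hne.symm
  have hγσ : γ ≠ σ := by
    rintro rfl
    refine hinv (isPos_reflectionPerm_of_nonpos b (isPos_simple b σ) hα' ?_)
    rw [pairingIn_simple_reflectionPerm]
    lia
  have hγ' := isPos_reflectionPerm_simple b σ hγ hγσ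
  rw [reflectionPerm_reflectionPerm] at hinv
  rw [P.pairingIn_reflectionPerm]
  refine h _ hγ' (fun h' ↦ hγα (by rw [← h', P.reflectionPerm_self])) fun hpos ↦ ?_
  by_cases h1 : P.reflectionPerm α (P.reflectionPerm σ γ) = σ
  · have h2 : P.reflectionPerm σ γ = P.reflectionPerm α σ :=
      (P.reflectionPerm_self α _).symm.trans (congrArg _ h1)
    rw [h2] at hγ'
    exact not_isPos_reflectionPerm_of_pairingIn_pos b hα hσ hγ'
  · exact hinv (isPos_reflectionPerm_simple b σ hpos h1)

variable {b} in
/-- The greatest element for the degree `α^∨` of a cosmall root is the reflection `s_α`. -/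
theorem IsCosmall.maxElt_eq {α : ι} (h : IsCosmall b α) (hα : b.IsPos α) :
    maxElt b (corootCoeff b α) = 𝐬 α := by
  refine degree_induction b (p := fun d ↦ ∀ α, b.IsPos α → IsCosmall b α → corootCoeff b α = d →
    maxElt b d = 𝐬 α) ?_ ?_ (corootCoeff_nonneg b hα) α hα h rfl
  · intro α _ _ h0
    exact absurd h0 (corootCoeff_ne_zero b α)
  · rintro d σ - hd hσ ih α hα h rfl
    rw [maxElt_step b hd hσ]
    rw [degPair_corootCoeff] at hσ
    by_cases hne : (σ : ι) = α
    · subst hne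
      rw [sub_self, maxElt_zero, one_hecke, refl_hecke_simple_of_pos b hα hσ]
    · have h1 := h.pairingIn_simple hα hσ hne
      have hα' := isPos_reflectionPerm_simple b σ hα (Ne.symm hne)
      rw [ih (P.reflectionPerm σ α) hα' (h.reflectionPerm hα hσ hne)
        (by rw [corootCoeff_reflectionPerm, h1, one_smul])]
      have h2 : P.pairingIn ℤ σ (P.reflectionPerm σ α) = -1 := by
        rw [pairingIn_simple_reflectionPerm, h1]
      have h3 : b.IsPos (P.reflectionPerm (P.reflectionPerm σ α) σ) :=
        isPos_reflectionPerm_of_nonpos b (isPos_simple b σ) hα' (by lia)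
      have h4 : P.reflectionPerm (P.reflectionPerm σ α) σ ≠ σ := by
        intro h4
        have h5 := rootCoeff_reflectionPerm b σ (P.reflectionPerm σ α)
        rw [h4, h2, neg_one_smul, sub_neg_eq_add, left_eq_add] at h5
        obtain ⟨τ, hτ⟩ := exists_rootCoeff_pos b hα'
        rw [h5] at hτ
        exact lt_irrefl _ hτ
      rw [← hecke_assoc, hecke_simple]
      have h5 : hecke b (𝐬 σ) (𝐬 (P.reflectionPerm σ α)) = 𝐬 σ * 𝐬 (P.reflectionPerm σ α) := by
        rw [← inv_inj, hecke_inv, ofIdx_inv, ofIdx_inv, hecke_simple, heckeStep_of_isPos,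
          mul_inv_rev, ofIdx_inv, ofIdx_inv]
        exact h3
      rw [h5, heckeStep_of_isPos, ofIdx_reflectionPerm]
      · simp only [mul_assoc, ofIdx_mul_ofIdx_mul, ofIdx_mul_self, mul_one]
      · rw [weylGroupToPerm_mul]
        exact isPos_reflectionPerm_simple b σ h3 h4

end Good

/-! ### Adding a root to a degree -/

section AddRoot

variable (b : P.Base) [Fintype ι] [P.IsRootSystem] [P.IsCrystallographic] [P.IsReduced]

theorem apply_pos_of_sub_pos {σ τ : b.support} {f : b.support → ℤ}
    (h : 0 < (f - corootCoeff b σ) τ) : 0 < f τ := by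
  have := corootCoeff_nonneg b (isPos_simple b σ) τ
  simp only [Pi.sub_apply, Pi.zero_apply] at this h
  lia

theorem apply_pos_of_sub_nonneg {σ : b.support} {f : b.support → ℤ}
    (h : 0 ≤ f - corootCoeff b σ) : 0 < f σ := by
  have := h σ
  simp only [Pi.sub_apply, Pi.zero_apply, corootCoeff_simple_self] at this
  lia

/-- If `α` is cosmall and has nonnegative products with the simple roots in the support of `f`,
then the greatest element for `α^∨ + f` is the Hecke product of `s_α` with the one for `f`. -/
theorem maxElt_add {α : ι} (hα : b.IsPos α) (hgood : IsCosmall b α) {f : b.support → ℤ}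
    (hf : 0 ≤ f) (h : ∀ σ : b.support, 0 < f σ → 0 ≤ P.pairingIn ℤ σ α) :
    maxElt b (corootCoeff b α + f) = hecke b (𝐬 α) (maxElt b f) := by
  refine degree_induction b (p := fun f ↦ (∀ σ : b.support, 0 < f σ → 0 ≤ P.pairingIn ℤ σ α) →
    maxElt b (corootCoeff b α + f) = hecke b (𝐬 α) (maxElt b f)) ?_ ?_ hf h
  · intro _
    rw [add_zero, maxElt_zero, hecke_one, hgood.maxElt_eq hα]
  · intro f σ hf hfσ hσ ih h
    have h1 := h σ (apply_pos_of_sub_nonneg b hfσ)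
    have hadd : corootCoeff b α + f - corootCoeff b σ = corootCoeff b α + (f - corootCoeff b σ) :=
      add_sub_assoc _ _ _
    rw [maxElt_step b (σ := σ) (d := corootCoeff b α + f), maxElt_step b hfσ hσ, hadd,
      ih fun τ hτ ↦ h τ (apply_pos_of_sub_pos b hτ), hecke_assoc, ← hecke_assoc,
      ← refl_hecke_comm_simple b hα h1, hecke_assoc]
    · rw [hadd]; exact add_nonneg (corootCoeff_nonneg b hα) hfσ
    · rw [degPair_add, degPair_corootCoeff]; lia

theorem refl_hecke_maxElt_comm {α : ι} (hα : b.IsPos α) {f : b.support → ℤ}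
    (hf : 0 ≤ f) (h : ∀ σ : b.support, 0 < f σ → 0 ≤ P.pairingIn ℤ σ α) :
    hecke b (𝐬 α) (maxElt b f) = hecke b (maxElt b f) (𝐬 α) := by
  refine degree_induction b (p := fun f ↦ (∀ σ : b.support, 0 < f σ → 0 ≤ P.pairingIn ℤ σ α) →
    hecke b (𝐬 α) (maxElt b f) = hecke b (maxElt b f) (𝐬 α)) ?_ ?_ hf h
  · intro _
    rw [maxElt_zero, hecke_one, one_hecke]
  · intro f σ hf hfσ hσ ih h
    have h1 := refl_hecke_comm_simple b hα (h σ (apply_pos_of_sub_nonneg b hfσ))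
    rw [maxElt_step b hfσ hσ, ← hecke_assoc, h1, hecke_assoc, hecke_assoc, hecke_assoc, ← h1,
      ← hecke_assoc b (𝐬 α), ih fun τ hτ ↦ h τ (apply_pos_of_sub_pos b hτ), hecke_assoc]

/-- The part of a degree supported on the simple roots orthogonal to `α`. -/
def orthPart (α : ι) (g : b.support → ℤ) (σ : b.support) : ℤ :=
  if P.pairingIn ℤ σ α = 0 then g σ else 0

theorem orthPart_nonneg {α : ι} {g : b.support → ℤ} (hg : 0 ≤ g) : 0 ≤ orthPart b α g := by
  intro σ
  unfold orthPart
  split_ifs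
  · exact hg σ
  · exact le_rfl

theorem orthPart_le {α : ι} {g : b.support → ℤ} (hg : 0 ≤ g) : orthPart b α g ≤ g := by
  intro σ
  unfold orthPart
  split_ifs
  · exact le_rfl
  · exact hg σ

theorem pairingIn_eq_zero_of_orthPart_pos {α : ι} {g : b.support → ℤ} {σ : b.support}
    (h : 0 < orthPart b α g σ) : P.pairingIn ℤ σ α = 0 := by
  by_contra h'
  rw [orthPart, if_neg h'] at h
  exact lt_irrefl _ h

/-- The part of the degree `g` that is not orthogonal to `α` is absorbed by the Hecke product
with `s_α`. -/
theorem refl_hecke_maxElt_orthPart {α : ι} (hα : b.IsPos α) {g : b.support → ℤ}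
    (hg : 0 ≤ g) (h : ∀ σ : b.support, 0 < g σ → 0 ≤ P.pairingIn ℤ σ α) :
    hecke b (𝐬 α) (maxElt b (orthPart b α g)) = hecke b (𝐬 α) (maxElt b g) := by
  refine degree_induction b (p := fun g ↦ (∀ σ : b.support, 0 < g σ → 0 ≤ P.pairingIn ℤ σ α) →
    hecke b (𝐬 α) (maxElt b (orthPart b α g)) = hecke b (𝐬 α) (maxElt b g)) ?_ ?_ hg h
  · intro _
    have : orthPart b α 0 = 0 := by ext σ; simp [orthPart]
    rw [this]
  · intro g σ hg hgσ hσ ih h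
    have h1 := h σ (apply_pos_of_sub_nonneg b hgσ)
    have ih := ih fun τ hτ ↦ h τ (apply_pos_of_sub_pos b hτ)
    rw [maxElt_step b hgσ hσ]
    rcases h1.lt_or_eq with h1 | h1
    · have h2 : orthPart b α (g - corootCoeff b σ) = orthPart b α g := by
        ext τ
        unfold orthPart
        split_ifs with h3
        · have : σ ≠ τ := by rintro rfl; lia
          simp [corootCoeff_simple_ne b this]
        · rfl
      rw [h2] at ih
      rw [← hecke_assoc, refl_hecke_simple_of_pos b hα h1, ← hecke_assoc, ← ih,
        refl_hecke_maxElt_comm b hα (orthPart_nonneg b hg)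
          fun τ hτ ↦ (pairingIn_eq_zero_of_orthPart_pos b hτ).ge,
        hecke_assoc, refl_hecke_simple_of_pos b hα h1]
    · have h2 : orthPart b α (g - corootCoeff b σ) = orthPart b α g - corootCoeff b σ := by
        ext τ
        simp only [orthPart, Pi.sub_apply]
        split_ifs with h3
        · rfl
        · have : σ ≠ τ := by rintro rfl; exact h3 h1.symm
          simp [corootCoeff_simple_ne b this]
      have h3 : 0 < degPair b σ (orthPart b α g) := by
        have := degPair_simple_nonpos b (σ := σ) (sub_nonneg.2 (orthPart_le b (α := α) hg))
          (by simp [orthPart, h1.symm])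
        rw [degPair_sub] at this
        lia
      have h4 := refl_hecke_comm_simple b hα h1.le
      rw [maxElt_step b (σ := σ) (d := orthPart b α g) _ h3, ← h2, ← hecke_assoc, h4, hecke_assoc,
        ← hecke_assoc b (𝐬 α), ih, hecke_assoc, ← hecke_assoc, ← h4, hecke_assoc]
      rw [← h2]
      exact orthPart_nonneg b hgσ

end AddRoot

/-! ### Maximal roots and greedy decompositions -/

section Greedy

variable (b : P.Base) [Fintype ι] [P.IsRootSystem] [P.IsCrystallographic] [P.IsReduced]

/-- `α` is a maximal root of the degree `d` of `G/B`, with degrees and roots encoded by their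
coefficients. -/
structure IsMaxRoot (d : b.support → ℤ) (α : ι) : Prop where
  isPos : b.IsPos α
  le : corootCoeff b α ≤ d
  eq_of_le : ∀ μ, b.IsPos μ → corootCoeff b μ ≤ d → rootCoeff b α ≤ rootCoeff b μ → μ = α

/-- Greedy decompositions of the degree `d` of `G/B`, with degrees encoded by their
coefficients. -/
def IsGreedyDeg : (b.support → ℤ) → List ι → Prop
  | d, [] => d = 0
  | d, α :: l => IsMaxRoot b d α ∧ IsGreedyDeg (d - corootCoeff b α) l

variable {b}

theorem IsMaxRoot.isCosmall {d : b.support → ℤ} {α : ι} (h : IsMaxRoot b d α) :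
    IsCosmall b α := by
  intro γ hγ hne hinv
  by_contra hk1
  have hk : 0 < P.pairingIn ℤ γ α := by
    by_contra hk
    exact hinv (isPos_reflectionPerm_of_nonpos b hγ h.isPos (by lia))
  have h1 : P.pairingIn ℤ α γ = 1 := (pairingIn_eq_one_or hne hk).resolve_left hk1
  -- the positive root `kα - γ`, with coroot `α^∨ - γ^∨`
  set δ := P.reflectionPerm (P.reflectionPerm α γ) (P.reflectionPerm α γ)
  have hδ : b.IsPos δ := (isPos_reflectionPerm_self b).2 hinv
  have hδr : rootCoeff b δ = P.pairingIn ℤ γ α • rootCoeff b α - rootCoeff b γ := by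
    rw [rootCoeff_reflectionPerm_self, rootCoeff_reflectionPerm, neg_sub]
  have hδc : corootCoeff b δ = corootCoeff b α - corootCoeff b γ := by
    rw [corootCoeff_reflectionPerm, P.pairingIn_same, corootCoeff_reflectionPerm, h1, two_smul,
      one_smul]
    abel
  have hγc := corootCoeff_nonneg b hγ
  have hδc' := corootCoeff_nonneg b hδ
  have hγd : corootCoeff b γ ≤ d := by
    rw [hδc, sub_nonneg] at hδc'
    exact hδc'.trans h.le
  have hδd : corootCoeff b δ ≤ d := by
    rw [hδc]
    exact (sub_le_self _ hγc).trans h.le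
  have hdiff : rootCoeff b (P.reflectionPerm γ α) = rootCoeff b α - rootCoeff b γ := by
    rw [rootCoeff_reflectionPerm, h1, one_smul]
  rcases rootCoeff_nonneg_or_nonpos b (P.reflectionPerm γ α) with h2 | h2
  · rw [hdiff] at h2
    have h3 : δ = α := by
      refine h.eq_of_le δ hδ hδd fun τ ↦ ?_
      have h4 := h2 τ
      have h5 := (isPos_iff_rootCoeff_nonneg b).1 h.isPos τ
      rw [hδr]
      simp only [Pi.sub_apply, Pi.smul_apply, smul_eq_mul, Pi.zero_apply] at h4 h5 ⊢
      have : (2 : ℤ) ≤ P.pairingIn ℤ γ α := by lia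
      nlinarith
    rw [h3, eq_comm, sub_eq_self] at hδc
    exact corootCoeff_ne_zero b γ hδc
  · rw [hdiff, sub_nonpos] at h2
    exact hne (h.eq_of_le γ hγ hγd h2)

theorem IsMaxRoot.pairingIn_nonneg {d : b.support → ℤ} {α β : ι} (h : IsMaxRoot b d α)
    (hβ : b.IsPos β) (hle : corootCoeff b β ≤ d - corootCoeff b α) :
    0 ≤ P.pairingIn ℤ β α := by
  by_contra! hneg
  obtain ⟨μ, hμ, hμ'⟩ :=
    exists_corootCoeff_eq_add b h.isPos hβ (pairingIn_neg_comm.1 hneg)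
  have hle' : rootCoeff b α ≤ rootCoeff b μ :=
    (le_add_of_nonneg_right ((isPos_iff_rootCoeff_nonneg b).1 hβ)).trans hμ'
  have := h.eq_of_le μ (isPos_of_rootCoeff_le b h.isPos hle')
    (by rw [hμ, add_comm]; exact le_sub_iff_add_le.1 hle) hle'
  rw [this, left_eq_add] at hμ
  exact corootCoeff_ne_zero b β hμ

theorem corootCoeff_simple_le {σ : b.support} {d : b.support → ℤ} (hd : 0 ≤ d) (h : 0 < d σ) :
    corootCoeff b σ ≤ d := by
  have := le_of_apply_le b (σ := σ) (n := 1) hd (by simpa using Int.add_one_le_iff.2 h)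
  simpa using this

theorem IsMaxRoot.pairingIn_simple_nonneg {d : b.support → ℤ} {α : ι} (h : IsMaxRoot b d α)
    (σ : b.support) (hσ : 0 < (d - corootCoeff b α) σ) : 0 ≤ P.pairingIn ℤ σ α :=
  h.pairingIn_nonneg (isPos_simple b σ) (corootCoeff_simple_le (sub_nonneg.2 h.le) hσ)

/-- Splitting off a maximal root of `d`. -/
theorem IsMaxRoot.maxElt_eq {d : b.support → ℤ} {α : ι} (h : IsMaxRoot b d α) :
    maxElt b d = hecke b (𝐬 α) (maxElt b (d - corootCoeff b α)) := by
  rw [← maxElt_add b h.isPos h.isCosmall (sub_nonneg.2 h.le) h.pairingIn_simple_nonneg,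
    add_sub_cancel]

theorem IsGreedyDeg.foldr_hecke {d : b.support → ℤ} {l : List ι} (h : IsGreedyDeg b d l) :
    (l.map 𝐬).foldr (hecke b) 1 = maxElt b d := by
  induction l generalizing d with
  | nil => rw [show d = 0 from h, maxElt_zero]; rfl
  | cons α l ih => rw [List.map_cons, List.foldr_cons, ih h.2, h.1.maxElt_eq]

theorem foldl_hecke (l : List P.weylGroup) (u : P.weylGroup) :
    l.foldl (hecke b) u = hecke b u (l.foldr (hecke b) 1) := by
  induction l generalizing u with
  | nil => rw [List.foldl_nil, List.foldr_nil, hecke_one]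
  | cons v l ih => rw [List.foldl_cons, List.foldr_cons, ih, hecke_assoc]

theorem IsGreedyDeg.nonneg {d : b.support → ℤ} {l : List ι} (h : IsGreedyDeg b d l) : 0 ≤ d := by
  cases l with
  | nil => exact (show d = 0 from h).ge
  | cons α l => exact (corootCoeff_nonneg b h.1.isPos).trans h.1.le

theorem IsGreedyDeg.isPos {d : b.support → ℤ} {l : List ι} (h : IsGreedyDeg b d l) :
    ∀ α ∈ l, b.IsPos α := by
  induction l generalizing d with
  | nil => simp
  | cons α l ih =>
    intro β hβ
    rcases List.mem_cons.1 hβ with rfl | hβ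
    · exact h.1.isPos
    · exact ih h.2 β hβ

theorem IsGreedyDeg.sum_eq {d : b.support → ℤ} {l : List ι} (h : IsGreedyDeg b d l) :
    (l.map (corootCoeff b)).sum = d := by
  induction l generalizing d with
  | nil => exact (show d = 0 from h).symm
  | cons α l ih => rw [List.map_cons, List.sum_cons, ih h.2, add_sub_cancel]

/-- Any root below a degree lies below a maximal root of the degree. -/
theorem exists_isMaxRoot_ge {d : b.support → ℤ} {β : ι} (hβ : b.IsPos β)
    (hd : corootCoeff b β ≤ d) : ∃ α, IsMaxRoot b d α ∧ rootCoeff b β ≤ rootCoeff b α := by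
  let S : Set ι := {μ | b.IsPos μ ∧ corootCoeff b μ ≤ d ∧ rootCoeff b β ≤ rootCoeff b μ}
  obtain ⟨α, hα, hmax⟩ := Set.exists_max_image S (fun μ ↦ ∑ τ, rootCoeff b μ τ) (Set.toFinite S)
    ⟨β, hβ, hd, le_rfl⟩
  refine ⟨α, ⟨hα.1, hα.2.1, fun μ hμ hμd hle ↦ ?_⟩, hα.2.2⟩
  have h1 := hmax μ ⟨hμ, hμd, hα.2.2.trans hle⟩
  have h2 := (Finset.sum_eq_sum_iff_of_le fun τ _ ↦ hle τ).1
    (le_antisymm (Finset.sum_le_sum fun τ _ ↦ hle τ) h1)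
  exact (ext_rootCoeff b (funext fun τ ↦ h2 τ (Finset.mem_univ τ))).symm

theorem sum_corootCoeff_pos {α : ι} (hα : b.IsPos α) : 0 < ∑ τ, corootCoeff b α τ := by
  obtain ⟨σ, hσ⟩ := exists_corootCoeff_pos b hα
  exact Finset.sum_pos' (fun τ _ ↦ corootCoeff_nonneg b hα τ) ⟨σ, Finset.mem_univ σ, hσ⟩

theorem exists_isGreedyDeg {d : b.support → ℤ} (hd : 0 ≤ d) : ∃ l, IsGreedyDeg b d l := by
  obtain ⟨n, hn⟩ : ∃ n : ℕ, (∑ τ, d τ) = n := Int.eq_ofNat_of_zero_le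
    (Finset.sum_nonneg fun τ _ ↦ hd τ)
  induction n using Nat.strong_induction_on generalizing d with
  | _ n ih =>
    by_cases h0 : d = 0
    · exact ⟨[], h0⟩
    · obtain ⟨σ, hσ, -⟩ := exists_degPair_pos b hd h0
      obtain ⟨α, hα, -⟩ := exists_isMaxRoot_ge (isPos_simple b σ) (corootCoeff_simple_le hd hσ)
      have h1 := sum_corootCoeff_pos hα.isPos
      have h2 : 0 ≤ d - corootCoeff b α := sub_nonneg.2 hα.le
      have h3 : ∑ τ, (d - corootCoeff b α) τ = n - ∑ τ, corootCoeff b α τ := by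
        simp only [Pi.sub_apply, Finset.sum_sub_distrib, hn]
      have h4 : 0 ≤ ∑ τ, (d - corootCoeff b α) τ := Finset.sum_nonneg fun τ _ ↦ h2 τ
      obtain ⟨l, hl⟩ := ih (n - ∑ τ, corootCoeff b α τ).toNat (by lia) h2 (by lia)
      exact ⟨α :: l, hα, hl⟩

end Greedy

/-! ### Degrees of the full flag variety -/

section FullFlag

variable (b : P.Base) [P.IsRootSystem]

/-- The class in `H₂(G/B)` with given coefficients on the simple coroots. -/
def ofDeg [Fintype b.support] (d : b.support → ℤ) : H2 b ∅ :=
  Submodule.Quotient.mk (∑ σ : b.support, d σ •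
    (⟨P.coroot σ, Submodule.subset_span ⟨σ, σ.2, rfl⟩⟩ : corootLattice b))

theorem ofDeg_zero : ofDeg b 0 = 0 := by simp [ofDeg]

theorem ofDeg_sub (d d' : b.support → ℤ) : ofDeg b (d - d') = ofDeg b d - ofDeg b d' := by
  simp [ofDeg, sub_smul, Finset.sum_sub_distrib]

theorem ofDeg_surjective (x : H2 b ∅) : ∃ d, ofDeg b d = x := by
  obtain ⟨⟨y, hy⟩, rfl⟩ := Submodule.Quotient.mk_surjective _ x
  rw [Submodule.mem_span_image_finset_iff_exists_fun] at hy
  obtain ⟨c, hc⟩ := hy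
  exact ⟨c, congrArg _ (Subtype.ext (by simpa using hc))⟩

theorem poincare_ofDeg (d : b.support → ℤ) (σ : b.support) :
    poincare b ∅ ⟨σ, fun h ↦ h⟩ (ofDeg b d) = d σ := by
  classical
  change fundamentalWeight b σ ((corootLattice b).subtype (∑ τ : b.support, d τ •
    (⟨P.coroot τ, Submodule.subset_span ⟨τ, τ.2, rfl⟩⟩ : corootLattice b))) = d σ
  rw [map_sum, map_sum, Finset.sum_eq_single σ]
  · simp [fundamentalWeight_coroot_simple]
  · intro τ _ hne
    simp [fundamentalWeight_coroot_simple, hne]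
  · simp

theorem degLE_ofDeg {d d' : b.support → ℤ} : DegLE b ∅ (ofDeg b d) (ofDeg b d') ↔ d ≤ d' := by
  constructor
  · intro h σ
    have := h ⟨σ, fun h ↦ h⟩
    rw [← ofDeg_sub, poincare_ofDeg] at this
    simpa using this
  · rintro h ⟨σ, hσ⟩
    rw [← ofDeg_sub, poincare_ofDeg]
    exact_mod_cast (sub_nonneg.2 h) σ

theorem ofDeg_injective : Function.Injective (ofDeg b) := fun d d' h ↦
  le_antisymm ((degLE_ofDeg b).1 (by rw [h]; simp [DegLE]))
    ((degLE_ofDeg b).1 (by rw [h]; simp [DegLE]))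

theorem corootClass_eq (i : ι) : corootClass b ∅ i = ofDeg b (corootCoeff b i) := by
  refine congrArg _ (Subtype.ext ?_)
  simpa using coroot_eq_sum b i

theorem isDegree_ofDeg {d : b.support → ℤ} : IsDegree b ∅ (ofDeg b d) ↔ 0 ≤ d := by
  rw [IsDegree, ← ofDeg_zero, degLE_ofDeg]

variable [Fintype ι] [P.IsCrystallographic] [P.IsReduced]

theorem mem_nonLeviPosRoots_empty {i : ι} : i ∈ nonLeviPosRoots b ∅ ↔ b.IsPos i := by
  refine ⟨fun h ↦ h.1, fun h ↦ ⟨h, fun h' ↦ ?_⟩⟩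
  have := h'.2
  simp only [leviRoots, Set.image_empty, Submodule.span_empty, Set.mem_ofPred_eq,
    Submodule.mem_bot] at this
  exact P.ne_zero i this

theorem rootLE_iff {i j : ι} : RootLE b i j ↔ rootCoeff b i ≤ rootCoeff b j := by
  constructor
  · intro h σ
    have key : ∀ x ∈ AddSubmonoid.closure (P.root '' b.support),
        0 ≤ b.toWeightBasis.coord σ x := by
      intro x hx
      induction hx using AddSubmonoid.closure_induction with
      | mem x hx =>
        obtain ⟨k, hk, rfl⟩ := hx
        rw [toWeightBasis_coord_root]
        exact_mod_cast (isPos_iff_rootCoeff_nonneg b).1 (isPos_simple b ⟨k, hk⟩) σ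
      | zero => simp
      | add x y _ _ hx hy => rw [map_add]; exact add_nonneg hx hy
    have := key _ h
    rw [map_sub, toWeightBasis_coord_root, toWeightBasis_coord_root] at this
    exact_mod_cast sub_nonneg.1 this
  · intro h
    rw [RootLE, root_eq_sum b i, root_eq_sum b j, ← Finset.sum_sub_distrib]
    refine AddSubmonoid.sum_mem _ fun σ _ ↦ ?_
    rw [← sub_smul]
    obtain ⟨n, hn⟩ := Int.eq_ofNat_of_zero_le (sub_nonneg.2 (h σ))
    rw [hn, natCast_zsmul]
    exact AddSubmonoid.nsmul_mem _ (AddSubmonoid.subset_closure (Set.mem_image_of_mem _ σ.2)) n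

theorem isMaximalRoot_ofDeg {d : b.support → ℤ} {i : ι} :
    IsMaximalRoot b ∅ (ofDeg b d) i ↔ IsMaxRoot b d i := by
  simp only [IsMaximalRoot, mem_nonLeviPosRoots_empty, corootClass_eq, degLE_ofDeg, rootLE_iff]
  exact ⟨fun ⟨⟨h1, h2⟩, h3⟩ ↦ ⟨h1, h2, h3⟩, fun ⟨h1, h2, h3⟩ ↦ ⟨⟨h1, h2⟩, h3⟩⟩

theorem isGreedy_ofDeg {d : b.support → ℤ} {l : List ι} :
    IsGreedy b ∅ (ofDeg b d) l ↔ IsGreedyDeg b d l := by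
  induction l generalizing d with
  | nil =>
    rw [IsGreedy, IsGreedyDeg, ← ofDeg_zero]
    exact (ofDeg_injective b).eq_iff
  | cons α l ih => rw [IsGreedy, IsGreedyDeg, isMaximalRoot_ofDeg, corootClass_eq, ← ofDeg_sub, ih]

theorem longest_empty : longest b ∅ = 1 := by
  have h := (exists_longest b ∅).choose_spec.1
  rw [longest]
  simpa [leviWeylGroup] using h

theorem z_ofDeg {d : b.support → ℤ} (hd : 0 ≤ d) : z b ∅ (ofDeg b d) = maxElt b d := by
  obtain ⟨l, hl⟩ := exists_isGreedyDeg hd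
  have h : ∃ l, IsGreedy b ∅ (ofDeg b d) l := ⟨l, (isGreedy_ofDeg b).2 hl⟩
  rw [z, greedy, dif_pos h, longest_empty, hecke_one, inv_one, mul_one, foldl_hecke, one_hecke]
  exact ((isGreedy_ofDeg b).1 h.choose_spec).foldr_hecke

/-- A degree `e` of `G/B` is minimal if no smaller degree has a greatest element above that
of `e`. -/
theorem IsMinimalDegree.eq_of_le {e : b.support → ℤ} (he : IsMinimalDegree b ∅ (ofDeg b e))
    {e' : b.support → ℤ} (he' : 0 ≤ e') (hle : e' ≤ e)
    (hz : BruhatLE b (maxElt b e) (maxElt b e')) : e' = e := by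
  have he0 : 0 ≤ e := (isDegree_ofDeg b).1 he.1
  refine ofDeg_injective b (he.2 _ ((isDegree_ofDeg b).2 he') ?_ ((degLE_ofDeg b).2 hle))
  rwa [z_ofDeg b he0, z_ofDeg b he']

theorem mem_cascade_ofDeg {e : b.support → ℤ} {i : ι} :
    i ∈ cascade b (ofDeg b e) ↔ ∃ l, IsGreedyDeg b e l ∧ i ∈ l := by
  simp only [cascade, isGreedy_ofDeg, Set.mem_ofPred_eq]
  exact ⟨fun h ↦ h.2, fun ⟨l, hl, hi⟩ ↦ ⟨hl.isPos i hi, l, hl, hi⟩⟩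

end FullFlag

/-! ### Uniqueness of greedy decompositions -/

section Uniqueness

variable {b : P.Base} [Fintype ι] [P.IsRootSystem] [P.IsCrystallographic] [P.IsReduced]

theorem rootForm_degVec_degVec (d d' : b.support → ℤ) :
    P.RootForm (degVec b d) (degVec b d') =
      ∑ τ : b.support, (d' τ : ℝ) * (2 / normSq P τ) * degPair b τ d := by
  rw [rootForm_degVec]
  refine Finset.sum_congr rfl fun τ _ ↦ ?_
  rw [rootForm_comm, rootForm_root_degVec]

theorem rootForm_degVec_nonneg {d d' : b.support → ℤ} (hd' : 0 ≤ d')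
    (h : ∀ τ : b.support, 0 < d' τ → 0 ≤ degPair b τ d) :
    0 ≤ P.RootForm (degVec b d) (degVec b d') := by
  rw [rootForm_degVec_degVec]
  refine Finset.sum_nonneg fun τ _ ↦ ?_
  rcases (hd' τ).eq_or_lt with h0 | h0
  · rw [← h0]; simp
  · have := normSq_pos (P := P) τ
    have h1 : (0 : ℝ) ≤ degPair b τ d := by exact_mod_cast h τ h0
    have h2 : (0 : ℝ) ≤ d' τ := by exact_mod_cast h0.le
    positivity

theorem rootForm_degVec_nonpos {d d' : b.support → ℤ} (hd : 0 ≤ d) (hd' : 0 ≤ d')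
    (h : ∀ τ : b.support, 0 < d' τ → d τ = 0) :
    P.RootForm (degVec b d) (degVec b d') ≤ 0 := by
  rw [rootForm_degVec_degVec]
  refine Finset.sum_nonpos fun τ _ ↦ ?_
  rcases (hd' τ).eq_or_lt with h0 | h0
  · rw [← h0]; simp
  · have := normSq_pos (P := P) τ
    have h1 : (degPair b τ d : ℝ) ≤ 0 := by exact_mod_cast degPair_simple_nonpos b hd (h τ h0)
    have h2 : (0 : ℝ) ≤ d' τ := by exact_mod_cast h0.le
    exact mul_nonpos_of_nonneg_of_nonpos (by positivity) h1

/-- Two positive roots with positive pairing are comparable. -/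
theorem rootCoeff_le_or_le {α β : ι} (h : 0 < P.pairingIn ℤ α β) :
    rootCoeff b α ≤ rootCoeff b β ∨ rootCoeff b β ≤ rootCoeff b α := by
  have key {α β : ι} (h : P.pairingIn ℤ α β = 1) :
      rootCoeff b α ≤ rootCoeff b β ∨ rootCoeff b β ≤ rootCoeff b α := by
    have h1 := rootCoeff_nonneg_or_nonpos b (P.reflectionPerm β α)
    rw [rootCoeff_reflectionPerm, h, one_smul, sub_nonneg, sub_nonpos] at h1
    exact h1.symm
  by_cases hne : α = β
  · rw [hne]; exact Or.inl le_rfl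
  · rcases pairingIn_eq_one_or hne h with h1 | h1
    · exact key h1
    · exact (key h1).symm

/-- Distinct maximal roots of `d` have coroots with disjoint supports: for the coefficientwise
minimum `m` of `α^∨` and `β^∨` one has `(α^∨, β^∨) ≥ (m, m)`, while incomparable roots have
nonpositive products. -/
theorem IsMaxRoot.add_le {d : b.support → ℤ} {α β : ι} (hα : IsMaxRoot b d α)
    (hβ : IsMaxRoot b d β) (hne : α ≠ β) : corootCoeff b α + corootCoeff b β ≤ d := by
  set m := corootCoeff b α ⊓ corootCoeff b β with hm
  set x := corootCoeff b α - m
  set y := corootCoeff b β - m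
  have hx : corootCoeff b α = m + x := (add_sub_cancel _ _).symm
  have hy : corootCoeff b β = m + y := (add_sub_cancel _ _).symm
  have hx0 : 0 ≤ x := sub_nonneg.2 inf_le_left
  have hy0 : 0 ≤ y := sub_nonneg.2 inf_le_right
  have hdisj (τ) : x τ = 0 ∨ y τ = 0 := by
    rcases le_total (corootCoeff b α τ) (corootCoeff b β τ) with h | h
    · left; simp [x, hm, h]
    · right; simp [y, hm, h]
  have hxd : x ≤ d - corootCoeff b β := by
    intro τ
    have h1 := hα.le τ
    have h2 := hβ.le τ
    have h3 := congrFun hx τ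
    have h4 := congrFun hy τ
    rcases hdisj τ with h | h <;>
      simp only [Pi.add_apply, Pi.sub_apply] at h1 h2 h3 h4 ⊢ <;> lia
  have hyd : y ≤ d - corootCoeff b α := by
    intro τ
    have h1 := hxd τ
    have h3 := congrFun hx τ
    have h4 := congrFun hy τ
    simp only [Pi.add_apply, Pi.sub_apply] at h1 h3 h4 ⊢
    lia
  have hpair : P.pairingIn ℤ α β ≤ 0 := by
    by_contra! hpos
    rcases rootCoeff_le_or_le (b := b) hpos with h | h
    · exact hne (hα.eq_of_le β hβ.isPos hβ.le h).symm
    · exact hne (hβ.eq_of_le α hα.isPos hα.le h)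
  have h1 : 0 ≤ P.RootForm (degVec b (corootCoeff b β)) (degVec b x) :=
    rootForm_degVec_nonneg hx0 fun τ hτ ↦ by
      rw [degPair_corootCoeff]
      exact hβ.pairingIn_simple_nonneg τ (hτ.trans_le (hxd τ))
  have h2 : 0 ≤ P.RootForm (degVec b (corootCoeff b α)) (degVec b y) :=
    rootForm_degVec_nonneg hy0 fun τ hτ ↦ by
      rw [degPair_corootCoeff]
      exact hα.pairingIn_simple_nonneg τ (hτ.trans_le (hyd τ))
  have h3 : P.RootForm (degVec b x) (degVec b y) ≤ 0 :=
    rootForm_degVec_nonpos hx0 hy0 fun τ hτ ↦ (hdisj τ).resolve_right hτ.ne'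
  have h4 : P.RootForm (degVec b (corootCoeff b α)) (degVec b (corootCoeff b β)) ≤ 0 := by
    rw [degVec_corootCoeff b α, map_smul, LinearMap.smul_apply, rootForm_root_degVec,
      degPair_corootCoeff, smul_eq_mul]
    have := normSq_pos (P := P) α
    exact mul_nonpos_of_nonneg_of_nonpos (by positivity) (by exact_mod_cast hpair)
  have h5 : P.RootForm (degVec b m) (degVec b m) ≤ 0 := by
    have c1 := rootForm_comm (P := P) (degVec b x) (degVec b m)
    have c2 := rootForm_comm (P := P) (degVec b y) (degVec b m)
    have c3 := rootForm_comm (P := P) (degVec b y) (degVec b x)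
    rw [hx, hy] at h4
    rw [hy] at h1
    rw [hx] at h2
    simp only [degVec_add, map_add, LinearMap.add_apply] at h1 h2 h4
    linarith
  have hm0 : m = 0 := by
    by_contra h0
    have := P.rootForm_pos_of_ne_zero (by simp) (degVec_ne_zero b h0)
    exact absurd h5 (not_le.2 this)
  rw [hm0, zero_add] at hx
  rw [hx]
  exact le_sub_iff_add_le.1 hxd

theorem IsMaxRoot.sub {d : b.support → ℤ} {α β : ι} (hα : IsMaxRoot b d α)
    (hβ : IsMaxRoot b d β) (hne : α ≠ β) : IsMaxRoot b (d - corootCoeff b α) β :=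
  ⟨hβ.isPos, le_sub_iff_add_le'.2 (hα.add_le hβ hne), fun μ hμ hle ↦
    hβ.eq_of_le μ hμ (hle.trans (sub_le_self _ (corootCoeff_nonneg b hα.isPos)))⟩

/-- Greedy decompositions are unique up to reordering. -/
theorem IsGreedyDeg.perm {d : b.support → ℤ} {l k : List ι} (hl : IsGreedyDeg b d l)
    (hk : IsGreedyDeg b d k) : l.Perm k := by
  induction hn : l.length using Nat.strong_induction_on generalizing d l k with
  | _ n ih =>
    have hzero {α : ι} {k : List ι} (h : IsGreedyDeg b 0 (α :: k)) : False := by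
      have h1 := le_antisymm h.1.le (corootCoeff_nonneg b h.1.isPos)
      exact corootCoeff_ne_zero b α h1
    match l, k with
    | [], [] => exact List.Perm.refl _
    | [], α :: k => exact (hzero (by rwa [show d = 0 from hl] at hk)).elim
    | α :: l, [] => exact (hzero (by rwa [show d = 0 from hk] at hl)).elim
    | α :: l, β :: k =>
      rw [List.length_cons] at hn
      by_cases hne : α = β
      · subst hne
        exact (ih l.length (by lia) hl.2 hk.2 rfl).cons α
      · have h1 := hl.1.sub hk.1 hne
        have h2 := hk.1.sub hl.1 (Ne.symm hne)
        obtain ⟨l', hl'⟩ := exists_isGreedyDeg (sub_nonneg.2 h1.le)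
        have h3 : l.Perm (β :: l') := ih l.length (by lia) hl.2 ⟨h1, hl'⟩ rfl
        have h4 : (α :: l').Perm k := by
          refine ih (α :: l').length ?_ ⟨h2, ?_⟩ hk.2 rfl
          · have := h3.length_eq
            rw [List.length_cons] at this ⊢
            lia
          · rwa [sub_right_comm]
        exact (h3.cons α).trans ((List.Perm.swap β α l').trans (h4.cons β))

end Uniqueness

/-! ### Minimal degrees of the full flag variety -/

section Minimal

variable {b : P.Base} [Fintype ι] [P.IsRootSystem] [P.IsCrystallographic] [P.IsReduced]

variable (b) in
/-- `e` is a minimal degree of `G/B`, with degrees encoded by their coefficients. -/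
def IsMinDeg (e : b.support → ℤ) : Prop :=
  ∀ e', 0 ≤ e' → e' ≤ e → BruhatLE b (maxElt b e) (maxElt b e') → e' = e

/-- The remainder of a minimal degree after removing a maximal root `α` is minimal, and it is
supported on simple roots orthogonal to `α`: the other part of it would not contribute to the
Hecke product. -/
theorem IsMinDeg.sub {e : b.support → ℤ} (he : IsMinDeg b e) {α : ι} (hα : IsMaxRoot b e α) :
    IsMinDeg b (e - corootCoeff b α) ∧
      ∀ σ : b.support, 0 < (e - corootCoeff b α) σ → P.pairingIn ℤ σ α = 0 := by
  set f := e - corootCoeff b α with hf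
  have hef : e = corootCoeff b α + f := (add_sub_cancel _ _).symm
  have hf0 : 0 ≤ f := sub_nonneg.2 hα.le
  have hpair := hα.pairingIn_simple_nonneg
  -- a degree below `f` with a Hecke product with `s_α` at least as large equals `f`
  have key {f' : b.support → ℤ} (h0 : 0 ≤ f') (hle : f' ≤ f)
      (h : BruhatLE b (hecke b (𝐬 α) (maxElt b f)) (hecke b (𝐬 α) (maxElt b f'))) : f' = f := by
    have h1 : corootCoeff b α + f' = e := by
      refine he _ (add_nonneg (corootCoeff_nonneg b hα.isPos) h0) ?_ ?_
      · rw [hef]; exact add_le_add_right hle _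
      · rwa [hα.maxElt_eq, maxElt_add b hα.isPos hα.isCosmall h0 fun σ hσ ↦
          hpair σ (hσ.trans_le (hle σ))]
    rw [hef] at h1
    exact add_left_cancel h1
  constructor
  · intro f' h0 hle hz
    exact key h0 hle (hecke_mono b (bruhatLE_refl b _) hz)
  · intro σ hσ
    have h1 := key (orthPart_nonneg b hf0) (orthPart_le b (α := α) hf0) (by
      rw [refl_hecke_maxElt_orthPart b hα.isPos hf0 hpair]; exact bruhatLE_refl b _)
    rw [← h1] at hσ
    exact pairingIn_eq_zero_of_orthPart_pos b hσ

theorem pairingIn_eq_zero_of_support {α β : ι} (hβ : b.IsPos β) {f : b.support → ℤ}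
    (hle : corootCoeff b β ≤ f) (h : ∀ σ : b.support, 0 < f σ → P.pairingIn ℤ σ α = 0) :
    P.pairingIn ℤ α β = 0 := by
  rw [← degPair_corootCoeff b α β]
  refine Finset.sum_eq_zero fun τ _ ↦ ?_
  rcases (corootCoeff_nonneg b hβ τ).eq_or_lt with h0 | h0
  · rw [← h0, Pi.zero_apply, zero_mul]
  · rw [pairingIn_zero_comm.1 (h τ (h0.trans_le (hle τ))), mul_zero]

theorem IsGreedyDeg.corootCoeff_le {d : b.support → ℤ} {l : List ι} (h : IsGreedyDeg b d l)
    {β : ι} (hβ : β ∈ l) : corootCoeff b β ≤ d := by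
  rw [← h.sum_eq]
  refine List.single_le_sum (fun x hx ↦ ?_) _ (List.mem_map_of_mem hβ)
  obtain ⟨γ, hγ, rfl⟩ := List.mem_map.1 hx
  exact corootCoeff_nonneg b (h.isPos γ hγ)

/-- The greedy decomposition of a minimal degree consists of pairwise orthogonal roots. -/
theorem IsMinDeg.pairwise {e : b.support → ℤ} (he : IsMinDeg b e) {l : List ι}
    (hl : IsGreedyDeg b e l) : l.Pairwise fun α β ↦ P.pairingIn ℤ α β = 0 := by
  induction l generalizing e with
  | nil => exact List.Pairwise.nil
  | cons α l ih =>
    have h := he.sub hl.1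
    refine List.Pairwise.cons (fun β hβ ↦ ?_) (ih h.1 hl.2)
    exact pairingIn_eq_zero_of_support (hl.2.isPos β hβ) (hl.2.corootCoeff_le hβ) h.2

theorem weylGroupToPerm_one (i : ι) : P.weylGroupToPerm 1 i = i := by rw [map_one]; rfl

/-- If the degree `f` is supported on simple roots orthogonal to `α`, then the Hecke product of
`s_α` with the greatest element for `f` is the ordinary product. -/
theorem refl_hecke_maxElt_eq_mul {α : ι} (hα : b.IsPos α) {f : b.support → ℤ} (hf : 0 ≤ f)
    (h : ∀ σ : b.support, 0 < f σ → P.pairingIn ℤ σ α = 0) :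
    hecke b (𝐬 α) (maxElt b f) = 𝐬 α * maxElt b f ∧
      P.weylGroupToPerm (maxElt b f)⁻¹ α = α := by
  refine degree_induction b (p := fun f ↦
    (∀ σ : b.support, 0 < f σ → P.pairingIn ℤ σ α = 0) →
    hecke b (𝐬 α) (maxElt b f) = 𝐬 α * maxElt b f ∧
      P.weylGroupToPerm (maxElt b f)⁻¹ α = α) ?_ ?_ hf h
  · intro _
    rw [maxElt_zero, hecke_one, mul_one, inv_one, weylGroupToPerm_one]
    exact ⟨rfl, rfl⟩
  · intro f σ hf hfσ hσ ih h
    have h0 := h σ (apply_pos_of_sub_nonneg b hfσ)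
    obtain ⟨ih1, ih2⟩ := ih fun τ hτ ↦ h τ (apply_pos_of_sub_pos b hτ)
    set m := maxElt b (f - corootCoeff b σ)
    have hσα : P.reflectionPerm α σ = σ := reflectionPerm_eq_self_of_pairingIn h0
    have hασ : P.reflectionPerm σ α = α :=
      reflectionPerm_eq_self_of_pairingIn (pairingIn_zero_comm.1 h0)
    have hcomm : 𝐬 α * 𝐬 σ = 𝐬 σ * 𝐬 α := by
      rw [mul_ofIdx b (𝐬 α) σ, weylGroupToPerm_ofIdx, hσα]
    -- multiplication by `s_σ` on the right
    have hfix (y : P.weylGroup) (hy : P.weylGroupToPerm y⁻¹ α = α) :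
        heckeStep b (𝐬 α * y) σ = 𝐬 α * heckeStep b y σ ∧
          P.weylGroupToPerm (heckeStep b y σ)⁻¹ α = α := by
      have h1 : P.weylGroupToPerm (𝐬 α * y) σ = P.weylGroupToPerm y σ := by
        rw [weylGroupToPerm_mul, weylGroupToPerm_ofIdx]
        have h2 : 𝐬 α * y = y * 𝐬 α := by
          rw [mul_ofIdx b, ← hy, ← weylGroupToPerm_mul, mul_inv_cancel, weylGroupToPerm_one, hy]
        have h3 := congrArg (fun w ↦ P.weylGroupToPerm w σ) h2
        simp only [weylGroupToPerm_mul, weylGroupToPerm_ofIdx, hσα] at h3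
        exact h3
      by_cases hp : b.IsPos (P.weylGroupToPerm y σ)
      · rw [heckeStep_of_isPos b hp, heckeStep_of_isPos b (by rwa [h1]), mul_assoc, mul_inv_rev,
          weylGroupToPerm_mul, hy, ofIdx_inv, weylGroupToPerm_ofIdx, hασ]
        exact ⟨rfl, rfl⟩
      · rw [heckeStep_of_not_isPos b hp, heckeStep_of_not_isPos b (by rwa [h1])]
        exact ⟨rfl, hy⟩
    -- multiplication by `s_σ` on the left
    have hfix' (y : P.weylGroup) (hy : P.weylGroupToPerm y⁻¹ α = α) :
        hecke b (𝐬 σ) (𝐬 α * y) = 𝐬 α * hecke b (𝐬 σ) y ∧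
          P.weylGroupToPerm (hecke b (𝐬 σ) y)⁻¹ α = α := by
      constructor
      · rw [← inv_inj, hecke_inv, mul_inv_rev, mul_inv_rev, hecke_inv, ofIdx_inv, ofIdx_inv,
          hecke_simple, hecke_simple]
        have h1 : P.weylGroupToPerm (y⁻¹ * 𝐬 α) σ = P.weylGroupToPerm y⁻¹ σ := by
          rw [weylGroupToPerm_mul, weylGroupToPerm_ofIdx, hσα]
        by_cases hp : b.IsPos (P.weylGroupToPerm y⁻¹ σ)
        · rw [heckeStep_of_isPos b hp, heckeStep_of_isPos b (by rwa [h1]), mul_assoc, hcomm,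
            mul_assoc]
        · rw [heckeStep_of_not_isPos b hp, heckeStep_of_not_isPos b (by rwa [h1])]
      · rcases simple_hecke_eq_or b σ y with h1 | h1
        · rw [h1, hy]
        · rw [h1, mul_inv_rev, weylGroupToPerm_mul, ofIdx_inv, weylGroupToPerm_ofIdx, hασ, hy]
    obtain ⟨h1, h2⟩ := hfix m ih2
    obtain ⟨h3, h4⟩ := hfix' _ h2
    rw [maxElt_step b hfσ hσ, hecke_simple]
    refine ⟨?_, h4⟩
    rw [← hecke_assoc, refl_hecke_comm_simple b hα h0.ge, hecke_assoc, ← hecke_simple,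
      ← hecke_assoc b (𝐬 α), ih1, hecke_simple, h1, h3, hecke_simple]

theorem IsMinDeg.maxElt_eq_prod {e : b.support → ℤ} (he : IsMinDeg b e) {l : List ι}
    (hl : IsGreedyDeg b e l) : maxElt b e = (l.map 𝐬).prod := by
  induction l generalizing e with
  | nil => rw [show e = 0 from hl, maxElt_zero]; rfl
  | cons α l ih =>
    have h := he.sub hl.1
    rw [hl.1.maxElt_eq, List.map_cons, List.prod_cons, ← ih h.1 hl.2]
    exact (refl_hecke_maxElt_eq_mul hl.1.isPos hl.2.nonneg h.2).1

theorem prod_map_ofIdx_smul {l : List ι} (hl : l.Pairwise fun α β ↦ P.pairingIn ℤ α β = 0)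
    (x : M) :
    (l.map 𝐬).prod • x = x - (l.map fun α ↦ P.coroot' α x • P.root α).sum := by
  induction l with
  | nil => simp
  | cons α l ih =>
    rw [List.pairwise_cons] at hl
    rw [List.map_cons, List.prod_cons, mul_smul, ih hl.2, ofIdx_smul, List.map_cons,
      List.sum_cons, map_sub]
    have h0 : P.coroot' α (l.map fun α ↦ P.coroot' α x • P.root α).sum = 0 := by
      rw [map_list_sum, List.map_map]
      refine List.sum_eq_zero fun y hy ↦ ?_
      obtain ⟨β, hβ, rfl⟩ := List.mem_map.1 hy
      rw [Function.comp_apply, map_smul, P.root_coroot'_eq_pairing, ← cast_pairingIn,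
        pairingIn_zero_comm.1 (hl.1 β hβ)]
      simp
    rw [h0, sub_zero]
    abel

end Minimal

/-! ### The Levi factor -/

section Levi

variable {b : P.Base} [Fintype ι] [P.IsRootSystem] [P.IsCrystallographic] [P.IsReduced]

theorem mem_leviRoots_iff {J : Set b.support} {i : ι} :
    i ∈ leviRoots b J ↔ ∀ σ ∉ J, rootCoeff b i σ = 0 := by
  constructor
  · intro h σ hσ
    have key : ∀ x ∈ Submodule.span ℤ ((fun j : b.support ↦ P.root j) '' J),
        b.toWeightBasis.coord σ x = 0 := by
      intro x hx
      induction hx using Submodule.span_induction with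
      | mem x hx =>
        obtain ⟨j, hj, rfl⟩ := hx
        rw [toWeightBasis_coord_root, rootCoeff_simple_ne b (τ := j) (σ := σ) (fun h ↦ hσ (h ▸ hj)),
          Int.cast_zero]
      | zero => rw [map_zero]
      | add x y _ _ hx hy => rw [map_add, hx, hy, add_zero]
      | smul n x _ hx => rw [map_zsmul, hx, smul_zero]
    have := key _ h
    rw [toWeightBasis_coord_root] at this
    exact_mod_cast this
  · intro h
    change P.root i ∈ Submodule.span ℤ ((fun j : b.support ↦ P.root j) '' J)
    rw [root_eq_sum b i]
    refine Submodule.sum_mem _ fun σ _ ↦ ?_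
    by_cases hσ : σ ∈ J
    · exact Submodule.smul_mem _ _ (Submodule.subset_span ⟨σ, hσ, rfl⟩)
    · rw [h σ hσ, zero_smul]; exact Submodule.zero_mem _

theorem longest_mul_simple {J : Set b.support} {σ : b.support} (hσ : σ ∈ J) :
    ¬ b.IsPos (P.weylGroupToPerm (longest b J) σ) := by
  intro hp
  have h := (exists_longest b J).choose_spec
  have h1 := h.2 (longest b J * 𝐬 σ)
    (mul_mem h.1 (Subgroup.subset_closure ⟨σ, hσ, rfl⟩))
  exact absurd (length_lt_mul b (isPos_simple b σ) hp) (not_lt.2 h1)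

/-- A Hecke product with the longest element of `W_P` as its last factor makes the positive
roots of the Levi factor negative. -/
theorem not_isPos_hecke_longest {J : Set b.support} (u : P.weylGroup) {γ : ι}
    (hγ : γ ∈ leviPosRoots b J) :
    ¬ b.IsPos (P.weylGroupToPerm (hecke b u (longest b J)) γ) := by
  set w := hecke b u (longest b J)
  have hneg (σ : b.support) (hσ : σ ∈ J) : ¬ b.IsPos (P.weylGroupToPerm w σ) := by
    intro hp
    have h1 : heckeStep b w σ = w := by
      rw [← hecke_simple, hecke_assoc, hecke_simple,
        heckeStep_of_not_isPos b (longest_mul_simple hσ)]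
    rw [heckeStep_of_isPos b hp] at h1
    have := length_lt_mul b (isPos_simple b σ) hp
    rw [h1] at this
    exact lt_irrefl _ this
  have hsum : P.root (P.weylGroupToPerm w γ) =
      ∑ σ : b.support, rootCoeff b γ σ • P.root (P.weylGroupToPerm w σ) := by
    rw [← P.weylGroup_apply_root, root_eq_sum b γ, Finset.smul_sum]
    refine Finset.sum_congr rfl fun σ _ ↦ ?_
    rw [← P.weylGroup_apply_root, smul_comm]
  rw [not_isPos_iff_rootCoeff_nonpos]
  intro τ
  have h1 := rootCoeff_congr b hsum τ
  rw [map_sum] at h1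
  have h2 : (rootCoeff b (P.weylGroupToPerm w γ) τ : ℝ) ≤ 0 := by
    rw [h1]
    refine Finset.sum_nonpos fun σ _ ↦ ?_
    rw [map_zsmul, toWeightBasis_coord_root, zsmul_eq_mul]
    by_cases hσ : σ ∈ J
    · refine mul_nonpos_of_nonneg_of_nonpos ?_ ?_
      · exact_mod_cast (isPos_iff_rootCoeff_nonneg b).1 hγ.1 σ
      · exact_mod_cast (not_isPos_iff_rootCoeff_nonpos b).1 (hneg σ hσ) τ
    · rw [mem_leviRoots_iff.1 hγ.2 σ hσ, Int.cast_zero, zero_mul]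
  exact_mod_cast h2

end Levi

/-! ### Bessel's inequality for orthogonal roots -/

section Bessel

variable {b : P.Base} [Fintype ι] [P.IsRootSystem] [P.IsCrystallographic] [P.IsReduced]

theorem pairingIn_mul_normSq (i j : ι) :
    (P.pairingIn ℤ i j : ℝ) * normSq P j = P.pairingIn ℤ j i * normSq P i := by
  rw [cast_pairingIn, cast_pairingIn, ← two_mul_rootForm, ← two_mul_rootForm, rootForm_comm]

theorem rootForm_pos_iff {i j : ι} :
    0 < P.RootForm (P.root i) (P.root j) ↔ 0 < P.pairingIn ℤ i j := by
  have h := two_mul_rootForm (P := P) i j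
  have hj := normSq_pos (P := P) j
  rw [← cast_pairingIn] at h
  rw [← @Int.cast_pos ℝ]
  constructor <;> intro h0
  · exact pos_of_mul_pos_left (h ▸ by linarith) hj.le
  · have := mul_pos h0 hj
    linarith

theorem rootForm_neg_of_pairingIn_neg {i j : ι} (h : P.pairingIn ℤ i j < 0) :
    P.RootForm (P.root i) (P.root j) < 0 := by
  have h1 := two_mul_rootForm (P := P) i j
  rw [← cast_pairingIn] at h1
  have h2 : (P.pairingIn ℤ i j : ℝ) < 0 := by exact_mod_cast h
  have := mul_neg_of_neg_of_pos h2 (normSq_pos (P := P) j)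
  linarith

/-- Bessel's inequality for a root `γ` and a set `T` of pairwise orthogonal roots: the squared
cosines add up to at most `1`, and in case of equality `γ` and `γ^∨` are the sums of their
projections. -/
theorem sum_pairingIn_mul_lt_or {T : Finset ι}
    (hT : ∀ α ∈ T, ∀ β ∈ T, α ≠ β → P.pairingIn ℤ α β = 0) (γ : ι) :
    ∑ α ∈ T, P.pairingIn ℤ γ α * P.pairingIn ℤ α γ < 4 ∨
      (∑ α ∈ T, P.pairingIn ℤ γ α * P.pairingIn ℤ α γ = 4 ∧
        (∀ σ, 2 * rootCoeff b γ σ = ∑ α ∈ T, P.pairingIn ℤ γ α * rootCoeff b α σ) ∧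
        ∀ σ, 2 * corootCoeff b γ σ = ∑ α ∈ T, P.pairingIn ℤ α γ * corootCoeff b α σ) := by
  set u : M := ∑ α ∈ T, ((P.pairingIn ℤ γ α : ℝ) / 2) • P.root α with hu
  set v := P.root γ - u with hv
  have hγ := normSq_pos (P := P) γ
  have horth : P.RootForm v u = 0 := by
    rw [hu, map_sum]
    refine Finset.sum_eq_zero fun α hα ↦ ?_
    rw [map_smul, hv, map_sub, LinearMap.sub_apply, hu, map_sum, LinearMap.sum_apply,
      Finset.sum_eq_single α]
    · have h1 := two_mul_rootForm (P := P) γ α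
      rw [← cast_pairingIn] at h1
      rw [map_smul, LinearMap.smul_apply, smul_eq_mul, smul_eq_mul]
      have h2 : P.RootForm (P.root α) (P.root α) = normSq P α := rfl
      rw [h2]
      have h3 : P.RootForm (P.root γ) (P.root α) -
          (P.pairingIn ℤ γ α : ℝ) / 2 * normSq P α = 0 := by linarith
      rw [h3, mul_zero]
    · intro β hβ hne
      have h1 := two_mul_rootForm (P := P) β α
      rw [← cast_pairingIn, hT β hβ α hα hne, Int.cast_zero, zero_mul] at h1
      rw [map_smul, LinearMap.smul_apply, smul_eq_mul,
        (mul_eq_zero.1 h1).resolve_left two_ne_zero, mul_zero]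
    · exact fun h ↦ (h hα).elim
  have hself : 4 * P.RootForm v v =
      normSq P γ * (4 - ((∑ α ∈ T, P.pairingIn ℤ γ α * P.pairingIn ℤ α γ : ℤ) : ℝ)) := by
    have h1 : P.RootForm v v = P.RootForm v (P.root γ) := by
      conv_lhs => rw [hv, map_sub, ← hv, horth, sub_zero]
    rw [h1, hv, map_sub, LinearMap.sub_apply, hu, map_sum, LinearMap.sum_apply, mul_sub, mul_sub]
    congr 1
    · rw [mul_comm]
    · push_cast
      rw [Finset.mul_sum, Finset.mul_sum]
      refine Finset.sum_congr rfl fun α _ ↦ ?_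
      have h2 := two_mul_rootForm (P := P) α γ
      rw [← cast_pairingIn] at h2
      rw [map_smul, LinearMap.smul_apply, smul_eq_mul]
      linear_combination (P.pairingIn ℤ γ α : ℝ) * h2
  by_cases hv0 : v = 0
  · right
    refine ⟨?_, ?_⟩
    · rw [hv0, map_zero, mul_zero] at hself
      have := (mul_eq_zero.1 hself.symm).resolve_left hγ.ne'
      have h4 : ((∑ α ∈ T, P.pairingIn ℤ γ α * P.pairingIn ℤ α γ : ℤ) : ℝ) = 4 := by linarith
      exact_mod_cast h4
    · have hrc (σ) : 2 * (rootCoeff b γ σ : ℝ) =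
          ∑ α ∈ T, (P.pairingIn ℤ γ α : ℝ) * rootCoeff b α σ := by
        have h1 := rootCoeff_congr b (sub_eq_zero.1 hv0) σ
        rw [h1, hu, map_sum, Finset.mul_sum]
        refine Finset.sum_congr rfl fun α _ ↦ ?_
        rw [map_smul, toWeightBasis_coord_root, smul_eq_mul]
        ring
      refine ⟨fun σ ↦ by exact_mod_cast hrc σ, fun σ ↦ ?_⟩
      have h1 : 2 * (corootCoeff b γ σ : ℝ) =
          ∑ α ∈ T, (P.pairingIn ℤ α γ : ℝ) * corootCoeff b α σ := by
        refine mul_left_cancel₀ hγ.ne' ?_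
        have h2 := normSq_mul_corootCoeff b γ σ
        rw [mul_left_comm, h2, mul_left_comm, hrc, Finset.mul_sum, Finset.mul_sum]
        refine Finset.sum_congr rfl fun α _ ↦ ?_
        have h3 := normSq_mul_corootCoeff b α σ
        have h4 := pairingIn_mul_normSq (P := P) γ α
        linear_combination -(P.pairingIn ℤ γ α : ℝ) * h3 + (corootCoeff b α σ : ℝ) * h4
      exact_mod_cast h1
  · left
    have h1 := P.rootForm_pos_of_ne_zero (x := v) (by simp) hv0
    have h2 : 0 < normSq P γ *
        (4 - ((∑ α ∈ T, P.pairingIn ℤ γ α * P.pairingIn ℤ α γ : ℤ) : ℝ)) := by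
      rw [← hself]; linarith
    have h3 := pos_of_mul_pos_right h2 hγ.le
    have h4 : ((∑ α ∈ T, P.pairingIn ℤ γ α * P.pairingIn ℤ α γ : ℤ) : ℝ) < 4 := by linarith
    exact_mod_cast h4

end Bessel

/-! ### Orthogonal greedy decompositions -/

section Cascade

variable {b : P.Base} [Fintype ι] [P.IsRootSystem] [P.IsCrystallographic] [P.IsReduced]
  {e : b.support → ℤ} {l : List ι}

theorem nodup_of_pairwise (ho : l.Pairwise fun α β ↦ P.pairingIn ℤ α β = 0) : l.Nodup := by
  refine ho.imp fun {α β} h hne ↦ ?_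
  rw [hne, P.pairingIn_same] at h
  exact two_ne_zero h

theorem pairingIn_eq_zero_of_pairwise (ho : l.Pairwise fun α β ↦ P.pairingIn ℤ α β = 0)
    {α β : ι} (hα : α ∈ l) (hβ : β ∈ l) (hne : α ≠ β) : P.pairingIn ℤ α β = 0 :=
  have : Std.Symm fun α β ↦ P.pairingIn ℤ α β = 0 := ⟨fun _ _ h ↦ pairingIn_zero_comm.1 h⟩
  ho.forall hα hβ hne

open scoped Classical in
/-- A root above all members of a nonempty subset `S` of a greedy decomposition, whose coroot is
at most the sum of the coroots from `S`, belongs to `S`: it could have been chosen at the step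
at which the first member of `S` was chosen. -/
theorem IsGreedyDeg.mem_of_corootCoeff_le_sum (hl : IsGreedyDeg b e l) (hnd : l.Nodup)
    {S : Finset ι} (hS : S.Nonempty) (hSl : ∀ α ∈ S, α ∈ l) {β : ι}
    (hβ : corootCoeff b β ≤ ∑ α ∈ S, corootCoeff b α)
    (hge : ∀ α ∈ S, rootCoeff b α ≤ rootCoeff b β) : β ∈ S := by
  induction l generalizing e with
  | nil =>
    obtain ⟨α, hα⟩ := hS
    exact absurd (hSl α hα) List.not_mem_nil
  | cons α l ih =>
    by_cases hα : α ∈ S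
    · have hle : ∑ α ∈ S, corootCoeff b α ≤ e := by
        rw [← hl.sum_eq, ← List.sum_toFinset _ hnd]
        refine Finset.sum_le_sum_of_subset_of_nonneg
          (fun γ hγ ↦ List.mem_toFinset.2 (hSl γ hγ)) fun γ hγ _ ↦ ?_
        exact corootCoeff_nonneg b (hl.isPos γ (List.mem_toFinset.1 hγ))
      have := hl.1.eq_of_le β (isPos_of_rootCoeff_le b hl.1.isPos (hge α hα)) (hβ.trans hle)
        (hge α hα)
      rwa [this]
    · refine ih hl.2 (List.nodup_cons.1 hnd).2 fun γ hγ ↦ ?_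
      rcases List.mem_cons.1 (hSl γ hγ) with rfl | h
      · exact absurd hγ hα
      · exact h

theorem rootCoeff_ne_zero_of_isPos {α : ι} (hα : b.IsPos α) : rootCoeff b α ≠ 0 := by
  intro h
  obtain ⟨σ, hσ⟩ := exists_rootCoeff_pos b hα
  rw [h] at hσ
  exact lt_irrefl _ hσ

theorem pairingIn_eq_neg_one_of_le {α γ : ι} (hα : b.IsPos α) (hγ : b.IsPos γ)
    (h : P.pairingIn ℤ γ α ≤ -2) : P.pairingIn ℤ α γ = -1 :=
  (pairingIn_eq_neg_one_or (root_ne_neg_of_isPos b hγ hα) (by lia)).resolve_left (by lia)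

open scoped Classical in
/-- If `⟨γ, α₀^∨⟩ < -1` for a member `α₀` of an orthogonal greedy decomposition, then the products
of `γ` with the other members are as in the simply laced case. -/
theorem IsGreedyDeg.pairingIn_of_le (hl : IsGreedyDeg b e l)
    (ho : l.Pairwise fun α β ↦ P.pairingIn ℤ α β = 0) {α₀ α γ : ι} (hα₀ : α₀ ∈ l) (hα : α ∈ l)
    (hne : α ≠ α₀) (hγ : b.IsPos γ) (h : P.pairingIn ℤ γ α₀ ≤ -2) :
    P.pairingIn ℤ α γ = P.pairingIn ℤ γ α ∧ (P.pairingIn ℤ γ α = -1 ∨ P.pairingIn ℤ γ α = 0 ∨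
      P.pairingIn ℤ γ α = 1) := by
  have pα₀ := hl.isPos α₀ hα₀
  have pα := hl.isPos α hα
  have h0 := pairingIn_eq_neg_one_of_le pα₀ hγ h
  have horth : P.pairingIn ℤ α α₀ = 0 := pairingIn_eq_zero_of_pairwise ho hα hα₀ hne
  have hγα : γ ≠ α := by rintro rfl; lia
  have hmem := pairingIn_mem hγα (root_ne_neg_of_isPos b hγ pα)
  have hB := sum_pairingIn_mul_lt_or (b := b) (T := {α₀, α}) (by
    intro β hβ δ hδ
    refine pairingIn_eq_zero_of_pairwise ho ?_ ?_
    · rcases Finset.mem_insert.1 hβ with rfl | hβ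
      · exact hα₀
      · rwa [Finset.mem_singleton.1 hβ]
    · rcases Finset.mem_insert.1 hδ with rfl | hδ
      · exact hα₀
      · rwa [Finset.mem_singleton.1 hδ]) γ
  simp only [Finset.sum_pair hne.symm, h0] at hB
  by_contra hcon
  -- the remaining values are those with `⟨γ, α^∨⟩⟨α, γ^∨⟩ ≥ 2`
  obtain ⟨hprod, hsign⟩ : 2 ≤ P.pairingIn ℤ γ α * P.pairingIn ℤ α γ ∧
      (P.pairingIn ℤ γ α < 0 ∨ P.pairingIn ℤ γ α = 1 ∨ P.pairingIn ℤ γ α = 2 ∨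
        P.pairingIn ℤ γ α = 3) := by
    simp only [Set.mem_insert_iff, Set.mem_singleton_iff, Prod.mk.injEq] at hmem
    rcases hmem with h | h | h | h | h | h | h | h | h | h | h <;> rw [h.1, h.2] at hcon ⊢ <;>
      revert hcon <;> decide
  obtain ⟨hB1, hB2, hB3⟩ := hB.resolve_left (by lia)
  have hp0 : P.pairingIn ℤ γ α₀ = -2 := by lia
  have hp : P.pairingIn ℤ γ α * P.pairingIn ℤ α γ = 2 := by lia
  rw [hp0] at hB2
  rcases hsign with hs | hs | hs | hs
  · obtain ⟨σ, hσ⟩ := exists_rootCoeff_pos b pα₀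
    have h1 := (isPos_iff_rootCoeff_nonneg b).1 hγ σ
    have h2 := (isPos_iff_rootCoeff_nonneg b).1 pα σ
    have h3 := hB2 σ
    simp only [Pi.zero_apply] at h1 h2
    nlinarith
  · -- `γ + α₀ = α / 2` would be a root
    have hδ (σ) : rootCoeff b α σ = 2 * rootCoeff b (P.reflectionPerm γ α₀) σ := by
      rw [rootCoeff_reflectionPerm, h0]
      have h3 := hB2 σ
      rw [hs] at h3
      simp only [Pi.sub_apply, Pi.smul_apply, smul_eq_mul]
      lia
    set δ := P.reflectionPerm γ α₀
    have hpair (k : ι) : P.pairingIn ℤ α k = 2 * P.pairingIn ℤ δ k := by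
      rw [pairingIn_eq_sum_rootCoeff b α, pairingIn_eq_sum_rootCoeff b δ, Finset.mul_sum]
      refine Finset.sum_congr rfl fun σ _ ↦ ?_
      rw [hδ σ, mul_assoc]
    have h4 := hpair α
    have h5 := hpair δ
    rw [P.pairingIn_same] at h4 h5
    have h6 := P.pairingIn_pairingIn_mem_set_of_isCrystal_of_isRed α δ
    simp only [Set.mem_insert_iff, Set.mem_singleton_iff, Prod.mk.injEq] at h6
    omega
  · -- `γ + 2 α₀ = α + α₀` is a root with coroot `(α^∨ + α₀^∨) / 2`
    have hp' : P.pairingIn ℤ α γ = 1 := by rw [hs] at hp; lia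
    have hβr : rootCoeff b (P.reflectionPerm α₀ γ) = rootCoeff b α + rootCoeff b α₀ := by
      ext σ
      rw [rootCoeff_reflectionPerm, hp0]
      have h3 := hB2 σ
      rw [hs] at h3
      simp only [Pi.sub_apply, Pi.add_apply, Pi.smul_apply, smul_eq_mul]
      lia
    have n₀ := (isPos_iff_rootCoeff_nonneg b).1 pα₀
    have n := (isPos_iff_rootCoeff_nonneg b).1 pα
    have hmemS := hl.mem_of_corootCoeff_le_sum (nodup_of_pairwise ho) (S := {α₀, α})
      (β := P.reflectionPerm α₀ γ) (by simp) (by simp [hα₀, hα]) (by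
        rw [Finset.sum_pair hne.symm, corootCoeff_reflectionPerm, h0]
        intro σ
        have h3 := hB3 σ
        have h4 := corootCoeff_nonneg b pα₀ σ
        have h5 := corootCoeff_nonneg b pα σ
        rw [hp'] at h3
        simp only [Pi.sub_apply, Pi.add_apply, Pi.smul_apply, smul_eq_mul, Pi.zero_apply]
          at h4 h5 ⊢
        lia) (by
        intro β hβ
        rw [hβr]
        rcases Finset.mem_insert.1 hβ with rfl | hβ
        · exact le_add_of_nonneg_left n
        · rw [Finset.mem_singleton.1 hβ]
          exact le_add_of_nonneg_right n₀)
    rcases Finset.mem_insert.1 hmemS with hβ | hβ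
    · rw [hβ, right_eq_add] at hβr
      exact rootCoeff_ne_zero_of_isPos pα hβr
    · rw [Finset.mem_singleton.1 hβ, left_eq_add] at hβr
      exact rootCoeff_ne_zero_of_isPos pα₀ hβr
  · rw [hs] at hp
    lia

open scoped Classical in
/-- If, besides `α₀` with `⟨γ, α₀^∨⟩ < -1`, two further members `α₁`, `α₂` of an orthogonal greedy
decomposition are not orthogonal to `γ`, then `γ` is a combination of these three roots. -/
theorem IsGreedyDeg.two_mul_rootCoeff (hl : IsGreedyDeg b e l)
    (ho : l.Pairwise fun α β ↦ P.pairingIn ℤ α β = 0) {α₀ α₁ α₂ γ : ι} (hα₀ : α₀ ∈ l)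
    (hα₁ : α₁ ∈ l) (hα₂ : α₂ ∈ l) (h10 : α₁ ≠ α₀) (h20 : α₂ ≠ α₀) (h12 : α₁ ≠ α₂)
    (hγ : b.IsPos γ) (h : P.pairingIn ℤ γ α₀ ≤ -2) (h1 : P.pairingIn ℤ γ α₁ ≠ 0)
    (h2 : P.pairingIn ℤ γ α₂ ≠ 0) :
    P.pairingIn ℤ γ α₀ = -2 ∧
    (∀ σ, 2 * rootCoeff b γ σ = -2 * rootCoeff b α₀ σ +
      (P.pairingIn ℤ γ α₁ * rootCoeff b α₁ σ + P.pairingIn ℤ γ α₂ * rootCoeff b α₂ σ)) ∧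
    ∀ σ, 2 * corootCoeff b γ σ = -corootCoeff b α₀ σ +
      (P.pairingIn ℤ γ α₁ * corootCoeff b α₁ σ + P.pairingIn ℤ γ α₂ * corootCoeff b α₂ σ) := by
  have h0 := pairingIn_eq_neg_one_of_le (hl.isPos α₀ hα₀) hγ h
  obtain ⟨e1, c1⟩ := hl.pairingIn_of_le ho hα₀ hα₁ h10 hγ h
  obtain ⟨e2, c2⟩ := hl.pairingIn_of_le ho hα₀ hα₂ h20 hγ h
  have hB := sum_pairingIn_mul_lt_or (b := b) (T := {α₀, α₁, α₂}) (by
    have hmem : ∀ β ∈ ({α₀, α₁, α₂} : Finset ι), β ∈ l := by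
      intro β hβ
      simp only [Finset.mem_insert, Finset.mem_singleton] at hβ
      rcases hβ with rfl | rfl | rfl <;> assumption
    exact fun β hβ δ hδ ↦ pairingIn_eq_zero_of_pairwise ho (hmem β hβ) (hmem δ hδ)) γ
  have hnot : α₀ ∉ ({α₁, α₂} : Finset ι) := by
    simp only [Finset.mem_insert, Finset.mem_singleton, not_or]
    exact ⟨h10.symm, h20.symm⟩
  simp only [Finset.sum_insert hnot, Finset.sum_pair h12, h0, e1, e2] at hB
  have s1 : P.pairingIn ℤ γ α₁ * P.pairingIn ℤ γ α₁ = 1 := by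
    rcases c1 with h | h | h
    · rw [h]; rfl
    · exact absurd h h1
    · rw [h]; rfl
  have s2 : P.pairingIn ℤ γ α₂ * P.pairingIn ℤ γ α₂ = 1 := by
    rcases c2 with h | h | h
    · rw [h]; rfl
    · exact absurd h h2
    · rw [h]; rfl
  rw [s1, s2] at hB
  obtain ⟨hB1, hB2, hB3⟩ := hB.resolve_left (by lia)
  have hp0 : P.pairingIn ℤ γ α₀ = -2 := by lia
  rw [hp0] at hB2
  exact ⟨hp0, hB2, fun σ ↦ by rw [hB3 σ, neg_one_mul]⟩

theorem mem_leviPosRoots_of_le {J : Set b.support} {γ α : ι} (hγ : γ ∈ leviPosRoots b J)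
    (hα : b.IsPos α) (hle : rootCoeff b α ≤ rootCoeff b γ) : α ∈ leviPosRoots b J := by
  refine ⟨hα, mem_leviRoots_iff.2 fun σ hσ ↦ le_antisymm ?_ ?_⟩
  · rw [← mem_leviRoots_iff.1 hγ.2 σ hσ]
    exact hle σ
  · exact (isPos_iff_rootCoeff_nonneg b).1 hα σ

open scoped Classical in
/-- Uniqueness of the associated root. -/
theorem IsGreedyDeg.eq_of_pairingIn_pos (hl : IsGreedyDeg b e l)
    (ho : l.Pairwise fun α β ↦ P.pairingIn ℤ α β = 0) {J : Set b.support} {α₀ α₁ α₂ γ : ι}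
    (hα₀ : α₀ ∈ l) (hα₁ : α₁ ∈ l) (hα₂ : α₂ ∈ l) (hγ : γ ∈ leviPosRoots b J)
    (h : P.pairingIn ℤ γ α₀ ≤ -2) (hJ₁ : α₁ ∉ leviPosRoots b J) (hJ₂ : α₂ ∉ leviPosRoots b J)
    (h1 : 0 < P.pairingIn ℤ γ α₁) (h2 : 0 < P.pairingIn ℤ γ α₂) : α₁ = α₂ := by
  by_contra h12
  have h10 : α₁ ≠ α₀ := by rintro rfl; lia
  have h20 : α₂ ≠ α₀ := by rintro rfl; lia
  have p₀ := hl.isPos α₀ hα₀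
  have p₁ := hl.isPos α₁ hα₁
  have p₂ := hl.isPos α₂ hα₂
  have h0 := pairingIn_eq_neg_one_of_le p₀ hγ.1 h
  obtain ⟨e1, c1⟩ := hl.pairingIn_of_le ho hα₀ hα₁ h10 hγ.1 h
  obtain ⟨e2, c2⟩ := hl.pairingIn_of_le ho hα₀ hα₂ h20 hγ.1 h
  have v1 : P.pairingIn ℤ γ α₁ = 1 := by lia
  have v2 : P.pairingIn ℤ γ α₂ = 1 := by lia
  obtain ⟨hp0, hr, hc⟩ := hl.two_mul_rootCoeff ho hα₀ hα₁ hα₂ h10 h20 h12 hγ.1 h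
    (by lia) (by lia)
  simp only [v1, v2, one_mul] at hr hc
  -- the root `α - γ - 2 α₀` for `α = α₁` and `α = α₂`
  have heps {α α' : ι} (hα : α ∈ l) (h0α : α ≠ α₀) (pα' : b.IsPos α')
      (hJ' : α' ∉ leviPosRoots b J) (eα : P.pairingIn ℤ α γ = 1)
      (hr' : ∀ σ, 2 * rootCoeff b γ σ = -2 * rootCoeff b α₀ σ +
        (rootCoeff b α σ + rootCoeff b α' σ)) :
      rootCoeff b α ≤ rootCoeff b (P.reflectionPerm α₀ γ) := by
    have hpair : P.pairingIn ℤ (P.reflectionPerm γ α) α₀ = 2 := by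
      rw [pairingIn_eq_sum_rootCoeff b]
      simp only [rootCoeff_reflectionPerm, Pi.sub_apply, Pi.smul_apply, smul_eq_mul, eα, one_mul,
        sub_mul, Finset.sum_sub_distrib]
      rw [← pairingIn_eq_sum_rootCoeff b, ← pairingIn_eq_sum_rootCoeff b, hp0,
        pairingIn_eq_zero_of_pairwise ho hα hα₀ h0α]
      rfl
    have hε (σ) : rootCoeff b (P.reflectionPerm α₀ (P.reflectionPerm γ α)) σ =
        rootCoeff b α σ - rootCoeff b γ σ - 2 * rootCoeff b α₀ σ := by
      rw [rootCoeff_reflectionPerm, hpair, rootCoeff_reflectionPerm, eα, one_smul]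
      rfl
    rcases rootCoeff_nonneg_or_nonpos b (P.reflectionPerm α₀ (P.reflectionPerm γ α)) with h' | h'
    · refine absurd (mem_leviPosRoots_of_le hγ pα' fun σ ↦ ?_) hJ'
      have h3 := h' σ
      have h4 := hr' σ
      rw [hε] at h3
      simp only [Pi.zero_apply] at h3
      lia
    · intro σ
      have h3 := h' σ
      rw [hε] at h3
      rw [rootCoeff_reflectionPerm, hp0]
      simp only [Pi.zero_apply, Pi.sub_apply, Pi.smul_apply, smul_eq_mul] at h3 ⊢
      lia
  have hle₁ := heps hα₁ h10 p₂ hJ₂ (by lia) hr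
  have hle₂ := heps hα₂ h20 p₁ hJ₁ (by lia) fun σ ↦ by rw [hr σ]; ring
  set β := P.reflectionPerm α₀ γ
  have hβr (σ) : 2 * rootCoeff b β σ =
      2 * rootCoeff b α₀ σ + rootCoeff b α₁ σ + rootCoeff b α₂ σ := by
    have := hr σ
    rw [rootCoeff_reflectionPerm, hp0]
    simp only [Pi.sub_apply, Pi.smul_apply, smul_eq_mul]
    lia
  have hβpair : P.pairingIn ℤ β α₀ = 2 := by
    rw [← P.pairingIn_reflectionPerm, P.pairingIn_reflectionPerm_self_right, hp0]
    rfl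
  have n₁ := (isPos_iff_rootCoeff_nonneg b).1 p₁
  have n₂ := (isPos_iff_rootCoeff_nonneg b).1 p₂
  have hnot : α₀ ∉ ({α₁, α₂} : Finset ι) := by
    simp only [Finset.mem_insert, Finset.mem_singleton, not_or]
    exact ⟨h10.symm, h20.symm⟩
  have hmemS := hl.mem_of_corootCoeff_le_sum (nodup_of_pairwise ho) (S := {α₀, α₁, α₂})
    (β := β) (by simp) (by simp [hα₀, hα₁, hα₂]) (by
      rw [Finset.sum_insert hnot, Finset.sum_pair h12, corootCoeff_reflectionPerm, h0]
      intro σ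
      have h3 := hc σ
      have h4 := corootCoeff_nonneg b p₀ σ
      have h5 := corootCoeff_nonneg b p₁ σ
      have h6 := corootCoeff_nonneg b p₂ σ
      simp only [Pi.sub_apply, Pi.add_apply, Pi.smul_apply, smul_eq_mul, Pi.zero_apply]
        at h4 h5 h6 ⊢
      lia) (by
      intro δ hδ
      simp only [Finset.mem_insert, Finset.mem_singleton] at hδ
      rcases hδ with rfl | rfl | rfl
      · intro σ
        have h3 := hβr σ
        have h4 := n₁ σ
        have h5 := n₂ σ
        simp only [Pi.zero_apply] at h4 h5
        lia
      · exact hle₁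
      · exact hle₂)
  simp only [Finset.mem_insert, Finset.mem_singleton] at hmemS
  rcases hmemS with hβ | hβ | hβ
  · obtain ⟨σ, hσ⟩ := exists_rootCoeff_pos b p₁
    have h3 := hβr σ
    have h5 := n₂ σ
    rw [hβ] at h3
    simp only [Pi.zero_apply] at h5
    lia
  · rw [hβ, pairingIn_eq_zero_of_pairwise ho hα₁ hα₀ h10] at hβpair
    lia
  · rw [hβ, pairingIn_eq_zero_of_pairwise ho hα₂ hα₀ h20] at hβpair
    lia

end Cascade

/-! ### Associated pairs -/

section Associated

variable {b : P.Base} [Fintype ι] [P.IsRootSystem] [P.IsCrystallographic] [P.IsReduced]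
  {e : b.support → ℤ} {l : List ι} {J : Set b.support}

open scoped Classical in
theorem prod_map_ofIdx_smul_root (ho : l.Pairwise fun α β ↦ P.pairingIn ℤ α β = 0) (γ : ι) :
    (l.map 𝐬).prod • P.root γ =
      P.root γ - ∑ α ∈ l.toFinset, P.pairingIn ℤ γ α • P.root α := by
  rw [prod_map_ofIdx_smul ho, List.sum_toFinset _ (nodup_of_pairwise ho)]
  congr 2
  refine List.map_congr_left fun α _ ↦ ?_
  rw [P.root_coroot'_eq_pairing, ← cast_pairingIn, Int.cast_smul_eq_zsmul]

theorem prod_map_ofIdx_smul_of_mem (ho : l.Pairwise fun α β ↦ P.pairingIn ℤ α β = 0) {α : ι}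
    (hα : α ∈ l) : (l.map 𝐬).prod • P.root α = -P.root α := by
  classical
  rw [prod_map_ofIdx_smul_root ho, Finset.sum_eq_single α, P.pairingIn_same, two_smul]
  · abel
  · intro β hβ hne
    rw [pairingIn_eq_zero_of_pairwise ho hα (List.mem_toFinset.1 hβ) hne.symm, zero_smul]
  · exact fun h ↦ (h (List.mem_toFinset.2 hα)).elim

theorem prod_map_ofIdx_smul_smul (ho : l.Pairwise fun α β ↦ P.pairingIn ℤ α β = 0) (γ : ι) :
    (l.map 𝐬).prod • (l.map 𝐬).prod • P.root γ = P.root γ := by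
  classical
  conv_lhs => rw [prod_map_ofIdx_smul_root ho γ, smul_sub, prod_map_ofIdx_smul_root ho γ]
  rw [Finset.smul_sum, sub_sub, sub_eq_self, ← Finset.sum_add_distrib]
  refine Finset.sum_eq_zero fun α hα ↦ ?_
  rw [smul_comm, prod_map_ofIdx_smul_of_mem ho (List.mem_toFinset.1 hα), smul_neg,
    add_neg_cancel]

open scoped Classical in
theorem rootCoeff_prod_map_ofIdx (ho : l.Pairwise fun α β ↦ P.pairingIn ℤ α β = 0) (γ : ι)
    (σ : b.support) :
    rootCoeff b (P.weylGroupToPerm (l.map 𝐬).prod γ) σ =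
      rootCoeff b γ σ - ∑ α ∈ l.toFinset, P.pairingIn ℤ γ α * rootCoeff b α σ := by
  have h1 := prod_map_ofIdx_smul_root ho γ
  rw [P.weylGroup_apply_root] at h1
  have h2 := rootCoeff_congr b h1 σ
  rw [map_sub, map_sum, toWeightBasis_coord_root] at h2
  have h3 : (rootCoeff b (P.weylGroupToPerm (l.map 𝐬).prod γ) σ : ℝ) =
      rootCoeff b γ σ - ∑ α ∈ l.toFinset, (P.pairingIn ℤ γ α : ℝ) * rootCoeff b α σ := by
    rw [h2]
    congr 1
    refine Finset.sum_congr rfl fun α _ ↦ ?_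
    rw [map_zsmul, toWeightBasis_coord_root, zsmul_eq_mul]
  exact_mod_cast h3

theorem exists_rootCoeff_pos_of_notMem {α : ι} (hα : b.IsPos α) (hJ : α ∉ leviPosRoots b J) :
    ∃ τ ∉ J, 0 < rootCoeff b α τ := by
  by_contra! h
  exact hJ ⟨hα, mem_leviRoots_iff.2 fun σ hσ ↦
    le_antisymm (h σ hσ) ((isPos_iff_rootCoeff_nonneg b).1 hα σ)⟩

theorem mul_rootCoeff_nonpos {α : ι} {n : ℤ} {τ : b.support} (hα : b.IsPos α) (hτ : τ ∉ J)
    (h : α ∉ leviPosRoots b J → n ≤ 0) : n * rootCoeff b α τ ≤ 0 := by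
  by_cases hJ : α ∈ leviPosRoots b J
  · rw [mem_leviRoots_iff.1 hJ.2 τ hτ, mul_zero]
  · exact mul_nonpos_of_nonpos_of_nonneg (h hJ) ((isPos_iff_rootCoeff_nonneg b).1 hα τ)

/-- Existence of the associated root: otherwise `z_e(γ)` would have a positive coefficient on a
simple root outside `Δ_P` that occurs in `α₀`. -/
theorem IsGreedyDeg.exists_pairingIn_pos (hl : IsGreedyDeg b e l)
    (ho : l.Pairwise fun α β ↦ P.pairingIn ℤ α β = 0) {α₀ γ : ι} (hα₀ : α₀ ∈ l)
    (hJ : α₀ ∉ leviPosRoots b J) (hγ : γ ∈ leviPosRoots b J) (h : P.pairingIn ℤ γ α₀ ≤ -2)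
    (hz : ¬ b.IsPos (P.weylGroupToPerm (l.map 𝐬).prod γ)) :
    ∃ α ∈ l, α ∉ leviPosRoots b J ∧ 0 < P.pairingIn ℤ γ α := by
  classical
  by_contra! hcon
  obtain ⟨τ, hτ, hpos⟩ := exists_rootCoeff_pos_of_notMem (hl.isPos α₀ hα₀) hJ
  have h1 := (not_isPos_iff_rootCoeff_nonpos b).1 hz τ
  rw [rootCoeff_prod_map_ofIdx ho, mem_leviRoots_iff.1 hγ.2 τ hτ] at h1
  have h2 : ∑ α ∈ l.toFinset, P.pairingIn ℤ γ α * rootCoeff b α τ < 0 := by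
    refine Finset.sum_neg' (fun α hα ↦ ?_) ⟨α₀, List.mem_toFinset.2 hα₀, ?_⟩
    · have hα := List.mem_toFinset.1 hα
      exact mul_rootCoeff_nonpos (hl.isPos α hα) hτ (hcon α hα)
    · exact mul_neg_of_neg_of_pos (by lia) hpos
  simp only [Pi.zero_apply] at h1
  lia

/-- The root `α' - γ'` is positive and lies outside the Levi factor. -/
theorem IsGreedyDeg.reflectionPerm_mem_nonLeviPosRoots (hl : IsGreedyDeg b e l)
    (ho : l.Pairwise fun α β ↦ P.pairingIn ℤ α β = 0) {α₀ α γ : ι} (hα₀ : α₀ ∈ l) (hα : α ∈ l)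
    (hJ₀ : α₀ ∉ leviPosRoots b J) (hJ : α ∉ leviPosRoots b J) (hγ : γ ∈ leviPosRoots b J)
    (h : P.pairingIn ℤ γ α₀ ≤ -2) (hpos : 0 < P.pairingIn ℤ γ α) :
    ∃ i ∈ nonLeviPosRoots b J, P.root i = P.root α + (l.map 𝐬).prod • P.root γ := by
  classical
  have hne : α ≠ α₀ := by rintro rfl; lia
  obtain ⟨-, hv⟩ := hl.pairingIn_of_le ho hα₀ hα hne hγ.1 h
  have hv1 : P.pairingIn ℤ γ α = 1 := by lia
  obtain ⟨τ, hτ, hτpos⟩ := exists_rootCoeff_pos_of_notMem (hl.isPos α₀ hα₀) hJ₀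
  set i := P.weylGroupToPerm (l.map 𝐬).prod (P.reflectionPerm α γ)
  have hroot : P.root i = P.root α + (l.map 𝐬).prod • P.root γ := by
    rw [← P.weylGroup_apply_root, P.root_reflectionPerm, P.reflection_apply_root,
      ← cast_pairingIn, hv1, Int.cast_one, one_smul, smul_sub, prod_map_ofIdx_smul_of_mem ho hα,
      sub_neg_eq_add, add_comm]
  have hmemα := List.mem_toFinset.2 hα
  have hcoeff : 0 < rootCoeff b i τ := by
    have h1 := rootCoeff_prod_map_ofIdx ho γ τ
    rw [mem_leviRoots_iff.1 hγ.2 τ hτ, ← Finset.add_sum_erase _ _ hmemα, hv1] at h1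
    have h2 : rootCoeff b i τ =
        rootCoeff b α τ + rootCoeff b (P.weylGroupToPerm (l.map 𝐬).prod γ) τ := by
      have h3 := rootCoeff_congr b hroot τ
      rw [P.weylGroup_apply_root, map_add, toWeightBasis_coord_root,
        toWeightBasis_coord_root] at h3
      exact_mod_cast h3
    have h3 : ∑ β ∈ l.toFinset.erase α, P.pairingIn ℤ γ β * rootCoeff b β τ < 0 := by
      refine Finset.sum_neg' (fun β hβ ↦ ?_)
        ⟨α₀, Finset.mem_erase.2 ⟨hne.symm, List.mem_toFinset.2 hα₀⟩, ?_⟩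
      · obtain ⟨hβα, hβ⟩ := Finset.mem_erase.1 hβ
        have hβ := List.mem_toFinset.1 hβ
        refine mul_rootCoeff_nonpos (hl.isPos β hβ) hτ fun hJβ ↦ ?_
        by_contra! hβpos
        exact hβα (hl.eq_of_pairingIn_pos ho hα₀ hβ hα hγ h hJβ hJ hβpos hpos)
      · exact mul_neg_of_neg_of_pos (by lia) hτpos
    lia
  refine ⟨i, ⟨?_, fun hi ↦ ?_⟩, hroot⟩
  · by_contra hneg
    exact absurd ((not_isPos_iff_rootCoeff_nonpos b).1 hneg τ) (not_le.2 hcoeff)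
  · rw [mem_leviRoots_iff.1 hi.2 τ hτ] at hcoeff
    exact lt_irrefl _ hcoeff

theorem pairingIn_sub_of_root_sub {i j k m : ι} (h : P.root i - P.root j = P.root k - P.root m)
    (n : ι) :
    P.pairingIn ℤ i n - P.pairingIn ℤ j n = P.pairingIn ℤ k n - P.pairingIn ℤ m n := by
  have h1 := congrArg (P.coroot' n) h
  simp only [map_sub, P.root_coroot'_eq_pairing, ← cast_pairingIn] at h1
  exact_mod_cast h1

/-- Injectivity of the assignment of tangent directions. -/
theorem IsGreedyDeg.eq_of_add_smul_eq (hl : IsGreedyDeg b e l)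
    (ho : l.Pairwise fun α β ↦ P.pairingIn ℤ α β = 0) {α₁ α₂ β₁ β₂ γ₁ γ₂ : ι}
    (hα₁ : α₁ ∈ l) (hα₂ : α₂ ∈ l) (hβ₁ : β₁ ∈ l) (hβ₂ : β₂ ∈ l)
    (hγ₁ : b.IsPos γ₁) (hγ₂ : b.IsPos γ₂)
    (h₁ : P.pairingIn ℤ γ₁ α₁ ≤ -2) (h₂ : P.pairingIn ℤ γ₂ α₂ ≤ -2)
    (hpos₁ : 0 < P.pairingIn ℤ γ₁ β₁) (hpos₂ : 0 < P.pairingIn ℤ γ₂ β₂)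
    (heq : P.root β₁ + (l.map 𝐬).prod • P.root γ₁ = P.root β₂ + (l.map 𝐬).prod • P.root γ₂) :
    α₁ = α₂ ∧ γ₁ = γ₂ := by
  have hsub : P.root γ₁ - P.root γ₂ = P.root β₁ - P.root β₂ := by
    have h := congrArg ((l.map 𝐬).prod • ·) heq
    simp only [smul_add, prod_map_ofIdx_smul_smul ho, prod_map_ofIdx_smul_of_mem ho hβ₁,
      prod_map_ofIdx_smul_of_mem ho hβ₂] at h
    rw [eq_add_of_neg_add_eq h]
    abel
  have hb₁ : β₁ ≠ α₁ := by rintro rfl; lia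
  have hb₂ : β₂ ≠ α₂ := by rintro rfl; lia
  by_cases hβ : β₁ = β₂
  · have hγ : γ₁ = γ₂ := by
      rw [hβ, sub_self, sub_eq_zero] at hsub
      exact P.root.injective hsub
    refine ⟨?_, hγ⟩
    by_contra hα
    obtain ⟨-, hv⟩ := hl.pairingIn_of_le ho hα₁ hα₂ (Ne.symm hα) hγ₁ h₁
    rw [hγ] at hv
    lia
  · exfalso
    have v₁ : P.pairingIn ℤ γ₁ β₁ = 1 := by
      have := (hl.pairingIn_of_le ho hα₁ hβ₁ hb₁ hγ₁ h₁).2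
      lia
    have v₂ : P.pairingIn ℤ γ₂ β₂ = 1 := by
      have := (hl.pairingIn_of_le ho hα₂ hβ₂ hb₂ hγ₂ h₂).2
      lia
    have o₁ := pairingIn_eq_zero_of_pairwise ho hβ₁ hβ₂ hβ
    have o₂ := pairingIn_eq_zero_of_pairwise ho hβ₂ hβ₁ (Ne.symm hβ)
    have w₁ := pairingIn_sub_of_root_sub hsub β₂
    have w₂ := pairingIn_sub_of_root_sub hsub β₁
    rw [P.pairingIn_same] at w₁ w₂
    have u₁ : P.pairingIn ℤ γ₁ β₂ = -1 := by lia
    have u₂ : P.pairingIn ℤ γ₂ β₁ = -1 := by lia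
    obtain ⟨-, r₁, -⟩ := hl.two_mul_rootCoeff ho hα₁ hβ₁ hβ₂ hb₁ (by rintro rfl; lia) hβ hγ₁ h₁
      (by lia) (by lia)
    obtain ⟨-, r₂, -⟩ := hl.two_mul_rootCoeff ho hα₂ hβ₁ hβ₂ (by rintro rfl; lia) hb₂ hβ hγ₂ h₂
      (by lia) (by lia)
    -- now `γ₁ + γ₂ = -(α₁ + α₂)`
    obtain ⟨σ, hσ⟩ := exists_rootCoeff_pos b (hl.isPos α₁ hα₁)
    have p := (isPos_iff_rootCoeff_nonneg b).1 (hl.isPos α₂ hα₂) σ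
    have p₁ := (isPos_iff_rootCoeff_nonneg b).1 hγ₁ σ
    have p₂ := (isPos_iff_rootCoeff_nonneg b).1 hγ₂ σ
    have r₁ := r₁ σ
    have r₂ := r₂ σ
    rw [v₁, u₁] at r₁
    rw [v₂, u₂] at r₂
    simp only [Pi.zero_apply] at p p₁ p₂
    lia

end Associated

end MinimalDegrees

open MinimalDegrees in
theorem corollary5p7 {ι M N : Type*} [Fintype ι] [AddCommGroup M] [Module ℝ M]
    [AddCommGroup N] [Module ℝ N] (P : RootPairing ι ℝ M N) [P.IsRootSystem]
    [P.IsCrystallographic] [P.IsReduced] [P.IsIrreducible] (b : P.Base) (J : Set b.support)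
    (d : MinimalDegrees.H2 b J) (hd : MinimalDegrees.IsMinimalDegree b J d)
    (e : MinimalDegrees.H2 b ∅) (he : MinimalDegrees.IsLifting b J d e) :
    (∀ p ∈ MinimalDegrees.specialPairs b J e, ∃! q, MinimalDegrees.IsAssociated b J e p q) ∧
    ∃ f : MinimalDegrees.specialPairs b J e ≃ MinimalDegrees.additionalTangentDirections b J e,
      ∀ (p : MinimalDegrees.specialPairs b J e) (q : ι × ι),
        MinimalDegrees.IsAssociated b J e p q → (f p : M) = -P.root q.1 + P.root q.2 := by
  obtain ⟨e, rfl⟩ := ofDeg_surjective b e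
  have he0 : 0 ≤ e := (isDegree_ofDeg b).1 he.1.1
  have hmin : IsMinDeg b e := fun e' h0 hle hz ↦ he.1.eq_of_le b h0 hle hz
  obtain ⟨l, hl⟩ := exists_isGreedyDeg he0
  have ho := hmin.pairwise hl
  have hzprod : z b ∅ (ofDeg b e) = (l.map (RootPairing.weylGroup.ofIdx P)).prod := by
    rw [z_ofDeg b he0, hmin.maxElt_eq_prod hl]
  set w := (l.map (RootPairing.weylGroup.ofIdx P)).prod with hw
  have hcasc {i : ι} : i ∈ cascade b (ofDeg b e) ↔ i ∈ l := by
    rw [mem_cascade_ofDeg]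
    exact ⟨fun ⟨l', hl', hi⟩ ↦ (hl'.perm hl).mem_iff.1 hi, fun hi ↦ ⟨l, hl, hi⟩⟩
  have hneg {γ : ι} (hγ : γ ∈ leviPosRoots b J) : ¬ b.IsPos (P.weylGroupToPerm w γ) := by
    have h := he.2
    rw [z, inv_mul_cancel_right] at h
    rw [← hzprod, ← h]
    exact not_isPos_hecke_longest _ hγ
  have hspec {p : ι × ι} (hp : p ∈ specialPairs b J (ofDeg b e)) : p.1 ∈ l ∧
      p.1 ∉ leviPosRoots b J ∧ p.2 ∈ leviPosRoots b J ∧ P.pairingIn ℤ p.2 p.1 ≤ -2 := by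
    obtain ⟨⟨h1, h2⟩, h3, h4⟩ := hp
    rw [← cast_pairingIn] at h4
    have h5 : P.pairingIn ℤ p.2 p.1 < -1 := by exact_mod_cast h4
    exact ⟨hcasc.1 h1, h2, h3, by lia⟩
  have hassoc {p q : ι × ι} (h : IsAssociated b J (ofDeg b e) p q) : q.1 ∈ l ∧
      q.1 ∉ leviPosRoots b J ∧ 0 < P.pairingIn ℤ p.2 q.1 ∧ P.root q.2 = -(w • P.root p.2) :=
    ⟨hcasc.1 h.fst_mem'.1, h.fst_mem'.2, pairingIn_pos_comm.1 (rootForm_pos_iff.1 h.form_pos'),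
      by rw [h.snd_eq', hzprod]⟩
  have hexu : ∀ p ∈ specialPairs b J (ofDeg b e), ∃! q, IsAssociated b J (ofDeg b e) p q := by
    intro p hp
    obtain ⟨h1, h2, h3, h4⟩ := hspec hp
    obtain ⟨α, hα, hJ, hpos⟩ := hl.exists_pairingIn_pos ho h1 h2 h3 h4 (hneg h3)
    refine ⟨(α, P.reflectionPerm (P.weylGroupToPerm w p.2) (P.weylGroupToPerm w p.2)), ?_, ?_⟩
    · refine ⟨hp.1, h3, rootForm_neg_of_pairingIn_neg (pairingIn_neg_comm.1 (by lia)),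
        ⟨hcasc.2 hα, hJ⟩, rootForm_pos_iff.2 (pairingIn_pos_comm.1 hpos), ?_⟩
      rw [hzprod, P.root_reflectionPerm, P.reflection_apply_self, P.weylGroup_apply_root]
    · rintro q hq
      obtain ⟨g1, g2, g3, g4⟩ := hassoc hq
      refine Prod.ext (hl.eq_of_pairingIn_pos ho h1 g1 hα h3 h4 g2 hJ g3 hpos) ?_
      apply P.root.injective
      rw [g4, P.root_reflectionPerm, P.reflection_apply_self, P.weylGroup_apply_root]
  refine ⟨hexu, ?_⟩
  have hmem (p : specialPairs b J (ofDeg b e)) {q : ι × ι}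
      (hq : IsAssociated b J (ofDeg b e) p q) :
      -P.root q.1 + P.root q.2 ∈ additionalTangentDirections b J (ofDeg b e) := by
    obtain ⟨h1, h2, h3, h4⟩ := hspec p.2
    obtain ⟨g1, g2, g3, g4⟩ := hassoc hq
    obtain ⟨i, hi, hroot⟩ :=
      hl.reflectionPerm_mem_nonLeviPosRoots ho h1 g1 h2 g2 h3 h4 g3
    refine ⟨⟨i, hi, ?_⟩, p, p.2, q, hq, rfl⟩
    rw [g4, hroot, neg_add]
  choose q hq using fun p : specialPairs b J (ofDeg b e) ↦ (hexu p p.2).exists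
  refine ⟨Equiv.ofBijective (fun p ↦ ⟨_, hmem p (hq p)⟩) ⟨?_, ?_⟩, ?_⟩
  · intro p p' h
    have h := congrArg Subtype.val h
    obtain ⟨h1, -, h3, h4⟩ := hspec p.2
    obtain ⟨h1', -, h3', h4'⟩ := hspec p'.2
    obtain ⟨g1, g2, g3, g4⟩ := hassoc (hq p)
    obtain ⟨g1', g2', g3', g4'⟩ := hassoc (hq p')
    simp only [g4, g4', ← neg_add, neg_inj] at h
    obtain ⟨k1, k2⟩ := hl.eq_of_add_smul_eq ho h1 h1' g1 g1' h3.1 h3'.1 h4 h4' g3 g3' h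
    exact Subtype.ext (Prod.ext k1 k2)
  · rintro ⟨x, -, p, hp, q', hq', rfl⟩
    refine ⟨⟨p, hp⟩, Subtype.ext ?_⟩
    have h := (hexu p hp).unique (hq ⟨p, hp⟩) hq'
    change -P.root (q ⟨p, hp⟩).1 + P.root (q ⟨p, hp⟩).2 = -P.root q'.1 + P.root q'.2
    rw [h]
  · intro p q' hq'
    rw [(hexu p p.2).unique hq' (hq p)]
    rfl

end
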